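/- Let $X$ and $\overline{X}$ be Noetherian schemes, $j\colon X\to\overline{X}$ an open immersion, $Z\subseteq X$ a closed subset and $\overline{Z}$ the closure of $j(Z)$ in $\overline{X}$. For a scheme $Y$ let $D(Y)$ be the (unbounded) derived category of $\mathcal{O}_Y$-modules and $D_{\mathrm{qc}}(Y)\subseteq D(Y)$ the full subcategory of complexes with quasi-coherent cohomology sheaves. For a closed subset $W\subseteq Y$ let $D_{\mathrm{qc}}(Y)_W$ be the full subcategory of those $\mathcal{F}^\bullet\in D_{\mathrm{qc}}(Y)$ all of whose cohomology sheaves restrict to zero on $Y\setminus W$. For $Y$ Noetherian and a closed subset $W'\subseteq Y$, let $R\Gamma_{W'}\colon D(Y)\to D(Y)$ be the right derived functor of $\Gamma_{W'}=\varinjlim_n\underline{\mathrm{Hom}}_{\mathcal{O}_Y}(\mathcal{O}_Y/\mathcal{I}^n,-)$, where $\mathcal{I}$ is any quasi-coherent sheaf of ideals with zero locus $W'$, and let $D_{\mathrm{qc}}(Y)_W^{W'}$ be the full subcategory of those $\mathcal{F}^\bullet\in D_{\mathrm{qc}}(Y)_W$ with $R\Gamma_{W'}\mathcal{F}^\bullet\cong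 0$. Then the derived functors $Rj_*\colon D(X)\to D(\overline{X})$ and $R\Gamma_{\overline{Z}\setminus j(X)}\colon D(\overline{X})\to D(\overline{X})$ exist, $Rj_*$ maps $D_{\mathrm{qc}}(X)_Z$ into $D_{\mathrm{qc}}(\overline{X})_{\overline{Z}}^{\overline{Z}\setminus j(X)}$, $j^*$ maps $D_{\mathrm{qc}}(\overline{X})_{\overline{Z}}^{\overline{Z}\setminus j(X)}$ into $D_{\mathrm{qc}}(X)_Z$, and the restricted functors $$Rj_*\colon D_{\mathrm{qc}}(X)_Z\longrightarrow D_{\mathrm{qc}}(\overline{X})_{\overline{Z}}^{\overline{Z}\setminus j(X)},\qquad j^*\colon D_{\mathrm{qc}}(\overline{X})_{\overline{Z}}^{\overline{Z}\setminus j(X)}\longrightarrow D_{\mathrm{qc}}(X)_Z$$ are inverse equivalences of categories. -/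

import Mathlib

open CategoryTheory CategoryTheory.Limits AlgebraicGeometry TopologicalSpace Opposite

universe w w₁ w₂ u

/-! ### Total right derived functors on unbounded derived categories -/

section Derived

variable {A B : Type*} [Category* A] [Category* B] [Abelian A] [Abelian B]
  [HasDerivedCategory.{w₁} A] [HasDerivedCategory.{w₂} B]

/-- The composite `C(A) ⥤ C(B) ⥤ D(B)` induced by an additive functor `F : A ⥤ B`. -/
noncomputable abbrev complexesToDerived (F : A ⥤ B) [F.Additive] :
    CochainComplex A ℤ ⥤ DerivedCategory B :=
  F.mapHomologicalComplex (ComplexShape.up ℤ) ⋙ DerivedCategory.Q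

/-- The additive functor `F : A ⥤ B` has a total right derived functor `D(A) ⥤ D(B)` on the
unbounded derived category. -/
abbrev HasTotalRightDerived (F : A ⥤ B) [F.Additive] : Prop :=
  (complexesToDerived F).HasRightDerivedFunctor
    (HomologicalComplex.quasiIso A (ComplexShape.up ℤ))

/-- The total right derived functor `RF : D(A) ⥤ D(B)` of an additive functor `F : A ⥤ B`. -/
noncomputable def totalRight (F : A ⥤ B) [F.Additive] [HasTotalRightDerived F] :
    DerivedCategory A ⥤ DerivedCategory B :=
  (complexesToDerived F).totalRightDerived DerivedCategory.Q
    (HomologicalComplex.quasiIso A (ComplexShape.up ℤ))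

end Derived

namespace AlgebraicGeometry.Scheme.Modules

/-! ### Exactness of the restriction to an open subscheme -/

section Restrict

variable {X Y : Scheme.{u}} (j : X ⟶ Y) [IsOpenImmersion j]

instance : PreservesLimits (restrictFunctor j) := by
  have e : restrictFunctor j ⋙ toPresheaf X ≅
      toPresheaf Y ⋙ (Functor.whiskeringLeft _ _ Ab).obj j.opensFunctor.op := Iso.refl _
  have : PreservesLimits ((Functor.whiskeringLeft _ _ Ab.{u}).obj j.opensFunctor.op) :=
    ⟨fun {_} _ => inferInstance⟩
  have : PreservesLimits (restrictFunctor j ⋙ toPresheaf X) :=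
    preservesLimits_of_natIso e.symm
  have : ReflectsLimits (toPresheaf X) := reflectsLimits_of_reflectsIsomorphisms
  exact preservesLimits_of_reflects_of_preserves (restrictFunctor j) (toPresheaf X)

instance : PreservesFiniteLimits (restrictFunctor j) :=
  PreservesLimits.preservesFiniteLimits _

instance : (restrictFunctor j).Additive :=
  Functor.additive_of_preserves_binary_products _

/-- `j^* : D(Y) ⥤ D(X)` for an open immersion `j : X ⟶ Y`. It is induced by the exact functor
of restriction of `𝒪_Y`-modules to `X`. -/
noncomputable def derivedRestrict [HasDerivedCategory.{w₁} X.Modules]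
    [HasDerivedCategory.{w₂} Y.Modules] :
    DerivedCategory Y.Modules ⥤ DerivedCategory X.Modules :=
  (restrictFunctor j).mapDerivedCategory

end Restrict

/-! ### Sections supported on a closed subscheme -/

section LocalCohomology

variable {X : Scheme.{u}} (I : X.IdealSheafData)

/-- The section `s` of `M` over `U` is killed by the ideal sheaf `I ^ n`. Such sections over `U`
are the sections over `U` of the sheaf `Hom(𝒪_X / I ^ n, M)`, via evaluation at `1`. -/
def IsKilledByPow {M : X.Modules} (n : ℕ) {U : X.Opens} (s : Γ(M, U)) : Prop :=
  ∀ (W : X.affineOpens) (h : W.1 ≤ U), ∀ f ∈ I.ideal W ^ n,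
    f • M.presheaf.map (homOfLE h).op s = 0

/-- The section `s` of `M` over `U` is locally killed by a power of `I`. Such sections are the
sections over `U` of the subsheaf `⋃ n, Hom(𝒪_X / I ^ n, M)` of `M`, i.e. of the colimit over `n`
of the sheaves `Hom(𝒪_X / I ^ n, M)`. -/
def IsPowerTorsion {M : X.Modules} {U : X.Opens} (s : Γ(M, U)) : Prop :=
  ∀ x ∈ U, ∃ (V : X.Opens) (h : V ≤ U) (n : ℕ), x ∈ V ∧
    IsKilledByPow I n (M.presheaf.map (homOfLE h).op s)

variable {I}

lemma map_map_apply (M : X.Modules) {U V W : X.Opens} (h : V ≤ U) (h' : W ≤ V) (s : Γ(M, U)) :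
    M.presheaf.map (homOfLE h').op (M.presheaf.map (homOfLE h).op s) =
      M.presheaf.map (homOfLE (h'.trans h)).op s := by
  rw [← ConcreteCategory.comp_apply, ← Functor.map_comp]
  rfl

lemma IsKilledByPow.map {M : X.Modules} {n : ℕ} {U V : X.Opens} {s : Γ(M, U)}
    (hs : IsKilledByPow I n s) (h : V ≤ U) :
    IsKilledByPow I n (M.presheaf.map (homOfLE h).op s) := by
  intro W hW f hf
  rw [map_map_apply]
  exact hs W _ f hf

lemma IsKilledByPow.mono {M : X.Modules} {n m : ℕ} (hnm : n ≤ m) {U : X.Opens} {s : Γ(M, U)}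
    (hs : IsKilledByPow I n s) : IsKilledByPow I m s :=
  fun W h f hf => hs W h f (Ideal.pow_le_pow_right hnm hf)

lemma IsKilledByPow.add {M : X.Modules} {n : ℕ} {U : X.Opens} {s t : Γ(M, U)}
    (hs : IsKilledByPow I n s) (ht : IsKilledByPow I n t) : IsKilledByPow I n (s + t) := by
  intro W h f hf
  rw [map_add, smul_add, hs W h f hf, ht W h f hf, add_zero]

lemma IsPowerTorsion.map {M : X.Modules} {U V : X.Opens} {s : Γ(M, U)}
    (hs : IsPowerTorsion I s) (h : V ≤ U) :
    IsPowerTorsion I (M.presheaf.map (homOfLE h).op s) := by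
  intro x hx
  obtain ⟨T, hT, n, hxT, H⟩ := hs x (h hx)
  refine ⟨T ⊓ V, inf_le_right, n, ⟨hxT, hx⟩, ?_⟩
  have := H.map (V := T ⊓ V) inf_le_left
  rw [map_map_apply] at this ⊢
  exact this

lemma IsPowerTorsion.zero (M : X.Modules) (U : X.Opens) : IsPowerTorsion I (0 : Γ(M, U)) := by
  intro x hx
  refine ⟨U, le_rfl, 0, hx, fun W h f _ => ?_⟩
  rw [map_zero, map_zero, smul_zero]

lemma IsPowerTorsion.add {M : X.Modules} {U : X.Opens} {s t : Γ(M, U)}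
    (hs : IsPowerTorsion I s) (ht : IsPowerTorsion I t) : IsPowerTorsion I (s + t) := by
  intro x hx
  obtain ⟨V, hV, n, hxV, H⟩ := hs x hx
  obtain ⟨T, hT, m, hxT, K⟩ := ht x hx
  refine ⟨V ⊓ T, inf_le_left.trans hV, max n m, ⟨hxV, hxT⟩, ?_⟩
  have H' := (H.map (V := V ⊓ T) inf_le_left).mono (le_max_left n m)
  have K' := (K.map (V := V ⊓ T) inf_le_right).mono (le_max_right n m)
  rw [map_map_apply] at H' K'
  rw [map_add]
  exact H'.add K'

lemma IsPowerTorsion.smul {M : X.Modules} {U : X.Opens} {s : Γ(M, U)} (r : Γ(X, U))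
    (hs : IsPowerTorsion I s) : IsPowerTorsion I (r • s) := by
  intro x hx
  obtain ⟨V, hV, n, hxV, H⟩ := hs x hx
  refine ⟨V, hV, n, hxV, fun W h f hf => ?_⟩
  rw [map_smul, map_smul, smul_comm, H W h f hf, smul_zero]

lemma IsPowerTorsion.app {M N : X.Modules} (φ : M ⟶ N) {U : X.Opens} {s : Γ(M, U)}
    (hs : IsPowerTorsion I s) : IsPowerTorsion I (φ.app U s) := by
  have nat : ∀ {V W : X.Opens} (h : W ≤ V) (t : Γ(M, V)),
      N.presheaf.map (homOfLE h).op (φ.app V t) = φ.app W (M.presheaf.map (homOfLE h).op t) :=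
    fun h t => (ConcreteCategory.congr_hom (φ.mapPresheaf.naturality (homOfLE h).op) t).symm
  intro x hx
  obtain ⟨V, hV, n, hxV, H⟩ := hs x hx
  refine ⟨V, hV, n, hxV, fun W h f hf => ?_⟩
  rw [nat, nat, ← Hom.app_smul, H W h f hf, map_zero]

lemma IsPowerTorsion.of_local {M : X.Modules} {U : X.Opens} {s : Γ(M, U)}
    (hs : ∀ x ∈ U, ∃ (V : X.Opens) (h : V ≤ U), x ∈ V ∧
      IsPowerTorsion I (M.presheaf.map (homOfLE h).op s)) : IsPowerTorsion I s := by
  intro x hx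
  obtain ⟨V, hV, hxV, H⟩ := hs x hx
  obtain ⟨T, hT, n, hxT, K⟩ := H x hxV
  rw [map_map_apply] at K
  exact ⟨T, hT.trans hV, n, hxT, K⟩

variable (I)

/-- The subpresheaf of modules of `M` formed by the sections that are locally killed by a power
of `I`. -/
def gammaSub (M : X.Modules) : M.val.Submodule where
  obj U :=
    { carrier := {s : Γ(M, U.unop) | IsPowerTorsion I s}
      zero_mem' := IsPowerTorsion.zero M _
      add_mem' := IsPowerTorsion.add
      smul_mem' := fun r _ hs => IsPowerTorsion.smul (M := M) r hs }
  map f _ hs := IsPowerTorsion.map (M := M) hs (leOfHom f.unop)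

lemma gammaSub_isSheaf (M : X.Modules) :
    Presheaf.IsSheaf (Opens.grothendieckTopology X)
      (gammaSub I M).toPresheafOfModules.presheaf := by
  rw [Presheaf.isSheaf_iff_isSheaf_forget _ _ (CategoryTheory.forget Ab.{u}), isSheaf_iff_isSheaf_of_type]
  let F := M.presheaf ⋙ CategoryTheory.forget Ab.{u}
  have hF : Presieve.IsSheaf (Opens.grothendieckTopology X) F := by
    rw [← isSheaf_iff_isSheaf_of_type]
    exact (Presheaf.isSheaf_iff_isSheaf_forget _ _ (CategoryTheory.forget Ab.{u})).1 M.isSheaf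
  let G : Subfunctor F :=
    { obj := fun U => {s : Γ(M, U.unop) | IsPowerTorsion I s}
      map := fun f _ hs => IsPowerTorsion.map (M := M) hs (leOfHom f.unop) }
  change Presieve.IsSheaf _ G.toFunctor
  rw [Subfunctor.isSheaf_iff _ hF]
  intro U s hs
  refine IsPowerTorsion.of_local (M := M) fun x hx => ?_
  obtain ⟨V, f, hf, hxV⟩ := hs x hx
  exact ⟨V, leOfHom f, hxV, hf⟩

/-- The subsheaf `Γ_Z M` of `M`, where `Z` is the closed subset defined by the ideal sheaf `I`. -/
noncomputable def gammaObj (M : X.Modules) : X.Modules :=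
  SheafOfModules.mk (gammaSub I M).toPresheafOfModules (gammaSub_isSheaf I M)

/-- The inclusion `Γ_Z M ⟶ M`. -/
noncomputable def gammaι (M : X.Modules) : gammaObj I M ⟶ M :=
  SheafOfModules.Hom.mk (gammaSub I M).ι

lemma gammaι_app_apply (M : X.Modules) (U : X.Opens) (s : Γ(gammaObj I M, U)) :
    (gammaι I M).app U s = Subtype.val (p := fun t : Γ(M, U) => IsPowerTorsion I t) s := rfl

instance (M : X.Modules) : Mono (gammaι I M) where
  right_cancellation {K} g h e := by
    ext U s
    have := ConcreteCategory.congr_hom (congr_arg (fun k => Hom.app k U) e) s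
    exact Subtype.ext this

/-- The map `Γ_Z M ⟶ Γ_Z N` induced by `φ : M ⟶ N`. -/
noncomputable def gammaMap {M N : X.Modules} (φ : M ⟶ N) : gammaObj I M ⟶ gammaObj I N :=
  SheafOfModules.Hom.mk (PresheafOfModules.homMk
    { app := fun U => AddCommGrpCat.ofHom
        { toFun := fun s => ⟨φ.app U.unop s.1, IsPowerTorsion.app φ s.2⟩
          map_zero' := Subtype.ext (map_zero (φ.app U.unop).hom)
          map_add' := fun s t => Subtype.ext (map_add (φ.app U.unop).hom s.1 t.1) }
      naturality := fun U V f => by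
        ext s
        exact Subtype.ext (ConcreteCategory.congr_hom (φ.mapPresheaf.naturality f) s.1) }
    (fun U r s => Subtype.ext (Hom.app_smul φ r s.1)))

lemma gammaMap_ι {M N : X.Modules} (φ : M ⟶ N) : gammaMap I φ ≫ gammaι I N = gammaι I M ≫ φ := rfl

/-- The functor `Γ_Z = colim_n Hom(𝒪_X / I ^ n, -)` on `𝒪_X`-modules, where `Z` is the closed
subset defined by the ideal sheaf `I`. -/
noncomputable def gamma : X.Modules ⥤ X.Modules where
  obj := gammaObj I
  map := gammaMap I
  map_id M := by rw [← cancel_mono (gammaι I M), gammaMap_ι]; simp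
  map_comp f g := by
    rw [← cancel_mono (gammaι I _)]
    rfl

lemma gammaMap_add {M N : X.Modules} (f g : M ⟶ N) :
    gammaMap I (f + g) = gammaMap I f + gammaMap I g := by
  rw [← cancel_mono (gammaι I N), Preadditive.add_comp, gammaMap_ι, gammaMap_ι, gammaMap_ι,
    Preadditive.comp_add]

instance : (gamma I).Additive where
  map_add {_ _ f g} := gammaMap_add I f g

end LocalCohomology

/-! ### The subcategories of the derived category of `𝒪_X`-modules -/

section Subcategories

variable {X : Scheme.{u}} [HasDerivedCategory.{w} X.Modules]

/-- `D_qc(X)`: the complexes of `𝒪_X`-modules with quasi-coherent cohomology sheaves. -/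
def Dqc : ObjectProperty (DerivedCategory X.Modules) := fun F =>
  ∀ n : ℤ, ((DerivedCategory.homologyFunctor X.Modules n).obj F).IsQuasicoherent

/-- `D_qc(X)_Z`: the complexes in `D_qc(X)` whose cohomology sheaves are supported on the closed
subset `Z`, i.e. restrict to zero on the open complement of `Z`. -/
def DqcSupp (Z : Closeds X) : ObjectProperty (DerivedCategory X.Modules) := fun F =>
  Dqc F ∧ ∀ n : ℤ,
    IsZero (((DerivedCategory.homologyFunctor X.Modules n).obj F).restrict (Scheme.Opens.ι Z.compl))

/-- `D_qc(X)_Z^{Z'}`: the complexes `F` in `D_qc(X)_Z` with `RΓ_{Z'} F = 0`, where `Z'` is the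
closed subset defined by the ideal sheaf `I`. -/
def DqcSuppVanishing (Z : Closeds X) (I : X.IdealSheafData) [HasTotalRightDerived (gamma I)] :
    ObjectProperty (DerivedCategory X.Modules) := fun F =>
  DqcSupp Z F ∧ IsZero ((totalRight (gamma I)).obj F)

end Subcategories

end AlgebraicGeometry.Scheme.Modules

/-! Restriction `j^*` is exact and left adjoint to `j_*`, hence left adjoint to `Rj_*` on unbounded
derived categories (`derivedAdjunction`). The counit is invertible because `j^* j_*` is already the
identity on sheaves. What remains is that both functors respect the two subcategories, and that the
unit is invertible on the target one.

Existence of the derived functors: sheaves of modules form a Grothendieck abelian category. There a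
set of acyclic monomorphisms generates all of them, and the small object argument yields functorial
K-injective resolutions with injective terms. Everything is then computed on such complexes, in
terms of sections.

Quasi-coherence: if `J` is K-injective with quasi-coherent cohomology and `V` is affine, the
cohomology of `Γ(V, J)` is `Γ(V, H^n J)` (`liftsBoundaries_of_isKInjective`,
`liftsClasses_of_isKInjective`). The bounded below case is an induction on the degree using
two-element Čech covers; the general case writes `J` as a homotopy limit of resolutions of its
truncations. It follows that a cocycle vanishing on `D(f)` becomes, after multiplication by a power
of `f`, the boundary of a section vanishing on `D(f)` (`KillsClasses`). On a Noetherian scheme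
Mayer–Vietoris extends this to all opens, so it holds for `j_* J`; conversely it forces the
cohomology to be quasi-coherent.

The unit (`quasiIso_homEquiv`): let `J` represent an object of the target, let `J'` be a K-injective
resolution of `j^* J`, and let `C` be the cone of `J ⟶ j_* J'`. The cohomology of `C` vanishes on
`X` and off the closure of `j(Z)`, so it is supported on the zero locus of `I`. On an affine open,
injectivity of the terms and Noetherianity allow a cocycle of `C` to be moved by a boundary to an
`I`-power torsion one, `(z, p)` (`exists_isPowerTorsion_sub`). Now `p = 0`, since `j_* J'` has no
such torsion, and `z` is the boundary of a torsion section `y`, since `Γ_I J` is acyclic. The image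
of `y` in `j_* J'` is again torsion, hence zero, so `(z, 0)` is the boundary of `(-y, 0)` and `C` is
acyclic. -/

namespace PresheafOfModules

/-! ### The category of sheaves of modules is Grothendieck abelian. -/

variable {C : Type u} [SmallCategory.{u} C] (R : Cᵒᵖ ⥤ RingCat.{u})

instance hasExactColimitsOfShape (J : Type u) [SmallCategory J] [IsFiltered J] :
    HasExactColimitsOfShape J (PresheafOfModules.{u} R) := by
  have : ReflectsFiniteLimits (toPresheaf.{u} R) := ⟨fun _ _ _ => inferInstance⟩
  exact HasExactColimitsOfShape.domain_of_functor J (toPresheaf R)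

end PresheafOfModules

namespace AlgebraicGeometry.Scheme.Modules

variable (X : Scheme.{u})

/-- Sheafification of a presheaf of `𝒪_X`-modules. -/
noncomputable def sheafify : X.PresheafOfModules ⥤ X.Modules :=
  PresheafOfModules.sheafification (𝟙 X.ringCatSheaf.obj)

/-- Sheafification is left adjoint to the inclusion of sheaves into presheaves of modules. -/
noncomputable def sheafifyAdjunction : sheafify X ⊣ toPresheafOfModules X :=
  (PresheafOfModules.sheafificationAdjunction (𝟙 X.ringCatSheaf.obj)).ofNatIsoRight
    (NatIso.ofComponents (fun _ => Iso.refl _) (fun _ => rfl))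

instance : PreservesFiniteLimits (sheafify X) :=
  inferInstanceAs (PreservesFiniteLimits
    (PresheafOfModules.sheafification (𝟙 X.ringCatSheaf.obj)))

instance : HasFilteredColimitsOfSize.{u, u} X.Modules where
  HasColimitsOfShape _ _ _ := inferInstance

instance : AB5OfSize.{u, u} X.Modules where
  ofShape J _ _ := (sheafifyAdjunction X).hasExactColimitsOfShape J

open PresheafOfModules in
instance : HasSeparator X.Modules where
  hasSeparator := by
    -- Maps out of the sheafified free module on a representable presheaf are sections, so these
    -- objects separate and their coproduct is a separator.
    let S (U : X.Opens) : X.Modules := (sheafify X).obj ((free _).obj (yoneda.obj U))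
    have hS : ObjectProperty.IsSeparating (.ofObj S) := by
      intro M N f g h
      apply (toPresheafOfModules X).map_injective
      apply freeYoneda.isSeparating
      rintro _ ⟨U⟩ k
      apply ((sheafifyAdjunction X).homEquiv _ _).symm.injective
      simpa [Adjunction.homEquiv_naturality_right_symm] using
        h _ ⟨U⟩ (((sheafifyAdjunction X).homEquiv _ _).symm k)
    exact ⟨_, hS.isSeparator_coproduct⟩

instance : IsGrothendieckAbelian.{u} X.Modules where

end AlgebraicGeometry.Scheme.Modules

/-! ### Acyclic monomorphisms of cochain complexes -/

namespace CochainComplex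

open HomologicalComplex HomComplex ZeroObject

section Double

variable {C : Type*} [Category* C] [Abelian C]

/-- The contractible complex `A ⟶ A` concentrated in degrees `n` and `n + 1`. -/
noncomputable abbrev disc (A : C) (n : ℤ) : CochainComplex C ℤ :=
  double (𝟙 A) (show (ComplexShape.up ℤ).Rel n (n + 1) by simp)

lemma isZero_disc_X (A : C) (n k : ℤ) (h₀ : k ≠ n) (h₁ : k ≠ n + 1) :
    IsZero ((disc A n).X k) :=
  isZero_double_X _ _ _ h₀ h₁

lemma isIso_disc_d (A : C) (n : ℤ) : IsIso ((disc A n).d n (n + 1)) := by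
  rw [double_d _ _ (by simp)]
  infer_instance

lemma acyclic_disc (A : C) (n : ℤ) : (disc A n).Acyclic := by
  intro k
  rw [exactAt_iff' _ (k - 1) k (k + 1) (by simp) (by simp)]
  by_cases h₀ : k = n
  · subst h₀
    have h : (disc A k).d (k - 1) k = 0 := double_d_eq_zero₀ _ _ _ _ (by simp)
    refine (ShortComplex.exact_iff_mono _ h).2 ?_
    have := isIso_disc_d A k
    change Mono ((disc A k).d k (k + 1))
    infer_instance
  by_cases h₁ : k = n + 1
  · subst h₁
    have h : (disc A n).d (n + 1) (n + 1 + 1) = 0 := double_d_eq_zero₀ _ _ _ _ (by simp)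
    refine (ShortComplex.exact_iff_epi _ h).2 ?_
    have := isIso_disc_d A n
    change Epi ((disc A n).d (n + 1 - 1) (n + 1))
    rw [add_sub_cancel_right]
    infer_instance
  exact ShortComplex.exact_of_isZero_X₂ _ (isZero_disc_X A n k h₀ h₁)

/-- The morphism `disc A n ⟶ K` induced by `f : A ⟶ K.X n`. -/
noncomputable def discDesc {A : C} {n : ℤ} {K : CochainComplex C ℤ} (f : A ⟶ K.X n) :
    disc A n ⟶ K :=
  mkHomFromDouble _ (by simp) f (f ≫ K.d n (n + 1)) (by simp) (by simp)

lemma discDesc_f {A : C} {n : ℤ} {K : CochainComplex C ℤ} (f : A ⟶ K.X n) :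
    (discDesc f).f n = (doubleXIso₀ (𝟙 A) _).hom ≫ f := by
  simp [discDesc]

open scoped Classical in
/-- The morphism `K ⟶ disc A n` induced by `f : K.X (n + 1) ⟶ A`. -/
noncomputable def discLift {A : C} {n : ℤ} {K : CochainComplex C ℤ} (f : K.X (n + 1) ⟶ A) :
    K ⟶ disc A n where
  f k :=
    if h₀ : k = n then
      (K.XIsoOfEq h₀).hom ≫ K.d n (n + 1) ≫ f ≫ (doubleXIso₀ (𝟙 A) _).inv ≫
        ((disc A n).XIsoOfEq h₀).inv
    else if h₁ : k = n + 1 then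
      (K.XIsoOfEq h₁).hom ≫ f ≫ (doubleXIso₁ (𝟙 A) _ (by simp)).inv ≫
        ((disc A n).XIsoOfEq h₁).inv
    else 0
  comm' k₀ k₁ hk := by
    by_cases h₁ : k₁ = n + 1
    · subst h₁
      obtain rfl : k₀ = n := by simpa using hk
      simp [double_d]
    · by_cases h₀ : k₁ = n
      · subst h₀
        rw [double_d_eq_zero₀ _ _ _ _ (by simp at hk; lia)]
        simp
      · exact (isZero_disc_X A n k₁ h₀ h₁).eq_of_tgt _ _

lemma discLift_f {A : C} {n : ℤ} {K : CochainComplex C ℤ} (f : K.X (n + 1) ⟶ A) :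
    (discLift f).f (n + 1) = f ≫ (doubleXIso₁ (𝟙 A) _ (by simp)).inv := by
  simp [discLift]

/-- The projection of `disc A n` onto its component of degree `n`. -/
noncomputable def discToSingle (A : C) (n : ℤ) :
    disc A n ⟶ (HomologicalComplex.single C (ComplexShape.up ℤ) n).obj A :=
  mkHomToSingle (doubleXIso₀ (𝟙 A) _).hom (fun i hi => by
    rw [double_d_eq_zero₀ _ _ _ _ (by simp at hi; lia)]
    simp)

lemma isIso_discToSingle_f (A : C) (n : ℤ) : IsIso ((discToSingle A n).f n) := by
  dsimp [discToSingle]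
  rw [mkHomToSingle_f]
  infer_instance

/-- Lifting against these maps detects acyclicity of a cokernel, and lifting against `disc E n ⟶ 0`
detects monomorphisms; both are used in `llp_le_acyclicMono`. -/
lemma degreewiseEpiWithInjectiveKernel_discToSingle (A : C) [Injective A] (n : ℤ) :
    degreewiseEpiWithInjectiveKernel (discToSingle A n) := by
  intro k
  by_cases h₀ : k = n
  · subst h₀
    have := isIso_discToSingle_f A k
    exact ⟨inferInstance, (isZero_kernel_of_mono _).injective⟩
  · have hz := isZero_single_obj_X (ComplexShape.up ℤ) n A k h₀
    refine ⟨⟨fun _ _ _ => hz.eq_of_src _ _⟩, ?_⟩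
    have e : (discToSingle A n).f k = 0 := hz.eq_of_tgt _ _
    rw [e]
    by_cases h₁ : k = n + 1
    · subst h₁
      exact Injective.of_iso ((doubleXIso₁ (𝟙 A) _ (by simp)).symm ≪≫ kernelZeroIsoSource.symm)
        inferInstance
    · exact ((isZero_disc_X A n k h₀ h₁).of_iso kernelZeroIsoSource).injective

end Double

section Lifting

variable {C : Type*} [Category* C] [Abelian C]

/-- The class of acyclic monomorphisms between cochain complexes. -/
def acyclicMono (C : Type*) [Category* C] [Abelian C] : MorphismProperty (CochainComplex C ℤ) :=
  fun _ _ f => Mono f ∧ QuasiIso f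

/-- The class of degreewise epimorphisms with a kernel which is a bounded below complex of
injective objects. -/
def fibrationWithBoundedBelowKernel (C : Type*) [Category* C] [Abelian C] :
    MorphismProperty (CochainComplex C ℤ) :=
  fun K _ p => degreewiseEpiWithInjectiveKernel p ∧ ∃ n : ℤ, K.IsStrictlyGE n

/-- Injectivity of the kernels gives lifts degree by degree. Their failure to commute with
differentials is a degree 1 cocycle from `cokernel i` to `kernel p`. It is a coboundary, because
`cokernel i` is acyclic and `kernel p`, bounded below with injective terms, is K-injective; a
primitive corrects the lifts. -/
lemma acyclicMono_le_llp :
    acyclicMono C ≤ (fibrationWithBoundedBelowKernel C).llp := by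
  rintro A B i ⟨_, _⟩ X Y p ⟨hp, d, hd⟩
  constructor
  intro t b sq
  have sq' (n : ℤ) : CommSq (t.f n) (i.f n) (p.f n) (b.f n) :=
    (sq.map (HomologicalComplex.eval _ _ n))
  have (n : ℤ) : (sq' n).HasLift := by
    have := (hp n).hasLiftingProperty (i.f n)
    infer_instance
  let β : Cocycle (cokernel i) (kernel p) 1 :=
    Lifting.cocycle₁ sq (fun n ↦
      { l := (sq' n).lift, fac_left := (sq' n).fac_left, fac_right := (sq' n).fac_right })
      (cokernelIsCokernel i) (kernelIsKernel p) (hπ := by simp) (hι := by simp)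
  have (n : ℤ) : Injective ((kernel p).X n) :=
    Injective.of_iso
      (asIso (kernelComparison p (HomologicalComplex.eval _ _ n))).symm (hp n).2
  have : (kernel p).IsStrictlyGE d := by
    rw [isStrictlyGE_iff]
    intro i hi
    rw [IsZero.iff_id_eq_zero, ← cancel_mono ((kernel.ι p).f i)]
    apply (X.isZero_of_isStrictlyGE d i).eq_of_tgt
  have : (kernel p).IsKInjective := isKInjective_of_injective _ d
  obtain ⟨α, hα⟩ : ∃ (α : Cochain (cokernel i) (kernel p) 0), δ 0 1 α = β.1 := by
    refine IsKInjective.eq_δ_of_cocycle β ?_ 0 (by simp)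
    have : (ShortComplex.mk _ _ (cokernel.condition i)).ShortExact :=
      { exact := ShortComplex.exact_cokernel i }
    exact this.acyclic_X₃ (by dsimp; infer_instance)
  exact Lifting.hasLift sq _ (cokernelIsCokernel _) (kernelIsKernel _) α hα

lemma isStrictlyGE_disc (A : C) (n : ℤ) : (disc A n).IsStrictlyGE n := by
  rw [isStrictlyGE_iff]
  intro i hi
  exact isZero_disc_X A n i (by lia) (by lia)

lemma injective_disc_X (A : C) [Injective A] (n k : ℤ) : Injective ((disc A n).X k) := by
  by_cases h₀ : k = n
  · subst h₀
    exact Injective.of_iso (doubleXIso₀ (𝟙 A) _).symm inferInstance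
  by_cases h₁ : k = n + 1
  · subst h₁
    exact Injective.of_iso (doubleXIso₁ (𝟙 A) _ (by simp)).symm inferInstance
  exact (isZero_disc_X A n k h₀ h₁).injective

lemma quasiIso_of_acyclic_X₃ {S : ShortComplex (CochainComplex C ℤ)} (hS : S.ShortExact)
    (h : S.X₃.Acyclic) : QuasiIso S.f := by
  rw [quasiIso_iff]
  intro n
  rw [quasiIsoAt_iff_isIso_homologyMap]
  have : Epi (homologyMap S.f n) :=
    (hS.homology_exact₂ n).epi_f ((h n).isZero_homology.eq_of_tgt _ _)
  have : Mono (homologyMap S.f n) :=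
    (hS.homology_exact₁ (n - 1) n (by simp)).mono_g ((h (n - 1)).isZero_homology.eq_of_src _ _)
  exact isIso_of_mono_of_epi _

/-- Describing acyclic monomorphisms by a lifting property makes them stable under pushouts and
transfinite compositions. Lifting against `disc E n ⟶ 0` extends an embedding of `A.X (n + 1)` in an
injective along `i`; lifting against `discToSingle` treats the cohomology of the cokernel. -/
lemma llp_le_acyclicMono [EnoughInjectives C] :
    (fibrationWithBoundedBelowKernel C).llp ≤ acyclicMono C := by
  intro A B i hi
  have hmono : Mono i := by
    refine mono_of_mono_f _ fun n => ?_
    obtain ⟨n, rfl⟩ : ∃ m, n = m + 1 := ⟨n - 1, by simp⟩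
    let t : A ⟶ disc (Injective.under (A.X (n + 1))) n := discLift (Injective.ι _)
    have ht : fibrationWithBoundedBelowKernel C
        (0 : disc (Injective.under (A.X (n + 1))) n ⟶ 0) :=
      ⟨(degreewiseEpiWithInjectiveKernel_iff_of_isZero _ (isZero_zero _)).2
        (injective_disc_X _ _), n, isStrictlyGE_disc _ _⟩
    have := hi _ ht
    have sq : CommSq t i (0 : disc (Injective.under (A.X (n + 1))) n ⟶ 0) 0 := ⟨by simp⟩
    have h : (i ≫ sq.lift).f (n + 1) = t.f (n + 1) := by rw [sq.fac_left]
    have ht' : Mono (t.f (n + 1)) := by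
      dsimp only [t]
      rw [discLift_f]
      infer_instance
    rw [← h, HomologicalComplex.comp_f] at ht'
    exact mono_of_mono (i.f (n + 1)) (sq.lift.f (n + 1))
  have hac : (cokernel i).Acyclic := by
    intro n
    let K := cokernel i
    let E := Injective.under (K.opcycles n)
    let φ : K ⟶ (HomologicalComplex.single C (ComplexShape.up ℤ) n).obj E :=
      mkHomToSingle (K.pOpcycles n ≫ Injective.ι _) (fun k _ => by simp)
    have hp : fibrationWithBoundedBelowKernel C (discToSingle E n) :=
      ⟨degreewiseEpiWithInjectiveKernel_discToSingle E n, n, isStrictlyGE_disc _ _⟩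
    have := hi _ hp
    have sq : CommSq (0 : A ⟶ _) i (discToSingle E n) (cokernel.π i ≫ φ) := ⟨by simp⟩
    let l : K ⟶ disc E n := cokernel.desc i sq.lift (by rw [sq.fac_left])
    have hl : l ≫ discToSingle E n = φ := by
      rw [← cancel_epi (cokernel.π i), cokernel.π_desc_assoc, sq.fac_right]
    have h₁ : K.pOpcycles n ≫ Injective.ι (K.opcycles n) =
        K.d n (n + 1) ≫ l.f (n + 1) ≫ (doubleXIso₁ (𝟙 E) _ (by simp)).hom := by
      have h := congr_arg (fun f => f.f n) hl
      dsimp [discToSingle, φ] at h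
      rw [mkHomToSingle_f, mkHomToSingle_f, ← Category.assoc, cancel_mono] at h
      rw [← h, ← l.comm_assoc, double_d _ _ (by simp)]
      simp
    -- The embedding of the opcycles into an injective factors through the differential, so the map
    -- from opcycles to degree `n + 1` is a monomorphism; its kernel is the cohomology.
    have h₂ : Injective.ι (K.opcycles n) =
        K.fromOpcycles n (n + 1) ≫ l.f (n + 1) ≫ (doubleXIso₁ (𝟙 E) _ (by simp)).hom := by
      rw [← cancel_epi (K.pOpcycles n), h₁, p_fromOpcycles_assoc]
    have h₃ : Mono (K.fromOpcycles n (n + 1)) := by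
      have : Mono (K.fromOpcycles n (n + 1) ≫ l.f (n + 1) ≫
        (doubleXIso₁ (𝟙 E) _ (by simp)).hom) := by rw [← h₂]; infer_instance
      exact mono_of_mono _ (l.f (n + 1) ≫ (doubleXIso₁ (𝟙 E) _ _).hom)
    rw [exactAt_iff_isZero_homology, IsZero.iff_id_eq_zero, ← cancel_mono (K.homologyι n),
      ← cancel_mono (K.fromOpcycles n (n + 1))]
    simp
  refine ⟨hmono, ?_⟩
  have hs : (ShortComplex.mk _ _ (cokernel.condition i)).ShortExact :=
    { exact := ShortComplex.exact_cokernel i }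
  exact quasiIso_of_acyclic_X₃ hs hac

lemma acyclicMono_eq_llp [EnoughInjectives C] :
    acyclicMono C = (fibrationWithBoundedBelowKernel C).llp :=
  le_antisymm acyclicMono_le_llp llp_le_acyclicMono

end Lifting

end CochainComplex

/-! ### Small generation of classes of monomorphisms in Grothendieck abelian categories -/

namespace CategoryTheory.IsGrothendieckAbelian

universe v' u'

open MorphismProperty

variable {C : Type u'} [Category.{v'} C]

/-- A class of morphisms `L` can be enlarged inside `W` if any monomorphism `p : X ⟶ Y` in `W`
which is not an isomorphism factors as a morphism in `L` which is not an isomorphism followed by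
a monomorphism. -/
def CanEnlarge (L W : MorphismProperty C) : Prop :=
  ∀ ⦃X Y : C⦄ (p : X ⟶ Y), Mono p → W p → ¬ IsIso p →
    ∃ (X' : C) (i : X ⟶ X') (p' : X' ⟶ Y), L i ∧ ¬ IsIso i ∧ Mono p' ∧ i ≫ p' = p

namespace CanEnlarge

variable {L W : MorphismProperty C} (H : CanEnlarge L W)

section

variable [L.RespectsIso] [W.RespectsIso]

include H in
lemma exists_larger_subobject {X : C} (A : Subobject X) (hA : W A.arrow) (hA' : A ≠ ⊤) :
    ∃ (A' : Subobject X) (h : A < A'), L (Subobject.ofLE A A' h.le) := by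
  induction A using Subobject.ind with | _ f
  obtain ⟨X', i, p', hi, hi', hp', fac⟩ := H f inferInstance
    ((MorphismProperty.arrow_mk_iso_iff _
      (Arrow.isoMk (Subobject.underlyingIso f) (Iso.refl _) (by simp))).1 hA)
    (by simpa only [Subobject.isIso_iff_mk_eq_top] using hA')
  refine ⟨Subobject.mk p', Subobject.mk_lt_mk_of_comm i fac hi',
    (MorphismProperty.arrow_mk_iso_iff _ ?_).2 hi⟩
  refine Arrow.isoMk (Subobject.underlyingIso f) (Subobject.underlyingIso p') ?_
  dsimp
  simp only [← cancel_mono p', Category.assoc, fac,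
    Subobject.underlyingIso_hom_comp_eq_mk, Subobject.ofLE_arrow]

open scoped Classical in
/-- A larger subobject of `X`, if there is one provided by `CanEnlarge`. -/
noncomputable def largerSubobject {X : C} (A : Subobject X) : Subobject X :=
  if hA : W A.arrow ∧ A ≠ ⊤ then (H.exists_larger_subobject A hA.1 hA.2).choose else A

lemma le_largerSubobject {X : C} (A : Subobject X) : A ≤ H.largerSubobject A := by
  dsimp only [largerSubobject]
  split_ifs with h
  · exact (H.exists_larger_subobject A h.1 h.2).choose_spec.choose.le
  · rfl

lemma lt_largerSubobject {X : C} (A : Subobject X) (hA : W A.arrow) (hA' : A ≠ ⊤) :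
    A < H.largerSubobject A := by
  dsimp only [largerSubobject]
  rw [dif_pos ⟨hA, hA'⟩]
  exact (H.exists_larger_subobject A hA hA').choose_spec.choose

lemma ofLE_largerSubobject [L.ContainsIdentities] {X : C} (A : Subobject X) :
    L (Subobject.ofLE A (H.largerSubobject A) (H.le_largerSubobject A)) := by
  by_cases hA : W A.arrow ∧ A ≠ ⊤
  · refine (MorphismProperty.arrow_mk_iso_iff _ ?_).1
      (H.exists_larger_subobject A hA.1 hA.2).choose_spec.choose_spec
    exact Arrow.isoMk (Iso.refl _)
      (Subobject.isoOfEq _ _ ((by simp [largerSubobject, dif_pos hA])))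
  · have e : H.largerSubobject A = A := by simp only [largerSubobject, dif_neg hA]
    refine (MorphismProperty.arrow_mk_iso_iff _ ?_).1 (L.id_mem (A : C))
    exact Arrow.isoMk (Iso.refl _) (Subobject.isoOfEq _ _ e.symm)

lemma ofLE_of_eq_largerSubobject [L.ContainsIdentities] {X : C} (A B : Subobject X)
    (h : B = H.largerSubobject A) (hAB : A ≤ B) : L (Subobject.ofLE A B hAB) := by
  subst h
  exact H.ofLE_largerSubobject A

variable [Abelian C] [IsGrothendieckAbelian.{w} C]

section

variable {X : C} (A₀ : Subobject X) (J : Type w) [LinearOrder J] [OrderBot J] [SuccOrder J]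
  [WellFoundedLT J]

/-- The transfinite iteration of `largerSubobject`. -/
noncomputable def functorToMonoOver : J ⥤ MonoOver X where
  obj j := MonoOver.mk (transfiniteIterate H.largerSubobject j A₀).arrow
  map {j j'} f := MonoOver.homMk (Subobject.ofLE _ _
      (monotone_transfiniteIterate _ _ H.le_largerSubobject (leOfHom f)))

/-- The functor `J ⥤ C` induced by `functorToMonoOver`. -/
noncomputable abbrev functor : J ⥤ C :=
  H.functorToMonoOver A₀ J ⋙ MonoOver.forget _ ⋙ Over.forget _

instance : (H.functor A₀ J).IsWellOrderContinuous where
  nonempty_isColimit m hm := ⟨by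
    have := hm.nonempty_Iio.to_subtype
    let c := (Set.principalSegIio m).cocone (H.functorToMonoOver A₀ J ⋙ MonoOver.forget _)
    have : Mono c.pt.hom :=
      inferInstanceAs (Mono (transfiniteIterate H.largerSubobject m A₀).arrow)
    apply IsGrothendieckAbelian.isColimitMapCoconeOfSubobjectMkEqISup
      ((Set.principalSegIio m).monotone.functor ⋙ H.functorToMonoOver A₀ J) c
    change Subobject.mk (transfiniteIterate H.largerSubobject m A₀).arrow = ⨆ j : Set.Iio m,
      Subobject.mk (transfiniteIterate H.largerSubobject j.1 A₀).arrow
    simp only [Subobject.mk_arrow]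
    exact transfiniteIterate_limit H.largerSubobject A₀ m hm⟩

variable {J} in
/-- The maps in the transfinite iteration are transfinite compositions of morphisms in `L`. -/
noncomputable def transfiniteCompositionOfShapeMapFromBot [L.ContainsIdentities] (j : J) :
    L.TransfiniteCompositionOfShape (Set.Iic j)
    ((H.functor A₀ J).map (homOfLE bot_le : ⊥ ⟶ j)) where
  F := (Set.initialSegIic j).monotone.functor ⋙ H.functor A₀ J
  isoBot := Iso.refl _
  fac := Category.id_comp _
  incl :=
    { app k := (H.functor A₀ J).map (homOfLE k.2)
      naturality k k' h := by
        exact (Subobject.ofLE_comp_ofLE _ _ _ _ _).trans (Category.comp_id _).symm }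
  isColimit := colimitOfDiagramTerminal isTerminalTop _
  map_mem k hk := by
    refine H.ofLE_of_eq_largerSubobject (transfiniteIterate H.largerSubobject k.1 A₀) _ ?_
      (monotone_transfiniteIterate _ _ H.le_largerSubobject (Order.le_succ k))
    rw [Set.Iic.succ_eq_of_not_isMax hk]
    exact transfiniteIterate_succ _ _ _ (Set.not_isMax_coe _ hk)

end

-- Enlarge the subobject transfinitely inside `X`, along more steps than `X` has subobjects. Two
-- stages must coincide, and a stage that no longer grows is `⊤`. The cancellation hypothesis `hLW`
-- keeps each stage in `W`, so that it can be enlarged again.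
include H in
lemma mem_of_mono [L.ContainsIdentities] [IsStableUnderTransfiniteComposition.{w} L]
    (hLW : ∀ ⦃X Y Z : C⦄ (f : X ⟶ Y) (g : Y ⟶ Z), Mono g → L f → W (f ≫ g) → W g)
    {A X : C} (f : A ⟶ X) [Mono f] (hf : W f) : L f := by
  let κ := Order.succ (Cardinal.mk (Shrink.{w} (Subobject X)))
  have : Nonempty κ.ord.ToType := by simp [κ]
  have := WellFoundedLT.toOrderBot κ.ord.ToType
  let J := κ.ord.ToType
  have hJ : HasCardinalLT (Subobject X) (Cardinal.mk J) :=
    lt_of_lt_of_le (Order.lt_succ _) (by simp [J, κ])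
  let T (j : J) := transfiniteIterate H.largerSubobject j (Subobject.mk f)
  have hT : Monotone T := monotone_transfiniteIterate _ _ H.le_largerSubobject
  have hinj : ¬ Function.Injective T := fun h ↦ by
    simpa [hasCardinalLT_iff_cardinal_mk_lt] using hJ.of_injective _ h
  obtain ⟨j, k, hjk, hT'⟩ : ∃ j k, j < k ∧ T j = T k := by
    simp only [Function.Injective, not_forall] at hinj
    obtain ⟨j, k, h, h'⟩ := hinj
    obtain h' | h' := lt_or_gt_of_ne h'
    · exact ⟨j, k, h', h⟩
    · exact ⟨k, j, h', h.symm⟩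
  have hL : L ((H.functor (Subobject.mk f) J).map (homOfLE bot_le : ⊥ ⟶ j)) := by
    have := IsStableUnderTransfiniteComposition.isStableUnderTransfiniteCompositionOfShape
      (W := L) (Set.Iic j)
    exact (isStableUnderTransfiniteCompositionOfShape_iff L (Set.Iic j)).1 this _
      (H.transfiniteCompositionOfShapeMapFromBot (Subobject.mk f) j).mem
  let i : A ⟶ (T j : C) := (Subobject.underlyingIso f).inv ≫
      Subobject.ofLE (Subobject.mk f) (T j) (by
        conv_lhs => rw [← transfiniteIterate_bot H.largerSubobject (J := J) (Subobject.mk f)]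
        exact hT bot_le)
  have e : (Subobject.isoOfEq (T ⊥) _ (transfiniteIterate_bot _ _) ≪≫
      Subobject.underlyingIso f).hom ≫ i = Subobject.ofLE (T ⊥) (T j) (hT bot_le) := by
    rw [← cancel_mono (T j).arrow]
    simp [i, T]
  have hi : L i := by
    refine (MorphismProperty.arrow_mk_iso_iff _ ?_).1 hL
    exact Arrow.isoMk ((Subobject.isoOfEq (T ⊥) _ (transfiniteIterate_bot _ _) ≪≫
      Subobject.underlyingIso f)) (Iso.refl _) (e.trans (Category.comp_id _).symm)
  have fac : i ≫ (T j).arrow = f := by simp [i]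
  have hW : W (T j).arrow := hLW i _ inferInstance hi (by rwa [fac])
  have htop : T j = ⊤ := by
    by_contra h
    have h₁ := H.lt_largerSubobject (T j) hW h
    have h₂ : H.largerSubobject (T j) = T (Order.succ j) :=
      (transfiniteIterate_succ _ _ _ hjk.not_isMax).symm
    rw [h₂] at h₁
    exact h₁.not_ge ((hT (Order.succ_le_of_lt hjk)).trans hT'.symm.le)
  have := (Subobject.isIso_arrow_iff_eq_top (T j)).2 htop
  rw [← fac]
  exact (L.cancel_right_of_respectsIso i (T j).arrow).2 hi

end

end CanEnlarge

variable [Abelian C] [IsGrothendieckAbelian.{w} C]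

/-- Relative cell complexes built from monomorphisms are chains of monomorphisms, and maps from an
object with fewer than `κ` subobjects commute with colimits of such `κ`-chains. -/
lemma hasSmallObjectArgument_of_mono (I : MorphismProperty C) [IsSmall.{w} I]
    (hI : I ≤ monomorphisms C) : HasSmallObjectArgument.{w} I := by
  obtain ⟨ι, A, B, f, rfl⟩ := (isSmall_iff_eq_ofHoms.{w} I).1 inferInstance
  obtain ⟨κ, hκ', hκ⟩ := HasCardinalLT.exists_regular_cardinal.{w} (Σ i, Subobject (A i))
  have : Fact κ.IsRegular := ⟨hκ'⟩
  have : Nonempty κ.ord.ToType := by simpa using hκ'.ne_zero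
  have := WellFoundedLT.toOrderBot κ.ord.ToType
  exact ⟨κ, inferInstance, inferInstance,
    { preservesColimit {A' B' X Y} i hi f' hf := by
        let hf' : (monomorphisms C).TransfiniteCompositionOfShape κ.ord.ToType f' :=
          { toTransfiniteCompositionOfShape := hf.toTransfiniteCompositionOfShape
            map_mem j hj := by
              have := (hf.attachCells j hj).pushouts_coproducts
              simp only [ofHoms_homFamily] at this
              refine (?_ : _ ≤ monomorphisms C) _ this
              simp only [pushouts_le_iff, coproducts_le_iff]
              exact hI }
        have (j j' : κ.ord.ToType) (φ : j ⟶ j') : Mono (hf'.F.map φ) := hf'.mem_map φ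
        apply preservesColimit_coyoneda_obj_of_mono (Y := hf'.F) (κ := κ)
        obtain ⟨i⟩ := hi
        exact hκ.of_injective (fun S ↦ (⟨i, S⟩ : Σ i, Subobject (A i)))
          (fun _ _ h ↦ by simpa using h) }⟩

end CategoryTheory.IsGrothendieckAbelian

/-! ### A set of acyclic monomorphisms generating all acyclic monomorphisms -/

namespace CochainComplex

open HomologicalComplex

universe v' u'

variable {C : Type u'} [Category.{v'} C] [Abelian C] [IsGrothendieckAbelian.{v'} C]

lemma exists_refinement_of_acyclic {C : Type*} [Category* C] [Abelian C]
    {K : CochainComplex C ℤ} (hK : K.Acyclic) (m : ℤ) {A : C}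
    (x : A ⟶ K.X (m + 1)) (hx : x ≫ K.d (m + 1) (m + 1 + 1) = 0) :
    ∃ (A' : C) (π : A' ⟶ A) (_ : Epi π) (y : A' ⟶ K.X m), π ≫ x = y ≫ K.d m (m + 1) :=
  ((exactAt_iff' _ m (m + 1) (m + 1 + 1) (by simp) (by simp)).1
    (hK (m + 1))).exact_up_to_refinements x hx

section Tower

variable (G : C) (P P₀ : CochainComplex C ℤ)

/-- The complex obtained from `P` by adding a free element of degree `m` for each `m : ℤ`, each
`z : G ⟶ P.X (m + 1)` and each endomorphism of `G`. -/
noncomputable abbrev enlarge : CochainComplex C ℤ :=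
  P ⨿ ∐ fun (s : Σ m : ℤ, (G ⟶ P.X (m + 1)) × (G ⟶ G)) => disc G s.1

/-- The iteration of `enlarge`. -/
noncomputable def towerObj : ℕ → CochainComplex C ℤ
  | 0 => P₀
  | k + 1 => enlarge G (towerObj k)

/-- The inclusions in the iteration of `enlarge`. -/
noncomputable def towerMap (k : ℕ) : towerObj G P₀ k ⟶ towerObj G P₀ (k + 1) :=
  (coprod.inl : towerObj G P₀ k ⟶ enlarge G (towerObj G P₀ k))

/-- The tower given by the iteration of `enlarge`. -/
noncomputable def tower : ℕ ⥤ CochainComplex C ℤ :=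
  Functor.ofSequence (towerMap G P₀)

variable {G P}

/-- Every cocycle of `P` that bounds in `Q` is made to bound in the image of the enlargement. The
endomorphism `h` is needed because primitives exist only after an epimorphism onto `G`; testing that
epimorphism on maps from the separator `G` produces an endomorphism of `G`. -/
lemma exists_enlarge_hom {Y Q : CochainComplex C ℤ} (π : Y ⟶ Q) (b : P ⟶ Y) :
    ∃ b' : enlarge G P ⟶ Y, coprod.inl ≫ b' = b ∧
      ∀ (m : ℤ) (z : G ⟶ P.X (m + 1)) (h : G ⟶ G),
        (∃ y : G ⟶ Y.X m, h ≫ z ≫ (b ≫ π).f (m + 1) = y ≫ π.f m ≫ Q.d m (m + 1)) →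
        ∃ t : G ⟶ (enlarge G P).X m,
          h ≫ z ≫ (b ≫ π).f (m + 1) = t ≫ (b' ≫ π).f m ≫ Q.d m (m + 1) := by
  classical
  -- The new generator indexed by `s` is sent to a chosen primitive if there is one, and to zero
  -- otherwise.
  let y (s : Σ m : ℤ, (G ⟶ P.X (m + 1)) × (G ⟶ G)) : G ⟶ Y.X s.1 :=
    if hs : ∃ y : G ⟶ Y.X s.1,
        s.2.2 ≫ s.2.1 ≫ (b ≫ π).f (s.1 + 1) = y ≫ π.f s.1 ≫ Q.d s.1 (s.1 + 1)
      then hs.choose else 0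
  refine ⟨coprod.desc b (Sigma.desc fun s => discDesc (y s)), coprod.inl_desc _ _, fun m z h hy => ?_⟩
  let s : Σ m : ℤ, (G ⟶ P.X (m + 1)) × (G ⟶ G) := ⟨m, z, h⟩
  let i : disc G m ⟶ enlarge G P := Sigma.ι (fun s : Σ m : ℤ, (G ⟶ P.X (m + 1)) × (G ⟶ G) =>
    disc G s.1) s ≫ coprod.inr
  have hi : i ≫ coprod.desc b (Sigma.desc fun s => discDesc (y s)) = discDesc (y s) := by
    dsimp only [i]
    rw [Category.assoc, coprod.inr_desc]
    exact Sigma.ι_desc (fun s => discDesc (y s)) s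
  have hys : y s = hy.choose := dif_pos hy
  refine ⟨(doubleXIso₀ (𝟙 G) _).inv ≫ i.f m, ?_⟩
  have e : i.f m ≫ (coprod.desc b (Sigma.desc fun s => discDesc (y s)) ≫ π).f m =
      (doubleXIso₀ (𝟙 G) _).hom ≫ y s ≫ π.f m := by
    rw [← comp_f, ← Category.assoc, hi, comp_f, discDesc_f, Category.assoc]
  rw [Category.assoc, reassoc_of% e, Iso.inv_hom_id_assoc, hys]
  exact hy.choose_spec

lemma exists_tower_cocone {Y Q : CochainComplex C ℤ} (π : Y ⟶ Q) (b : P₀ ⟶ Y) :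
    ∃ β : colimit (tower G P₀) ⟶ Y, (colimit.ι (tower G P₀) 0 : P₀ ⟶ _) ≫ β = b ∧
      ∀ (k : ℕ) (m : ℤ) (z : G ⟶ ((tower G P₀).obj k).X (m + 1)) (h : G ⟶ G),
        (∃ y : G ⟶ Y.X m, h ≫ z ≫ (colimit.ι (tower G P₀) k ≫ β ≫ π).f (m + 1) =
          y ≫ π.f m ≫ Q.d m (m + 1)) →
        ∃ t : G ⟶ (colimit (tower G P₀)).X m,
          h ≫ z ≫ (colimit.ι (tower G P₀) k ≫ β ≫ π).f (m + 1) =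
            t ≫ (β ≫ π).f m ≫ Q.d m (m + 1) := by
  choose S hS₁ hS₂ using fun (P : CochainComplex C ℤ) (b : P ⟶ Y) =>
    exists_enlarge_hom (G := G) π b
  let c (k : ℕ) : towerObj G P₀ k ⟶ Y := Nat.rec b (fun _ c => S _ c) k
  have hc (k : ℕ) : towerMap G P₀ k ≫ c (k + 1) = c k := hS₁ _ (c k)
  have hc' (k : ℕ) (m : ℤ) (z : G ⟶ (towerObj G P₀ k).X (m + 1)) (h : G ⟶ G)
      (hy : ∃ y : G ⟶ Y.X m, h ≫ z ≫ (c k ≫ π).f (m + 1) = y ≫ π.f m ≫ Q.d m (m + 1)) :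
      ∃ t : G ⟶ (towerObj G P₀ (k + 1)).X m,
        h ≫ z ≫ (c k ≫ π).f (m + 1) = t ≫ (c (k + 1) ≫ π).f m ≫ Q.d m (m + 1) :=
    hS₂ _ (c k) m z h hy
  let φ : tower G P₀ ⟶ (Functor.const ℕ).obj Y := NatTrans.ofSequence c (fun n => by
    have e : (tower G P₀).map (homOfLE (Nat.le_add_right n 1)) = towerMap G P₀ n :=
      Functor.ofSequence_map_homOfLE_succ _ n
    rw [e]
    exact (hc n).trans (Category.comp_id _).symm)
  let β : colimit (tower G P₀) ⟶ Y := colimit.desc (tower G P₀) ⟨Y, φ⟩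
  let j (k : ℕ) : towerObj G P₀ k ⟶ colimit (tower G P₀) := colimit.ι (tower G P₀) k
  have hβ (k : ℕ) : j k ≫ β = c k := colimit.ι_desc _ _
  refine ⟨β, hβ 0, fun k m z h hy => ?_⟩
  change ∃ y : G ⟶ Y.X m, h ≫ z ≫ (j k ≫ β ≫ π).f (m + 1) = _ at hy
  change ∃ t : G ⟶ (colimit (tower G P₀)).X m, h ≫ z ≫ (j k ≫ β ≫ π).f (m + 1) = _
  change G ⟶ (towerObj G P₀ k).X (m + 1) at z
  rw [reassoc_of% (hβ k)] at hy ⊢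
  obtain ⟨t, ht⟩ := hc' k m z h hy
  have e : (j (k + 1)).f m ≫ (β ≫ π).f m = (c (k + 1) ≫ π).f m := by
    rw [← comp_f, reassoc_of% (hβ (k + 1))]
  exact ⟨t ≫ (j (k + 1)).f m, ht.trans (by rw [Category.assoc, reassoc_of% e])⟩

/-- An element of a sequential colimit which is a cocycle comes, up to refinements, from cocycles
in the terms of the sequence. -/
lemma colimit_exact (F : ℕ ⥤ C) {c : Cocone F} (hc : IsColimit c) {Q Q' : C} (d : c.pt ⟶ Q)
    (e : c.pt ⟶ Q') (h : ∀ (k : ℕ) (T : C) (x : T ⟶ F.obj k), x ≫ c.ι.app k ≫ d = 0 →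
      x ≫ c.ι.app k ≫ e = 0) {A : C} (x : A ⟶ c.pt) (hx : x ≫ d = 0) : x ≫ e = 0 := by
  let φ : F ⟶ (Functor.const ℕ).obj Q :=
    { app k := c.ι.app k ≫ d
      naturality _ _ f := by simp }
  let S : ShortComplex (ℕ ⥤ C) := ShortComplex.mk (kernel.ι φ) φ (by simp)
  have hS : S.Exact := ShortComplex.exact_kernel φ
  let c₃ : Cocone ((Functor.const ℕ).obj Q) := ⟨Q, 𝟙 _⟩
  let hc₃ : IsColimit c₃ :=
    { desc s := s.ι.app 0
      fac s j := by
        have := s.ι.naturality (homOfLE (Nat.zero_le j))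
        simpa [c₃] using this.symm
      uniq s m hm := by simpa [c₃] using hm 0 }
  have : HasFilteredColimitsOfSize.{0, 0} C := hasFilteredColimitsOfSize_of_univLE.{0}
  have : AB5OfSize.{0, 0} C := AB5OfSize_of_univLE.{0, 0, v', v'} C
  have hS' := colim.exact_mapShortComplex hS (colimit.isColimit S.X₁) hc hc₃
    (colimit.desc S.X₁ ⟨c.pt, S.f ≫ c.ι⟩) d (fun j => by simp) (fun j => by simp [S, φ, c₃])
  obtain ⟨A', π, _, (y : A' ⟶ colimit S.X₁), hy⟩ := hS'.exact_up_to_refinements x hx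
  replace hy : π ≫ x = y ≫ colimit.desc S.X₁ ⟨c.pt, S.f ≫ c.ι⟩ := hy
  rw [← cancel_epi π, reassoc_of% hy, comp_zero]
  convert comp_zero
  apply colimit.hom_ext
  intro k
  have := h k _ ((kernel.ι φ).app k) (NatTrans.congr_app (kernel.condition φ) k)
  simpa [S] using this

variable (hG : IsSeparator G) {P₀}

-- A cocycle at stage `k` bounds in `Q`, which is acyclic, hence bounds in the image of stage `k +
-- 1` by construction. Exactness of sequential colimits (`colimit_exact`) passes this to the
-- colimit.
include hG in
lemma acyclic_image {Y Q : CochainComplex C ℤ} (π : Y ⟶ Q) [Epi π] (hQ : Q.Acyclic)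
    (β : colimit (tower G P₀) ⟶ Y)
    (hβ : ∀ (k : ℕ) (m : ℤ) (z : G ⟶ ((tower G P₀).obj k).X (m + 1)) (h : G ⟶ G),
        (∃ y : G ⟶ Y.X m, h ≫ z ≫ (colimit.ι (tower G P₀) k ≫ β ≫ π).f (m + 1) =
          y ≫ π.f m ≫ Q.d m (m + 1)) →
        ∃ t : G ⟶ (colimit (tower G P₀)).X m,
          h ≫ z ≫ (colimit.ι (tower G P₀) k ≫ β ≫ π).f (m + 1) =
            t ≫ (β ≫ π).f m ≫ Q.d m (m + 1)) :
    (Abelian.image (β ≫ π)).Acyclic := by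
  intro n
  obtain ⟨m, rfl⟩ : ∃ m, n = m + 1 := ⟨n - 1, by simp⟩
  let B := Abelian.image (β ≫ π)
  let p : colimit (tower G P₀) ⟶ B := Abelian.factorThruImage (β ≫ π)
  let i : B ⟶ Q := Abelian.image.ι (β ≫ π)
  have fac : p ≫ i = β ≫ π := Abelian.image.fac _
  have fac' (n : ℤ) : p.f n ≫ i.f n = (β ≫ π).f n := by rw [← comp_f, fac]
  rw [exactAt_iff' _ m (m + 1) (m + 1 + 1) (by simp) (by simp),
    ShortComplex.exact_iff_exact_up_to_refinements]
  intro A (x : A ⟶ B.X (m + 1)) (hx : x ≫ B.d (m + 1) (m + 1 + 1) = 0)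
  obtain ⟨A₁, a₁, _, x₁, hx₁⟩ := surjective_up_to_refinements_of_epi (p.f (m + 1)) x
  let e := cokernel.π ((β ≫ π).f m ≫ Q.d m (m + 1))
  have key : x₁ ≫ (β ≫ π).f (m + 1) ≫ e = 0 := by
    refine colimit_exact (tower G P₀ ⋙ eval _ _ (m + 1))
      (isColimitOfPreserves (eval _ _ (m + 1)) (colimit.isColimit (tower G P₀)))
      ((β ≫ π).f (m + 1) ≫ Q.d (m + 1) (m + 1 + 1)) ((β ≫ π).f (m + 1) ≫ e) ?_ x₁ ?_
    · intro k T (z : T ⟶ ((tower G P₀).obj k).X (m + 1))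
        (hz : z ≫ (colimit.ι (tower G P₀) k).f (m + 1) ≫
          (β ≫ π).f (m + 1) ≫ Q.d (m + 1) (m + 1 + 1) = 0)
      change z ≫ (colimit.ι (tower G P₀) k).f (m + 1) ≫ (β ≫ π).f (m + 1) ≫ e = 0
      have e₁ : (colimit.ι (tower G P₀) k).f (m + 1) ≫ (β ≫ π).f (m + 1) =
          (colimit.ι (tower G P₀) k ≫ β ≫ π).f (m + 1) := by rw [← comp_f]
      rw [reassoc_of% e₁] at hz ⊢
      apply hG.def
      intro g
      rw [comp_zero]
      obtain ⟨T₁, t₁, _, y₁, hy₁⟩ := exists_refinement_of_acyclic hQ m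
        (g ≫ z ≫ (colimit.ι (tower G P₀) k ≫ β ≫ π).f (m + 1))
        (by rw [Category.assoc, Category.assoc, hz, comp_zero])
      obtain ⟨T₂, t₂, _, y₂, hy₂⟩ := surjective_up_to_refinements_of_epi (π.f m) y₁
      rw [← cancel_epi t₁, ← cancel_epi t₂, comp_zero, comp_zero]
      apply hG.def
      intro s
      rw [comp_zero]
      obtain ⟨t, ht⟩ := hβ k m (g ≫ z) (s ≫ t₂ ≫ t₁) ⟨s ≫ y₂, by
        simp only [Category.assoc]
        rw [← reassoc_of% hy₂, ← hy₁]⟩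
      simp only [Category.assoc] at ht
      -- Composition with `e` being zero is the formulation of being a boundary that can be tested
      -- after epimorphisms and on maps from `G`.
      have he : (β ≫ π).f m ≫ Q.d m (m + 1) ≫ e = 0 := by
        rw [← Category.assoc]
        exact cokernel.condition _
      rw [reassoc_of% ht, he, comp_zero]
    · change x₁ ≫ (β ≫ π).f (m + 1) ≫ Q.d (m + 1) (m + 1 + 1) = 0
      rw [← fac', Category.assoc, i.comm, ← reassoc_of% hx₁, reassoc_of% hx]
      simp
  obtain ⟨A₂, a₂, _, (x₂ : A₂ ⟶ (colimit (tower G P₀)).X m), hx₂⟩ := (ShortComplex.exact_cokernel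
    ((β ≫ π).f m ≫ Q.d m (m + 1))).exact_up_to_refinements (x₁ ≫ (β ≫ π).f (m + 1))
    (by rw [Category.assoc]; exact key)
  replace hx₂ : a₂ ≫ x₁ ≫ (β ≫ π).f (m + 1) = x₂ ≫ (β ≫ π).f m ≫ Q.d m (m + 1) := hx₂
  refine ⟨A₂, a₂ ≫ a₁, inferInstance, x₂ ≫ p.f m, ?_⟩
  have : (a₂ ≫ a₁) ≫ x = (x₂ ≫ p.f m) ≫ B.d m (m + 1) := by
    rw [← cancel_mono (i.f (m + 1))]
    simp only [Category.assoc]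
    rw [← i.comm, reassoc_of% (fac' m), ← hx₂, reassoc_of% hx₁, fac']
  exact this

end Tower

open IsGrothendieckAbelian MorphismProperty

variable (C)

/-- The source of the generating acyclic monomorphisms. -/
noncomputable def towerColimit : CochainComplex C ℤ :=
  colimit (tower (separator C) (separator (CochainComplex C ℤ)))

/-- A set of acyclic monomorphisms which generates all acyclic monomorphisms. -/
noncomputable def generatingAcyclicMono : MorphismProperty (CochainComplex C ℤ) :=
  ofHoms (fun S : {S : Subobject (towerColimit C) // QuasiIso S.arrow} => S.1.arrow)

instance : IsSmall.{v'} (generatingAcyclicMono C) := by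
  dsimp only [generatingAcyclicMono]
  infer_instance

lemma generatingAcyclicMono_le : generatingAcyclicMono C ≤ acyclicMono C := by
  rintro _ _ _ ⟨S⟩
  exact ⟨inferInstance, S.2⟩

instance : HasSmallObjectArgument.{v'} (generatingAcyclicMono C) :=
  hasSmallObjectArgument_of_mono _ (fun _ _ f hf => (generatingAcyclicMono_le C f hf).1)

variable {C}

lemma acyclicMono_llp_rlp_le {L : MorphismProperty (CochainComplex C ℤ)} (hL : L ≤ acyclicMono C) :
    L.rlp.llp ≤ acyclicMono C := by
  rw [acyclicMono_eq_llp] at hL ⊢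
  exact antitone_llp ((le_llp_iff_le_rlp _ _).1 hL)

/-- Choose `b` from the separator to `Y` not factoring through `X`. It extends to a map `β` from
`towerColimit C`, an object independent of `X` and `Y`, whose image in `Y/X` is acyclic. So the
pullback of `p` along `β` is up to isomorphism one of the generators, and pushing it out adjoins the
image of `β` to `X`. -/
lemma canEnlarge_acyclicMono :
    CanEnlarge (generatingAcyclicMono C).rlp.llp (acyclicMono C) := by
  intro X Y p _ hp hp'
  rw [(isSeparator_separator (CochainComplex C ℤ)).isDetector.isIso_iff_of_mono] at hp'
  simp only [ObjectProperty.singleton_iff, Function.Surjective, Functor.flip_obj_map, forall_eq',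
    not_forall, not_exists] at hp'
  obtain ⟨b, hb⟩ := hp'
  obtain ⟨β, hβ₀, hβ⟩ := exists_tower_cocone (G := separator C) _ (cokernel.π p) b
  change towerColimit C ⟶ Y at β
  have hQ : (cokernel p).Acyclic := by
    have hs : (ShortComplex.mk _ _ (cokernel.condition p)).ShortExact :=
      { exact := ShortComplex.exact_cokernel p }
    exact hs.acyclic_X₃ hp.2
  have hB : (Abelian.image (β ≫ cokernel.π p)).Acyclic :=
    acyclic_image (isSeparator_separator C) (cokernel.π p) hQ β hβ
  let S : ShortComplex (CochainComplex C ℤ) :=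
    ShortComplex.mk (pullback.snd p β) (Abelian.factorThruImage (β ≫ cokernel.π p)) (by
      rw [← cancel_mono (Abelian.image.ι (β ≫ cokernel.π p))]
      simp [← pullback.condition_assoc])
  have hS : S.ShortExact :=
    { exact := by
        refine S.exact_of_f_is_kernel (KernelFork.IsLimit.ofι' _ _ fun {A} k hk => ?_)
        have hk' : (k ≫ β) ≫ cokernel.π p = 0 := by
          rw [Category.assoc, ← Abelian.image.fac (β ≫ cokernel.π p), ← Category.assoc]
          change (k ≫ S.g) ≫ _ = 0
          rw [hk, zero_comp]
        exact ⟨pullback.lift (Abelian.monoLift p (k ≫ β) hk') k (by simp),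
          pullback.lift_snd _ _ _⟩
      mono_f := inferInstanceAs (Mono (pullback.snd p β))
      epi_g := inferInstanceAs (Epi (Abelian.factorThruImage _)) }
  have hq : QuasiIso (pullback.snd p β) := quasiIso_of_acyclic_X₃ hS hB
  have hI : (generatingAcyclicMono C).rlp.llp (pullback.snd p β) := by
    refine (arrow_mk_iso_iff _ (Arrow.isoMk (f := Arrow.mk (Subobject.mk (pullback.snd p β)).arrow)
      (g := Arrow.mk (pullback.snd p β)) (Subobject.underlyingIso _)
      (Iso.refl _) (by simp))).1 (le_llp_rlp _ _ (ofHoms.mk (ι := {S : Subobject (towerColimit C) //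
        QuasiIso S.arrow}) ⟨Subobject.mk (pullback.snd p β), ?_⟩))
    rw [← Subobject.underlyingIso_hom_comp_eq_mk]
    infer_instance
  refine ⟨pushout (pullback.fst p β) (pullback.snd p β), pushout.inl _ _,
    pushout.desc p β pullback.condition,
    of_isPushout (IsPushout.of_hasPushout (pullback.fst p β) (pullback.snd p β)) hI, ?_, ?_,
    pushout.inl_desc _ _ _⟩
  · intro h
    let b₀ : separator (CochainComplex C ℤ) ⟶ towerColimit C :=
      colimit.ι (tower (separator C) (separator (CochainComplex C ℤ))) 0
    -- If nothing had been added, `b`, which is `β` on stage zero of the tower, would factor through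
    -- `X`.
    refine hb (b₀ ≫ pushout.inr (pullback.fst p β) (pullback.snd p β) ≫ inv (pushout.inl _ _)) ?_
    have h₁ : inv (pushout.inl (pullback.fst p β) (pullback.snd p β)) ≫ p =
        pushout.desc p β pullback.condition := by
      rw [IsIso.inv_comp_eq, pushout.inl_desc]
    have h₂ : (b₀ ≫ pushout.inr (pullback.fst p β) (pullback.snd p β) ≫
        inv (pushout.inl _ _)) ≫ p = b₀ ≫ β := by
      rw [Category.assoc, Category.assoc, h₁, pushout.inr_desc]
    exact h₂.trans hβ₀
  -- In an abelian category the union of two subobjects is their pushout over the intersection; here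
  -- only `p` has to be a monomorphism.
  · exact (IsPushout.of_hasPushout _ _).mono_of_isPullback_of_mono
      (IsPullback.of_hasPullback p β) _ (pushout.inl_desc _ _ _) (pushout.inr_desc _ _ _)

instance : (acyclicMono C).RespectsIso := by
  rw [acyclicMono_eq_llp]
  infer_instance

lemma acyclicMono_le_llp_rlp : acyclicMono C ≤ (generatingAcyclicMono C).rlp.llp := by
  intro X Y f hf
  have := hf.1
  have hle := acyclicMono_llp_rlp_le (generatingAcyclicMono_le C)
  refine canEnlarge_acyclicMono.mem_of_mono.{v'} (fun X Y Z f g _ hf hfg => ⟨inferInstance, ?_⟩) f hf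
  have := (hle _ hf).2
  have := hfg.2
  exact quasiIso_of_comp_left f g

lemma rlp_generatingAcyclicMono : (generatingAcyclicMono C).rlp = (acyclicMono C).rlp :=
  le_antisymm ((le_llp_iff_le_rlp _ _).1 acyclicMono_le_llp_rlp)
    (antitone_rlp (generatingAcyclicMono_le C))

instance : HasFunctorialFactorization (acyclicMono C) (acyclicMono C).rlp := by
  have e : acyclicMono C = (generatingAcyclicMono C).rlp.llp :=
    le_antisymm acyclicMono_le_llp_rlp (acyclicMono_llp_rlp_le (generatingAcyclicMono_le C))
  rw [← rlp_generatingAcyclicMono]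
  nth_rw 1 [e]
  infer_instance

open ZeroObject

/-- The functor which sends a complex `K` to the morphism `K ⟶ 0`. -/
noncomputable def toZeroArrow : CochainComplex C ℤ ⥤ Arrow (CochainComplex C ℤ) where
  obj K := Arrow.mk (0 : K ⟶ 0)
  map {K L} f := Arrow.homMk (f := Arrow.mk (0 : K ⟶ 0)) (g := Arrow.mk (0 : L ⟶ 0)) f (𝟙 _)
    ((isZero_zero _).eq_of_tgt _ _)

/-- Functorial K-injective resolutions. -/
noncomputable def kInjectiveResolution : CochainComplex C ℤ ⥤ CochainComplex C ℤ :=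
  toZeroArrow ⋙ (functorialFactorizationData (acyclicMono C) (acyclicMono C).rlp).Z

/-- The inclusion of a complex in its K-injective resolution. -/
noncomputable def toKInjectiveResolution :
    𝟭 (CochainComplex C ℤ) ⟶ kInjectiveResolution :=
  Functor.whiskerLeft toZeroArrow
    (functorialFactorizationData (acyclicMono C) (acyclicMono C).rlp).i

lemma acyclicMono_toKInjectiveResolution_app (K : CochainComplex C ℤ) :
    acyclicMono C (toKInjectiveResolution.app K) :=
  (functorialFactorizationData (acyclicMono C) (acyclicMono C).rlp).hi (toZeroArrow.obj K)

instance (K : CochainComplex C ℤ) : QuasiIso (toKInjectiveResolution.app K) :=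
  (acyclicMono_toKInjectiveResolution_app K).2

/-- The complexes with the extension property with respect to acyclic monomorphisms. -/
def IsAcyclicFibrant {C : Type*} [Category* C] [Abelian C] (J : CochainComplex C ℤ) : Prop :=
  ∀ ⦃A B : CochainComplex C ℤ⦄ (i : A ⟶ B) (f : A ⟶ J), acyclicMono C i → ∃ g : B ⟶ J, i ≫ g = f

lemma isAcyclicFibrant_kInjectiveResolution_obj (K : CochainComplex C ℤ) :
    IsAcyclicFibrant (kInjectiveResolution.obj K) := by
  intro A B i f hi
  let p : kInjectiveResolution.obj K ⟶ (0 : CochainComplex C ℤ) :=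
    ((functorialFactorizationData (acyclicMono C) (acyclicMono C).rlp).p).app
    (Arrow.mk (0 : K ⟶ 0))
  have hp : (acyclicMono C).rlp p :=
    (functorialFactorizationData (acyclicMono C) (acyclicMono C).rlp).hp _
  have := hp i hi
  have sq : CommSq f i p 0 := ⟨(isZero_zero _).eq_of_tgt _ _⟩
  exact ⟨sq.lift, sq.fac_left⟩

lemma quasiIso_of_acyclic {C : Type*} [Category* C] [Abelian C]
    {K L : CochainComplex C ℤ} (f : K ⟶ L) (hK : K.Acyclic)
    (hL : L.Acyclic) : QuasiIso f := by
  rw [quasiIso_iff]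
  intro n
  rw [quasiIsoAt_iff_isIso_homologyMap]
  exact ⟨0, (hK n).isZero_homology.eq_of_src _ _, (hL n).isZero_homology.eq_of_src _ _⟩

lemma mono_of_mono_disc {C : Type*} [Category* C] [Abelian C]
    {A B : C} {n : ℤ} (i : disc A n ⟶ disc B n) (hi : Mono (i.f n)) :
    Mono i := by
  refine mono_of_mono_f _ fun k => ?_
  by_cases h₀ : k = n
  · subst h₀
    exact hi
  by_cases h₁ : k = n + 1
  · subst h₁
    have := isIso_disc_d A n
    have := isIso_disc_d B n
    have e : i.f (n + 1) = inv ((disc A n).d n (n + 1)) ≫ i.f n ≫ (disc B n).d n (n + 1) := by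
      rw [IsIso.eq_inv_comp, i.comm]
    rw [e]
    infer_instance
  exact ⟨fun _ _ _ => (isZero_disc_X A n k h₀ h₁).eq_of_tgt _ _⟩

/-- A monomorphism `A ⟶ B` induces an acyclic monomorphism `disc A n ⟶ disc B n`, and a map `A ⟶ J.X
n` induces one from `disc A n` to `J`. -/
lemma IsAcyclicFibrant.injective_X {C : Type*} [Category* C] [Abelian C]
    {J : CochainComplex C ℤ} (hJ : IsAcyclicFibrant J) (n : ℤ) :
    Injective (J.X n) where
  factors {A B} g f _ := by
    let i : disc A n ⟶ disc B n := discDesc (f ≫ (doubleXIso₀ (𝟙 B) _).inv)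
    have hi : acyclicMono C i := by
      refine ⟨mono_of_mono_disc _ ?_, quasiIso_of_acyclic _ (acyclic_disc _ _) (acyclic_disc _ _)⟩
      dsimp only [i]
      rw [discDesc_f]
      infer_instance
    obtain ⟨h, hh⟩ := hJ i (discDesc g) hi
    refine ⟨(doubleXIso₀ (𝟙 B) _).inv ≫ h.f n, ?_⟩
    have h₁ := congr_arg (fun k => k.f n) hh
    dsimp only [i] at h₁
    rw [comp_f, discDesc_f, discDesc_f, Category.assoc, Category.assoc, cancel_epi] at h₁
    exact h₁

lemma acyclic_mappingCone_id {C : Type*} [Category* C] [Abelian C]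
    (E : CochainComplex C ℤ) : (mappingCone (𝟙 E)).Acyclic := by
  intro n
  rw [exactAt_iff_isZero_homology, IsZero.iff_id_eq_zero, ← homologyMap_id,
    (mappingCone.homotopyToZeroOfId E).homologyMap_eq, homologyMap_zero]

/-- For `E` acyclic, the inclusion of `E` in the cone of its identity is an acyclic monomorphism
into a contractible complex, so a map `E ⟶ J` extends to the cone and is null-homotopic. -/
lemma IsAcyclicFibrant.isKInjective {C : Type*} [Category* C] [Abelian C]
    {J : CochainComplex C ℤ} (hJ : IsAcyclicFibrant J) :
    J.IsKInjective where
  nonempty_homotopy_zero {E} f hE := by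
    have : Mono (mappingCone.inr (𝟙 E)) := by
      refine mono_of_mono_f _ fun n => ?_
      have e := mappingCone.inr_f_snd_v (𝟙 E) n
      have : Mono ((mappingCone.inr (𝟙 E)).f n ≫
        (mappingCone.snd (𝟙 E)).v n n (add_zero n)) := by rw [e]; infer_instance
      exact mono_of_mono _ ((mappingCone.snd (𝟙 E)).v n n (add_zero n))
    obtain ⟨g, hg⟩ := hJ (mappingCone.inr (𝟙 E)) f
      ⟨inferInstance, quasiIso_of_acyclic _ hE (acyclic_mappingCone_id E)⟩
    exact ⟨(Homotopy.ofEq (by simp [hg])).trans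
      ((((mappingCone.homotopyToZeroOfId E).compLeft (mappingCone.inr (𝟙 E))).compRight g).trans
        (Homotopy.ofEq (by simp)))⟩

instance (K : CochainComplex C ℤ) : (kInjectiveResolution.obj K).IsKInjective :=
  (isAcyclicFibrant_kInjectiveResolution_obj K).isKInjective

instance (K : CochainComplex C ℤ) (n : ℤ) : Injective ((kInjectiveResolution.obj K).X n) :=
  (isAcyclicFibrant_kInjectiveResolution_obj K).injective_X n

end CochainComplex

/-! ### Total right derived functors of additive functors -/

section Derived

open HomologicalComplex CochainComplex

section

variable {A B : Type*} [Category* A] [Abelian A] [Category* B] [Abelian B]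

variable (A) in
/-- The inclusion of the full subcategory of K-injective complexes, as a morphism of localizers. -/
def kInjectiveLocalizer : LocalizerMorphism
    ((quasiIso A (ComplexShape.up ℤ)).inverseImage
      (ObjectProperty.ι (fun K : CochainComplex A ℤ => K.IsKInjective)))
    (quasiIso A (ComplexShape.up ℤ)) where
  functor := ObjectProperty.ι _
  map := le_rfl

instance : (kInjectiveLocalizer A).functor.Full :=
  inferInstanceAs (ObjectProperty.ι (fun K : CochainComplex A ℤ => K.IsKInjective)).Full

instance : (kInjectiveLocalizer A).functor.Faithful :=
  inferInstanceAs (ObjectProperty.ι (fun K : CochainComplex A ℤ => K.IsKInjective)).Faithful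

lemma quasiIso_map_of_isKInjective (F : A ⥤ B) [F.Additive]
    {J J' : CochainComplex A ℤ} [J.IsKInjective] [J'.IsKInjective]
    (f : J ⟶ J') [QuasiIso f] : QuasiIso ((F.mapHomologicalComplex (ComplexShape.up ℤ)).map f) := by
  obtain ⟨e, rfl⟩ := (IsKInjective.quasiIso_iff f).1 inferInstance
  exact homotopyEquivalences_le_quasiIso _ _ _ ⟨F.mapHomotopyEquiv e, rfl⟩

/-- Quasi-isomorphisms between K-injective complexes are homotopy equivalences, which additive
functors preserve. The further functor `G` shows that the derived functor stays derived after
postcomposition. -/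
lemma kInjectiveLocalizer_derives [HasDerivedCategory.{w₂} B] (F : A ⥤ B) [F.Additive]
    (H : Type*) [Category* H] (G : DerivedCategory B ⥤ H) :
    (kInjectiveLocalizer A).Derives (complexesToDerived F ⋙ G) := by
  intro J J' f hf
  have := J.property
  have := J'.property
  have : QuasiIso f.hom := hf
  have := quasiIso_map_of_isKInjective F f.hom
  have : IsIso (DerivedCategory.Q.map ((F.mapHomologicalComplex (ComplexShape.up ℤ)).map f.hom)) :=
    inferInstance
  exact inferInstanceAs (IsIso (G.map
    (DerivedCategory.Q.map ((F.mapHomologicalComplex (ComplexShape.up ℤ)).map f.hom))))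

end

universe v' u'

variable {A : Type u'} [Category.{v'} A] [Abelian A] [IsGrothendieckAbelian.{v'} A]
  {B : Type*} [Category* B] [Abelian B]

instance : (kInjectiveLocalizer A).IsRightDerivabilityStructure :=
  (kInjectiveLocalizer A).isRightDerivabilityStructure_of_functorial_resolutions
    (ρ := ObjectProperty.lift _ kInjectiveResolution (fun _ => inferInstance))
    toKInjectiveResolution (fun K => by
      rw [mem_quasiIso_iff]
      exact (acyclicMono_toKInjectiveResolution_app K).2) rfl

variable [HasDerivedCategory.{w₂} B] (F : A ⥤ B) [F.Additive]

lemma hasTotalRightDerived_of_isGrothendieckAbelian : HasTotalRightDerived F := by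
  have h : (kInjectiveLocalizer A).Derives (complexesToDerived F) :=
    kInjectiveLocalizer_derives F _ (𝟭 _)
  have := h.hasPointwiseRightDerivedFunctor
  infer_instance

variable [HasDerivedCategory.{w₁} A] [HasTotalRightDerived F]

/-- The unit `Q(F(K)) ⟶ RF(Q(K))`. -/
noncomputable def totalRightUnit : complexesToDerived F ⟶ DerivedCategory.Q ⋙ totalRight F :=
  (complexesToDerived F).totalRightDerivedUnit DerivedCategory.Q
    (quasiIso A (ComplexShape.up ℤ))

instance : (totalRight F).IsRightDerivedFunctor (totalRightUnit F)
    (quasiIso A (ComplexShape.up ℤ)) := by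
  dsimp only [totalRight, totalRightUnit]
  infer_instance

instance (J : CochainComplex A ℤ) [hJ : J.IsKInjective] : IsIso ((totalRightUnit F).app J) :=
  LocalizerMorphism.Derives.isIso_of_isRightDerivedFunctor
    (kInjectiveLocalizer_derives F _ (𝟭 _)) (RF := totalRight F) (totalRightUnit F) ⟨J, hJ⟩

end Derived

/-! ### The adjunction between derived functors. -/

section Adjunction

open HomologicalComplex Functor

/-- The adjunction between categories of complexes induced by an adjunction. -/
def mapHomologicalComplexAdjunction {A B : Type*} [Category* A] [Category* B] [Abelian A]
    [Abelian B] {G : B ⥤ A} [G.Additive] {F : A ⥤ B} [F.Additive] (adj : G ⊣ F)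
    {ι : Type*} (c : ComplexShape ι) : G.mapHomologicalComplex c ⊣ F.mapHomologicalComplex c where
  unit :=
    { app K :=
        { f i := adj.unit.app (K.X i)
          comm' i j _ := (adj.unit.naturality (K.d i j)).symm }
      naturality _ _ f := hom_ext _ _ fun i => adj.unit.naturality (f.f i) }
  counit :=
    { app K :=
        { f i := adj.counit.app (K.X i)
          comm' i j _ := (adj.counit.naturality (K.d i j)).symm }
      naturality _ _ f := hom_ext _ _ fun i => adj.counit.naturality (f.f i) }
  left_triangle_components K := hom_ext _ _ fun i => adj.left_triangle_components (K.X i)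
  right_triangle_components K := hom_ext _ _ fun i => adj.right_triangle_components (K.X i)

universe v' u'

variable {A : Type u'} [Category.{v'} A] [Abelian A] [IsGrothendieckAbelian.{v'} A]
  {B : Type*} [Category* B] [Abelian B] [HasDerivedCategory.{w₁} A] [HasDerivedCategory.{w₂} B]
  {G : B ⥤ A} [G.Additive] [PreservesFiniteLimits G] [PreservesFiniteColimits G]
  {F : A ⥤ B} [F.Additive] [HasTotalRightDerived F]

/-- The compatibility of an exact functor with the localization functors. -/
noncomputable def mapDerivedIso {A B : Type*} [Category* A] [Category* B] [Abelian A] [Abelian B]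
    [HasDerivedCategory.{w₁} A] [HasDerivedCategory.{w₂} B] (G : B ⥤ A) [G.Additive]
    [PreservesFiniteLimits G] [PreservesFiniteColimits G] :
    DerivedCategory.Q ⋙ G.mapDerivedCategory ≅
      G.mapHomologicalComplex (ComplexShape.up ℤ) ⋙ DerivedCategory.Q :=
  G.mapDerivedCategoryFactors

instance {A B : Type*} [Category* A] [Category* B] [Abelian A] [Abelian B]
    [HasDerivedCategory.{w₁} A] [HasDerivedCategory.{w₂} B] (G : B ⥤ A) [G.Additive]
    [PreservesFiniteLimits G] [PreservesFiniteColimits G] :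
    (G.mapDerivedCategory).IsLeftDerivedFunctor (mapDerivedIso G).hom
    (quasiIso B (ComplexShape.up ℤ)) := isLeftDerivedFunctor_of_inverts _ _ _

instance {A B : Type*} [Category* A] [Category* B] [Abelian A] [Abelian B]
    [HasDerivedCategory.{w₁} A] [HasDerivedCategory.{w₂} B] (G : B ⥤ A) [G.Additive]
    [PreservesFiniteLimits G] [PreservesFiniteColimits G] {H : Type*} [Category* H]
    (F' : DerivedCategory A ⥤ H) : (G.mapDerivedCategory ⋙ F').IsLeftDerivedFunctor
      ((Functor.associator _ _ _).inv ≫ whiskerRight (mapDerivedIso G).hom F')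
      (quasiIso B (ComplexShape.up ℤ)) :=
  isLeftDerivedFunctor_of_inverts _ _
    ((Functor.associator _ _ _).symm ≪≫ isoWhiskerRight (mapDerivedIso G) F')

/-- To derive an adjunction, the composites of the two derived functors must also be derived
functors; this and the preceding instance provide that. -/
instance {H : Type*} [Category* H] (G' : DerivedCategory B ⥤ H) :
    (totalRight F ⋙ G').IsRightDerivedFunctor
      (whiskerRight (totalRightUnit F) G' ≫ (Functor.associator _ _ _).hom)
      (quasiIso A (ComplexShape.up ℤ)) :=
  LocalizerMorphism.Derives.isRightDerivedFunctor_of_isIso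
    (kInjectiveLocalizer_derives F _ G') _ (fun J => by
      have := J.property
      change IsIso (G'.map ((totalRightUnit F).app J.obj) ≫ 𝟙 _)
      infer_instance)

/-- The derived adjunction between an exact functor and the total right derived functor of its
right adjoint. -/
noncomputable def derivedAdjunction (adj : G ⊣ F) : G.mapDerivedCategory ⊣ totalRight F :=
  (mapHomologicalComplexAdjunction adj (ComplexShape.up ℤ)).derived
    (quasiIso B (ComplexShape.up ℤ)) (quasiIso A (ComplexShape.up ℤ))
    (mapDerivedIso G).hom (totalRightUnit F)

lemma derivedAdjunction_unit_fac (adj : G ⊣ F) (K : CochainComplex B ℤ) :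
    (derivedAdjunction adj).unit.app (DerivedCategory.Q.obj K) ≫
      (totalRight F).map ((mapDerivedIso G).hom.app K) =
    DerivedCategory.Q.map
      ((mapHomologicalComplexAdjunction adj (ComplexShape.up ℤ)).unit.app K) ≫
      (totalRightUnit F).app ((G.mapHomologicalComplex (ComplexShape.up ℤ)).obj K) :=
  (mapHomologicalComplexAdjunction adj (ComplexShape.up ℤ)).derivedη_fac_app
    (quasiIso B (ComplexShape.up ℤ)) (mapDerivedIso G).hom (totalRightUnit F) K

lemma derivedAdjunction_counit_fac (adj : G ⊣ F) (K : CochainComplex A ℤ) :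
    G.mapDerivedCategory.map ((totalRightUnit F).app K) ≫
      (derivedAdjunction adj).counit.app (DerivedCategory.Q.obj K) =
    (mapDerivedIso G).hom.app ((F.mapHomologicalComplex (ComplexShape.up ℤ)).obj K) ≫
      DerivedCategory.Q.map
      ((mapHomologicalComplexAdjunction adj (ComplexShape.up ℤ)).counit.app K) :=
  (mapHomologicalComplexAdjunction adj (ComplexShape.up ℤ)).derivedε_fac_app
    (quasiIso A (ComplexShape.up ℤ)) (mapDerivedIso G).hom (totalRightUnit F) K

end Adjunction

/-! ### Sections of sheaves of modules -/

namespace AlgebraicGeometry.Scheme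

/-- The restriction of functions. -/
noncomputable def rres (X : Scheme.{u}) {U V : X.Opens} (h : V ≤ U) : Γ(X, U) →+* Γ(X, V) :=
  (X.presheaf.map (homOfLE h).op).hom

section

variable {X : Scheme.{u}} {U V W : X.Opens}

@[simp]
lemma rres_self (f : Γ(X, U)) : X.rres (le_refl U) f = f := by
  simp [rres]

@[simp]
lemma rres_rres (h : V ≤ U) (h' : W ≤ V) (f : Γ(X, U)) :
    X.rres h' (X.rres h f) = X.rres (h'.trans h) f := by
  change (X.presheaf.map _ ≫ X.presheaf.map _).hom f = _
  rw [← Functor.map_comp]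
  rfl

end

namespace Modules

variable {X : Scheme.{u}} (M : X.Modules) {N : X.Modules} {U V W : X.Opens}

/-- The restriction of sections. -/
noncomputable def res (h : V ≤ U) : Γ(M, U) →+ Γ(M, V) :=
  (M.presheaf.map (homOfLE h).op).hom

variable {M}

@[simp]
lemma res_self (s : Γ(M, U)) : M.res (le_refl U) s = s := by
  simp [res]

@[simp]
lemma res_res (h : V ≤ U) (h' : W ≤ V) (s : Γ(M, U)) :
    M.res h' (M.res h s) = M.res (h'.trans h) s :=
  map_map_apply M h h' s

@[simp]
lemma res_smul (h : V ≤ U) (r : Γ(X, U)) (s : Γ(M, U)) :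
    M.res h (r • s) = X.rres h r • M.res h s :=
  map_smul M (homOfLE h) r s

lemma eq_of_res_eq (s t : Γ(M, U))
    (H : ∀ x ∈ U, ∃ (V : X.Opens) (h : V ≤ U), x ∈ V ∧ M.res h s = M.res h t) : s = t := by
  choose V hV hxV H using fun x : U => H x.1 x.2
  refine TopCat.Sheaf.eq_of_locally_eq' ⟨M.presheaf, M.isSheaf⟩ V U (fun x => homOfLE (hV x))
    (fun x hx => ?_) s t H
  exact Opens.mem_iSup.2 ⟨⟨x, hx⟩, hxV ⟨x, hx⟩⟩

lemma exists_glue_iSup {ι : Type*} {V : ι → X.Opens} (h : ∀ i, V i ≤ U) (H : U ≤ ⨆ i, V i)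
    (s : ∀ i, Γ(M, V i))
    (hs : ∀ i j, M.res (inf_le_left : V i ⊓ V j ≤ V i) (s i) =
      M.res (inf_le_right : V i ⊓ V j ≤ V j) (s j)) :
    ∃ r : Γ(M, U), ∀ i, M.res (h i) r = s i :=
  (TopCat.Sheaf.existsUnique_gluing' ⟨M.presheaf, M.isSheaf⟩ V U (fun i => homOfLE (h i)) H s
    hs).exists

lemma exists_glue (h₁ : V ≤ U) (h₂ : W ≤ U) (H : U ≤ V ⊔ W) (s : Γ(M, V)) (t : Γ(M, W))
    (hst : M.res (inf_le_left : V ⊓ W ≤ V) s = M.res (inf_le_right : V ⊓ W ≤ W) t) :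
    ∃ r : Γ(M, U), M.res h₁ r = s ∧ M.res h₂ r = t := by
  let A : Bool → X.Opens := fun b => Bool.rec W V b
  let σ : ∀ b, Γ(M, A b) := fun b => Bool.rec t s b
  have hA : ∀ b, A b ≤ U := by rintro (_ | _) <;> assumption
  have hσ : ∀ a b, M.res (inf_le_left : A a ⊓ A b ≤ A a) (σ a) =
      M.res (inf_le_right : A a ⊓ A b ≤ A b) (σ b) := by
    rintro (_ | _) (_ | _)
    · rfl
    · have := congr_arg (M.res (le_inf inf_le_right inf_le_left : W ⊓ V ≤ V ⊓ W)) hst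
      rw [res_res, res_res] at this
      exact this.symm
    · exact hst
    · rfl
  obtain ⟨r, hr⟩ := exists_glue_iSup (M := M) hA
    (H.trans (sup_le (le_iSup A true) (le_iSup A false))) σ hσ
  exact ⟨r, hr true, hr false⟩

namespace Hom

/-- The map induced by a morphism on sections. -/
noncomputable def sec (φ : M ⟶ N) (U : X.Opens) : Γ(M, U) →+ Γ(N, U) :=
  (φ.app U).hom

@[simp]
lemma sec_smul (φ : M ⟶ N) (r : Γ(X, U)) (s : Γ(M, U)) : φ.sec U (r • s) = r • φ.sec U s :=
  Hom.app_smul φ r s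

lemma res_sec (φ : M ⟶ N) (h : V ≤ U) (s : Γ(M, U)) :
    N.res h (φ.sec U s) = φ.sec V (M.res h s) :=
  (ConcreteCategory.congr_hom (φ.mapPresheaf.naturality (homOfLE h).op) s).symm

@[simp]
lemma sec_comp {P : X.Modules} (φ : M ⟶ N) (ψ : N ⟶ P) (s : Γ(M, U)) :
    (φ ≫ ψ).sec U s = ψ.sec U (φ.sec U s) := rfl

@[simp]
lemma sec_id (s : Γ(M, U)) : sec (𝟙 M) U s = s := rfl

@[simp]
lemma sec_zero (s : Γ(M, U)) : sec (0 : M ⟶ N) U s = 0 := rfl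

@[simp]
lemma sec_add (φ ψ : M ⟶ N) (s : Γ(M, U)) : (φ + ψ).sec U s = φ.sec U s + ψ.sec U s := rfl

@[simp]
lemma sec_sub (φ ψ : M ⟶ N) (s : Γ(M, U)) : (φ - ψ).sec U s = φ.sec U s - ψ.sec U s := rfl

end Hom

lemma hom_ext_sec {φ ψ : M ⟶ N} (h : ∀ (U : X.Opens) (s : Γ(M, U)), φ.sec U s = ψ.sec U s) :
    φ = ψ := by
  ext U s
  exact h U s

/-- The functor of sections over an open subset. -/
noncomputable abbrev sections (U : X.Opens) : X.Modules ⥤ Ab.{u} :=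
  toPresheaf X ⋙ (CategoryTheory.evaluation _ _).obj (op U)

instance (U : X.Opens) : PreservesLimits (sections U) :=
  by
  have : PreservesLimitsOfSize.{u, u} ((CategoryTheory.evaluation X.Opensᵒᵖ Ab.{u}).obj (op U)) :=
    ⟨fun {_} _ => inferInstance⟩
  exact comp_preservesLimits _ _

instance (U : X.Opens) : (sections U).Additive where

lemma sec_injective (φ : M ⟶ N) [Mono φ] (U : X.Opens) : Function.Injective (φ.sec U) := by
  have : Mono ((sections U).map φ) := inferInstance
  exact (AddCommGrpCat.mono_iff_injective _).1 this

lemma exists_sec_eq_of_mono {S : ShortComplex X.Modules} (hS : S.Exact) [Mono S.f]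
    (s : Γ(S.X₂, U)) (hs : S.g.sec U s = 0) : ∃ t : Γ(S.X₁, U), S.f.sec U t = s := by
  have h := hS.map_of_mono_of_preservesKernel (sections U) inferInstance inferInstance
  exact (ShortComplex.ab_exact_iff _).1 h s hs

/-- A family of submodules of the modules of sections of `M` which is stable under restriction
and local. -/
structure SubSheaf (M : X.Modules) where
  /-- the submodule of the module of sections over an open subset -/
  obj (U : X.Opens) : Submodule Γ(X, U) Γ(M, U)
  res_mem {U V : X.Opens} (h : V ≤ U) (s : Γ(M, U)) (hs : s ∈ obj U) : M.res h s ∈ obj V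
  of_local {U : X.Opens} (s : Γ(M, U))
    (hs : ∀ x ∈ U, ∃ (V : X.Opens) (h : V ≤ U), x ∈ V ∧ M.res h s ∈ obj V) : s ∈ obj U

namespace SubSheaf

variable (P : SubSheaf M)

/-- The presheaf of modules attached to `P : SubSheaf M`. -/
def presheafSubmodule : M.val.Submodule where
  obj U := P.obj U.unop
  map f _ hs := P.res_mem (leOfHom f.unop) _ hs

lemma isSheaf : Presheaf.IsSheaf (Opens.grothendieckTopology X)
    P.presheafSubmodule.toPresheafOfModules.presheaf := by
  rw [Presheaf.isSheaf_iff_isSheaf_forget _ _ (CategoryTheory.forget Ab.{u}),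
    isSheaf_iff_isSheaf_of_type]
  let F := M.presheaf ⋙ CategoryTheory.forget Ab.{u}
  have hF : Presieve.IsSheaf (Opens.grothendieckTopology X) F := by
    rw [← isSheaf_iff_isSheaf_of_type]
    exact (Presheaf.isSheaf_iff_isSheaf_forget _ _ (CategoryTheory.forget Ab.{u})).1 M.isSheaf
  let G : Subfunctor F :=
    { obj := fun U => {s : Γ(M, U.unop) | s ∈ P.obj U.unop}
      map := fun f _ hs => P.res_mem (leOfHom f.unop) _ hs }
  change Presieve.IsSheaf _ G.toFunctor
  rw [Subfunctor.isSheaf_iff _ hF]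
  intro U s hs
  refine P.of_local s fun x hx => ?_
  obtain ⟨V, f, hf, hxV⟩ := hs x hx
  exact ⟨V, leOfHom f, hxV, hf⟩

/-- The sheaf of modules attached to `P : SubSheaf M`. -/
noncomputable def toModules : X.Modules :=
  SheafOfModules.mk P.presheafSubmodule.toPresheafOfModules P.isSheaf

/-- The inclusion of the sheaf of modules attached to `P : SubSheaf M`. -/
noncomputable def ι : P.toModules ⟶ M :=
  SheafOfModules.Hom.mk P.presheafSubmodule.ι

lemma ι_sec_mem (s : Γ(P.toModules, U)) : P.ι.sec U s ∈ P.obj U :=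
  Subtype.property (p := fun t : Γ(M, U) => t ∈ P.obj U) s

instance : Mono P.ι where
  right_cancellation {K} g h e := by
    ext U s
    have := ConcreteCategory.congr_hom (congr_arg (fun k => Hom.app k U) e) s
    exact Subtype.ext this

/-- A morphism whose values on sections belong to `P` factors through `P.ι`. -/
lemma exists_lift (φ : N ⟶ M) (h : ∀ (U : X.Opens) (s : Γ(N, U)), φ.sec U s ∈ P.obj U) :
    ∃ ψ : N ⟶ P.toModules, ψ ≫ P.ι = φ :=
  ⟨SheafOfModules.Hom.mk (PresheafOfModules.homMk
    { app := fun U => AddCommGrpCat.ofHom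
        { toFun := fun s => ⟨φ.app U.unop s, h _ s⟩
          map_zero' := Subtype.ext (map_zero (φ.app U.unop).hom)
          map_add' := fun s t => Subtype.ext (map_add (φ.app U.unop).hom s t) }
      naturality := fun U V f => by
        ext s
        exact Subtype.ext (ConcreteCategory.congr_hom (φ.mapPresheaf.naturality f) s) }
    (fun U r s => Subtype.ext (Hom.app_smul φ r s))), rfl⟩

end SubSheaf

/-- The sections which are locally in the image of a morphism. -/
def localImage (φ : M ⟶ N) : SubSheaf N where
  obj U :=
    { carrier := {s | ∀ x ∈ U, ∃ (V : X.Opens) (h : V ≤ U), x ∈ V ∧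
        ∃ t : Γ(M, V), φ.sec V t = N.res h s}
      zero_mem' := fun x hx => ⟨U, le_rfl, hx, 0, by simp⟩
      add_mem' := by
        intro s s' hs hs' x hx
        obtain ⟨V, h, hxV, t, ht⟩ := hs x hx
        obtain ⟨V', h', hxV', t', ht'⟩ := hs' x hx
        refine ⟨V ⊓ V', inf_le_left.trans h, ⟨hxV, hxV'⟩,
          M.res inf_le_left t + M.res inf_le_right t', ?_⟩
        rw [map_add, ← Hom.res_sec, ← Hom.res_sec, ht, ht', res_res, res_res, map_add]
      smul_mem' := by
        intro r s hs x hx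
        obtain ⟨V, h, hxV, t, ht⟩ := hs x hx
        exact ⟨V, h, hxV, X.rres h r • t, by rw [Hom.sec_smul, ht, res_smul]⟩ }
  res_mem {U V} h s hs x hx := by
    obtain ⟨W, h', hxW, t, ht⟩ := hs x (h hx)
    refine ⟨V ⊓ W, inf_le_left, ⟨hx, hxW⟩, M.res inf_le_right t, ?_⟩
    rw [← Hom.res_sec, ht, res_res, res_res]
  of_local s hs x hx := by
    obtain ⟨V, h, hxV, H⟩ := hs x hx
    obtain ⟨W, h', hxW, t, ht⟩ := H x hxV
    exact ⟨W, h'.trans h, hxW, t, by rw [ht, res_res]⟩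

/-- The subsheaf of sections locally in the image has an inclusion that is both mono and epi, hence
invertible. -/
lemma exists_sec_eq_of_epi (φ : M ⟶ N) [Epi φ] (s : Γ(N, U)) {x : X} (hx : x ∈ U) :
    ∃ (V : X.Opens) (h : V ≤ U), x ∈ V ∧ ∃ t : Γ(M, V), φ.sec V t = N.res h s := by
  obtain ⟨ψ, hψ⟩ := (localImage φ).exists_lift φ
    (fun U s x hx => ⟨U, le_rfl, hx, s, by rw [res_self]⟩)
  have : Epi (ψ ≫ (localImage φ).ι) := by rw [hψ]; infer_instance
  have : Epi (localImage φ).ι := epi_of_epi ψ _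
  have : IsIso (localImage φ).ι := isIso_of_mono_of_epi _
  have e : (localImage φ).ι.sec U ((inv (localImage φ).ι).sec U s) = s := by
    rw [← Hom.sec_comp, IsIso.inv_hom_id, Hom.sec_id]
  have := (localImage φ).ι_sec_mem ((inv (localImage φ).ι).sec U s)
  rw [e] at this
  exact this x hx

lemma exists_sec_eq_of_exact {S : ShortComplex X.Modules} (hS : S.Exact) (s : Γ(S.X₂, U))
    (hs : S.g.sec U s = 0) {x : X} (hx : x ∈ U) :
    ∃ (V : X.Opens) (h : V ≤ U), x ∈ V ∧ ∃ t : Γ(S.X₁, V), S.f.sec V t = S.X₂.res h s := by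
  have := hS.epi_toCycles
  obtain ⟨c, hc⟩ := exists_sec_eq_of_mono
    (ShortComplex.exact_of_f_is_kernel (.mk _ _ S.iCycles_g) S.cyclesIsKernel) s hs
  obtain ⟨V, h, hxV, t, ht⟩ := exists_sec_eq_of_epi S.toCycles c hx
  refine ⟨V, h, hxV, t, ?_⟩
  have := congr_arg (S.iCycles.sec V) ht
  rw [← Hom.sec_comp, S.toCycles_i, ← Hom.res_sec] at this
  rw [this, ← hc]

lemma eq_zero_of_isZero (hM : IsZero M) (s : Γ(M, U)) : s = 0 := by
  rw [← Hom.sec_id s, (IsZero.iff_id_eq_zero _).1 hM, Hom.sec_zero]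

lemma isZero_of_forall_eq_zero (h : ∀ (U : X.Opens) (s : Γ(M, U)), s = 0) : IsZero M :=
  (IsZero.iff_id_eq_zero _).2 (hom_ext_sec fun U s => (h U s).trans (h U _).symm)

/-! ### Sections of complexes of sheaves of modules -/

section Complexes

variable {K : CochainComplex X.Modules ℤ} {i j k : ℤ}

lemma d_sec_d_sec (s : Γ(K.X i, U)) : (K.d j k).sec U ((K.d i j).sec U s) = 0 := by
  rw [← Hom.sec_comp, K.d_comp_d, Hom.sec_zero]

lemma f_sec_d_sec {L : CochainComplex X.Modules ℤ} (φ : K ⟶ L) (s : Γ(K.X i, U)) :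
    (φ.f j).sec U ((K.d i j).sec U s) = (L.d i j).sec U ((φ.f i).sec U s) := by
  rw [← Hom.sec_comp, ← Hom.sec_comp, φ.comm]

lemma exists_iCycles_sec_eq (hij : i + 1 = j) (s : Γ(K.X i, U)) (hs : (K.d i j).sec U s = 0) :
    ∃ c : Γ(K.cycles i, U), (K.iCycles i).sec U c = s :=
  exists_sec_eq_of_mono (ShortComplex.exact_of_f_is_kernel (.mk _ _ (K.iCycles_d i j))
    (K.cyclesIsKernel i j (by simp [← hij]))) s hs

lemma d_sec_iCycles_sec (c : Γ(K.cycles i, U)) : (K.d i j).sec U ((K.iCycles i).sec U c) = 0 := by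
  rw [← Hom.sec_comp, K.iCycles_d, Hom.sec_zero]

/-- A section of `K` which is locally a boundary. -/
def IsLocalBoundary (K : CochainComplex X.Modules ℤ) (i j : ℤ) (z : Γ(K.X j, U)) : Prop :=
  ∀ x ∈ U, ∃ (V : X.Opens) (h : V ≤ U), x ∈ V ∧ ∃ y : Γ(K.X i, V), (K.d i j).sec V y = (K.X j).res h z

/-- The dictionary between cohomology sheaves and sections: a class vanishes exactly when its
cocycle is locally a boundary. -/
lemma homologyπ_sec_eq_zero_iff (hij : i + 1 = j) (c : Γ(K.cycles j, U)) :
    (K.homologyπ j).sec U c = 0 ↔ IsLocalBoundary K i j ((K.iCycles j).sec U c) := by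
  constructor
  · intro h x hx
    obtain ⟨V, hV, hxV, y, hy⟩ := exists_sec_eq_of_exact (ShortComplex.exact_of_g_is_cokernel
      (.mk _ _ (K.toCycles_comp_homologyπ i j)) (K.homologyIsCokernel i j (by simp [← hij]))) c h hx
    refine ⟨V, hV, hxV, y, ?_⟩
    have := congr_arg ((K.iCycles j).sec V) hy
    rw [← Hom.sec_comp, K.toCycles_i, ← Hom.res_sec] at this
    exact this
  · intro h
    refine eq_of_res_eq _ _ fun x hx => ?_
    obtain ⟨V, hV, hxV, y, hy⟩ := h x hx
    refine ⟨V, hV, hxV, ?_⟩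
    have e : (K.toCycles i j).sec V y = (K.cycles j).res hV c := by
      apply sec_injective (K.iCycles j) V
      rw [← Hom.sec_comp, K.toCycles_i, ← Hom.res_sec, hy]
    rw [Hom.res_sec, ← e, ← Hom.sec_comp, K.toCycles_comp_homologyπ, Hom.sec_zero, map_zero]

lemma exists_homologyπ_sec_eq (h : Γ(K.homology j, U)) {x : X} (hx : x ∈ U) :
    ∃ (V : X.Opens) (hV : V ≤ U), x ∈ V ∧ ∃ c : Γ(K.cycles j, V),
      (K.homologyπ j).sec V c = (K.homology j).res hV h :=
  exists_sec_eq_of_epi _ _ hx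

lemma isZero_homology_iff (hij : i + 1 = j) (hjk : j + 1 = k) :
    IsZero (K.homology j) ↔ ∀ (U : X.Opens) (z : Γ(K.X j, U)), (K.d j k).sec U z = 0 →
      IsLocalBoundary K i j z := by
  constructor
  · intro h U z hz
    obtain ⟨c, rfl⟩ := exists_iCycles_sec_eq hjk z hz
    rw [← homologyπ_sec_eq_zero_iff hij]
    exact eq_zero_of_isZero h _
  · intro H
    refine isZero_of_forall_eq_zero fun U h => eq_of_res_eq _ _ fun x hx => ?_
    obtain ⟨V, hV, hxV, c, hc⟩ := exists_homologyπ_sec_eq h hx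
    refine ⟨V, hV, hxV, ?_⟩
    rw [← hc, (homologyπ_sec_eq_zero_iff hij c).2 (H _ _ (d_sec_iCycles_sec c)), map_zero]

lemma acyclic_iff_isLocalBoundary :
    K.Acyclic ↔ ∀ (j : ℤ) (U : X.Opens) (z : Γ(K.X j, U)), (K.d j (j + 1)).sec U z = 0 →
      IsLocalBoundary K (j - 1) j z := by
  refine forall_congr' fun j => ?_
  rw [HomologicalComplex.exactAt_iff_isZero_homology]
  exact isZero_homology_iff (by simp) rfl

end Complexes

end Modules

end AlgebraicGeometry.Scheme

/-! ### Extension of sections of injective sheaves of modules -/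

namespace PresheafOfModules

section

variable {C : Type u} [SmallCategory C] {R : Cᵒᵖ ⥤ RingCat.{u}}

lemma exists_comp_eq_of_injective {P Q J : PresheafOfModules.{u} R} [Injective J] (ψ : P ⟶ Q)
    (φ : P ⟶ J) (h : ∀ (V : Cᵒᵖ) (x : P.obj V), ψ.app V x = 0 → φ.app V x = 0) :
    ∃ τ : Q ⟶ J, ψ ≫ τ = φ := by
  have h' : kernel.ι ψ ≫ φ = 0 := by
    ext V x
    refine h V _ ?_
    have := congr_arg (fun k => PresheafOfModules.Hom.app k V) (kernel.condition ψ)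
    exact ConcreteCategory.congr_hom this x
  have := ShortComplex.exact_of_f_is_kernel (.mk _ _ (kernel.condition ψ)) (kernelIsKernel ψ)
  exact ⟨this.descToInjective φ h', this.comp_descToInjective φ h'⟩

lemma freeObjDesc_apply {F : Cᵒᵖ ⥤ Type u} {G : PresheafOfModules.{u} R}
    (φ : F ⟶ G.presheaf ⋙ CategoryTheory.forget _) (V : Cᵒᵖ) (x : F.obj V →₀ R.obj V) :
    (freeObjDesc φ).app V x = x.sum fun t b => b • (show G.obj V from φ.app V t) := by
  change Finsupp.lift _ _ _ _ x = _
  rw [Finsupp.lift_apply]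
  rfl

lemma presheaf_map_smul (G : PresheafOfModules.{u} R) {V W : Cᵒᵖ} (f : V ⟶ W) (r : R.obj V)
    (x : G.obj V) : (show G.obj W from G.presheaf.map f (r • x)) =
      R.map f r • (show G.obj W from G.presheaf.map f x) :=
  G.map_smul f r x

lemma presheaf_map_map (G : PresheafOfModules.{u} R) {V W T : Cᵒᵖ} (f : V ⟶ W) (g : W ⟶ T)
    (x : G.obj V) : (show G.obj T from G.presheaf.map g (G.presheaf.map f x)) =
      G.presheaf.map (f ≫ g) x := by
  rw [Functor.map_comp]
  rfl

end

section

variable {C : Type u} [Preorder C] {R : Cᵒᵖ ⥤ RingCat.{u}} {ι : Type u} (W : ι → C)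

/-- The presheaf of sets with value `{i // V ≤ W i}` on `V`. -/
def membershipPresheaf : Cᵒᵖ ⥤ Type u where
  obj V := {i // V.unop ≤ W i}
  map f := ↾fun i => ⟨i.1, (leOfHom f.unop).trans i.2⟩

variable {W}

/-- The morphism attached to a family of sections over the objects `W i`. -/
noncomputable def ofFamily {G : PresheafOfModules.{u} R} (g : ∀ i, G.obj (op (W i))) :
    membershipPresheaf W ⟶ G.presheaf ⋙ CategoryTheory.forget _ where
  app V := ↾fun i => G.presheaf.map (homOfLE i.2).op (g i.1)
  naturality V V' f := by
    ext i
    exact (G.presheaf_map_map _ _ _).symm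

/-- Sections of injective presheaves of modules with prescribed multiples. -/
lemma exists_smul_map_eq (J : PresheafOfModules.{u} R) [Injective J] {U : C} (hW : ∀ i, W i ≤ U)
    (a : ∀ i, R.obj (op (W i))) (s : ∀ i, J.obj (op (W i)))
    (H : ∀ (V : C) (b : {i // V ≤ W i} →₀ R.obj (op V)),
      (b.sum fun i c => c * R.map (homOfLE i.2).op (a i.1)) = 0 →
      (b.sum fun i c => c • (show J.obj (op V) from J.presheaf.map (homOfLE i.2).op (s i.1))) = 0) :
    ∃ t : J.obj (op U), ∀ i,
      a i • (show J.obj (op (W i)) from J.presheaf.map (homOfLE (hW i)).op t) = s i := by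
  -- A map from `Q` to `J` is a section of `J` over `U`. Hypothesis `H` says that every relation
  -- among the multiples `a i • e` holds among the `s i`, so sending `a i • e` to `s i` is well
  -- defined and extends to `Q` by injectivity; `t` is the image of `e`.
  let Q : PresheafOfModules.{u} R := freeObj (yoneda.obj U)
  let e : Q.obj (op U) := ModuleCat.freeMk (𝟙 U)
  have he : ∀ {V : C} (h : V ≤ U),
      (show Q.obj (op V) from Q.presheaf.map (homOfLE h).op e) = Finsupp.single (homOfLE h) 1 :=
    fun h => ModuleCat.freeDesc_apply _ _
  let g : ∀ i, Q.obj (op (W i)) := fun i =>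
    a i • (show Q.obj (op (W i)) from Q.presheaf.map (homOfLE (hW i)).op e)
  have hg : ∀ (V : C) (i : {i // V ≤ W i}),
      (show Q.obj (op V) from Q.presheaf.map (homOfLE i.2).op (g i.1)) =
        Finsupp.single (homOfLE (i.2.trans (hW i.1))) (R.map (homOfLE i.2).op (a i.1)) := by
    intro V i
    refine (Q.presheaf_map_smul _ _ _).trans ?_
    rw [presheaf_map_map]
    refine (congr_arg _ (he (i.2.trans (hW i.1)))).trans ?_
    exact (Finsupp.smul_single _ _ _).trans (by rw [smul_eq_mul, mul_one])
  obtain ⟨τ, hτ⟩ := exists_comp_eq_of_injective (freeObjDesc (ofFamily g))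
    (freeObjDesc (ofFamily s)) (by
      intro V (x : {i // V.unop ≤ W i} →₀ R.obj V) hx
      refine (freeObjDesc_apply _ _ _).trans (H V.unop x ?_)
      by_cases hV : V.unop ≤ U
      · replace hx := (freeObjDesc_apply (ofFamily g) V x).symm.trans hx
        have key : Finsupp.single (homOfLE hV)
            (x.sum fun i c => c * R.map (homOfLE i.2).op (a i.1)) = 0 := by
          refine .trans ?_ hx
          rw [Finsupp.single_sum]
          refine Finset.sum_congr rfl fun i _ => ?_
          refine .trans ?_ (congr_arg (x i • ·) (hg V.unop i)).symm
          exact ((Finsupp.smul_single _ _ _).trans (by rw [smul_eq_mul])).symm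
        exact Finsupp.single_eq_zero.1 key
      · have : x = 0 := by
          ext i
          exact (hV (i.2.trans (hW i.1))).elim
        rw [this, Finsupp.sum_zero_index])
  refine ⟨τ.app _ e, fun i => ?_⟩
  have h₁ := ConcreteCategory.congr_hom
    (congr_arg (fun k => PresheafOfModules.Hom.app k (op (W i))) hτ)
    (ModuleCat.freeMk (⟨i, le_rfl⟩ : {k // W i ≤ W k}))
  have h₂ : ∀ {G : PresheafOfModules.{u} R} (g : ∀ i, G.obj (op (W i))),
      (freeObjDesc (ofFamily g)).app (op (W i)) (ModuleCat.freeMk ⟨i, le_rfl⟩) = g i := by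
    intro G g
    refine (ModuleCat.freeDesc_apply _ _).trans ?_
    exact ConcreteCategory.congr_hom (G.presheaf.map_id (op (W i))) (g i)
  have h₃ : τ.app (op (W i)) (g i) = s i :=
    (congr_arg (τ.app (op (W i))) (h₂ g)).symm.trans (h₁.trans (h₂ s))
  rw [← h₃]
  refine .trans ?_ (map_smul (τ.app (op (W i))).hom _ _).symm
  exact congr_arg (a i • ·) (PresheafOfModules.naturality_apply τ (homOfLE (hW i)).op e).symm

end

end PresheafOfModules

namespace AlgebraicGeometry.Scheme.Modules

variable {X : Scheme.{u}} (J : X.Modules) {U V : X.Opens}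

instance [Injective J] : Injective ((toPresheafOfModules X).obj J) :=
  Injective.injective_of_adjoint (sheafifyAdjunction X) J

lemma exists_smul_res_eq [Injective J] {ι : Type u} {W : ι → X.Opens} (hW : ∀ i, W i ≤ U)
    (a : ∀ i, Γ(X, W i)) (s : ∀ i, Γ(J, W i))
    (H : ∀ (V : X.Opens) (b : {i // V ≤ W i} →₀ Γ(X, V)),
      (b.sum fun i c => c * X.rres i.2 (a i.1)) = 0 →
      (b.sum fun i c => c • J.res i.2 (s i.1)) = 0) :
    ∃ t : Γ(J, U), ∀ i, a i • J.res (hW i) t = s i :=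
  PresheafOfModules.exists_smul_map_eq ((toPresheafOfModules X).obj J) hW a s H

/-- A sheaf of modules is flasque if sections extend to larger open subsets. -/
def IsFlasque (M : X.Modules) : Prop :=
  ∀ {U V : X.Opens} (h : V ≤ U), Function.Surjective (M.res h)

lemma isFlasque_of_injective [Injective J] : IsFlasque J := by
  intro U V h s
  obtain ⟨t, ht⟩ := exists_smul_res_eq J (ι := PUnit.{u + 1}) (W := fun _ => V) (fun _ => h)
    (fun _ => 1) (fun _ => s) (by
      intro T b hb
      refine Finset.sum_eq_zero fun i hi => ?_
      have hi' : ∀ k, k = i := fun k => Subsingleton.elim _ _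
      replace hb : (∑ k ∈ b.support, b k * X.rres k.2 1) = 0 := hb
      rw [Finset.sum_eq_single_of_mem i hi (fun k _ hk => (hk (hi' k)).elim), map_one,
        mul_one] at hb
      exact (congr_arg (· • _) hb).trans (zero_smul _ _))
  exact ⟨t, by simpa using ht ⟨⟩⟩

lemma isUnit_rres_basicOpen (f : Γ(X, U)) : IsUnit (X.rres (X.basicOpen_le f) f) :=
  X.toRingedSpace.isUnit_res_basicOpen f

lemma exists_pow_mul_eq_rres (hU : IsAffineOpen U) (f : Γ(X, U)) {ι : Type*} (T : Finset ι)
    (s : ι → Γ(X, X.basicOpen f)) : ∃ (n : ℕ) (a : ι → Γ(X, U)), ∀ i ∈ T,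
      X.rres (X.basicOpen_le f) (a i) = X.rres (X.basicOpen_le f) f ^ n * s i := by
  have := hU.isLocalization_basicOpen f
  obtain ⟨⟨_, n, rfl⟩, h⟩ := IsLocalization.exist_integer_multiples (Submonoid.powers f) T s
  choose! a ha using h
  refine ⟨n, a, fun i hi => (ha i hi).trans ((Algebra.smul_def _ _).trans ?_)⟩
  exact congr_arg (· * s i) (map_pow (X.rres (X.basicOpen_le f)) f n)

lemma exists_pow_mul_eq_zero (hU : IsAffineOpen U) (f a : Γ(X, U))
    (h : X.rres (X.basicOpen_le f) a = 0) : ∃ n : ℕ, f ^ n * a = 0 := by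
  have := hU.isLocalization_basicOpen f
  obtain ⟨⟨_, n, rfl⟩, h⟩ := (IsLocalization.map_eq_zero_iff (Submonoid.powers f)
    Γ(X, X.basicOpen f) a).1 h
  exact ⟨n, h⟩

/-- Baer's criterion for sections over an affine open. A relation among elements of `K` over a
smaller open must be respected by `φ`: on a basic open `D(f)`, clearing denominators and multiplying
by a further power of `f` turns it into a relation over `U`, and `f` is invertible on `D(f)`. -/
lemma exists_smul_eq_of_isAffineOpen [Injective J] (hU : IsAffineOpen U) (K : Ideal Γ(X, U))
    (φ : K →ₗ[Γ(X, U)] Γ(J, U)) : ∃ t : Γ(J, U), ∀ k : K, (k : Γ(X, U)) • t = φ k := by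
  obtain ⟨t, ht⟩ := exists_smul_res_eq J (ι := K) (W := fun _ => U) (fun _ => le_rfl)
    (fun k => (k : Γ(X, U))) φ (by
      intro V b hb
      refine eq_of_res_eq _ _ fun x hx => ?_
      by_cases hV : V ≤ U
      · obtain ⟨f, hfV, hxf⟩ := hU.exists_basicOpen_le ⟨x, hx⟩ (hV hx)
        refine ⟨X.basicOpen f, hfV, hxf, ?_⟩
        obtain ⟨n, a, ha⟩ := exists_pow_mul_eq_rres hU f b.support (fun i => X.rres hfV (b i))
        have h₁ : X.rres (X.basicOpen_le f) (∑ i ∈ b.support, a i * i.1.1) = 0 := by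
          have := congr_arg (X.rres hfV) hb
          rw [Finsupp.sum, map_sum, map_zero] at this
          rw [map_sum, ← mul_zero (X.rres (X.basicOpen_le f) f ^ n), ← this, Finset.mul_sum]
          refine Finset.sum_congr rfl fun i hi => ?_
          rw [map_mul, ha i hi, map_mul, rres_rres, mul_assoc]
        obtain ⟨m, hm⟩ := exists_pow_mul_eq_zero hU f _ h₁
        have h₂ : ∑ i ∈ b.support, (f ^ m * a i) • φ i.1 = 0 := by
          have e : ∑ i ∈ b.support, (f ^ m * a i) • i.1 = 0 := by
            ext
            rw [Finset.mul_sum] at hm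
            simpa [mul_assoc] using hm
          have := congr_arg φ e
          rw [map_sum, map_zero] at this
          exact (Finset.sum_congr rfl fun i _ => (φ.map_smul _ _).symm).trans this
        have h₃ := congr_arg (J.res (X.basicOpen_le f)) h₂
        rw [map_sum, map_zero] at h₃
        rw [map_zero]
        refine ((isUnit_rres_basicOpen f).pow (m + n)).smul_eq_zero.1 (.trans ?_ h₃)
        rw [Finsupp.sum, map_sum, Finset.smul_sum]
        refine Finset.sum_congr rfl fun i hi => ?_
        rw [res_smul, res_smul, res_res, map_mul, map_pow, ha i hi, ← mul_assoc,
          ← pow_add, smul_smul]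
      · have : b = 0 := by
          ext i
          exact (hV i.2).elim
        exact ⟨V, le_rfl, hx, by rw [this, Finsupp.sum_zero_index, map_zero]⟩)
  exact ⟨t, by simpa using ht⟩

end AlgebraicGeometry.Scheme.Modules

/-! ### Sections of quasi-coherent sheaves over affine opens -/

namespace AlgebraicGeometry.Scheme.Modules

variable {X : Scheme.{u}} {U V W : X.Opens}

lemma fromSpec_image_le (hV : IsAffineOpen V) (U : (Spec Γ(X, V)).Opens) :
    hV.fromSpec ''ᵁ U ≤ V := by
  have := hV.fromSpec.image_le_opensRange U
  rwa [hV.opensRange_fromSpec] at this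

lemma fromSpec_image_top (hV : IsAffineOpen V) : hV.fromSpec ''ᵁ ⊤ = V := by
  rw [Hom.image_top_eq_opensRange, hV.opensRange_fromSpec]

lemma fromSpec_appIso_inv (hV : IsAffineOpen V) (U : (Spec Γ(X, V)).Opens) (r : Γ(X, V)) :
    (hV.fromSpec.appIso U).inv ((Spec Γ(X, V)).presheaf.map U.leTop.op
      ((Scheme.ΓSpecIso Γ(X, V)).inv r)) = X.rres (fromSpec_image_le hV U) r := by
  have h : (Scheme.ΓSpecIso Γ(X, V)).inv ≫ (Spec Γ(X, V)).presheaf.map U.leTop.op ≫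
      (hV.fromSpec.appIso U).inv = X.presheaf.map (homOfLE (fromSpec_image_le hV U)).op := by
    rw [← Category.assoc, Iso.comp_inv_eq, Hom.appIso_hom', Hom.map_appLE, Hom.appLE,
      hV.fromSpec_app_self, Category.assoc, ← Functor.map_comp]
    rfl
  exact ConcreteCategory.congr_hom h r

lemma smul_restrict_fromSpec (M : X.Modules) (hV : IsAffineOpen V) (U : (Spec Γ(X, V)).Opens)
    (r : Γ(X, V)) (x : Γ(M, hV.fromSpec ''ᵁ U)) :
    (show Γ(M.restrict hV.fromSpec, U) from r • (show Γ(M.restrict hV.fromSpec, U) from x)) =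
      X.rres (fromSpec_image_le hV U) r • x := by
  rw [← fromSpec_appIso_inv]
  rfl

/-- The condition that the sections of `M` over basic open subsets of affine opens are obtained
by localization. -/
structure HasLocalizedSections (M : X.Modules) : Prop where
  exists_pow_smul_eq_zero (V : X.Opens) (hV : IsAffineOpen V) (f : Γ(X, V)) (s : Γ(M, V))
    (hs : M.res (X.basicOpen_le f) s = 0) : ∃ n : ℕ, f ^ n • s = 0
  exists_res_eq_pow_smul (V : X.Opens) (hV : IsAffineOpen V) (f : Γ(X, V))
    (s : Γ(M, X.basicOpen f)) : ∃ (n : ℕ) (t : Γ(M, V)),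
      M.res (X.basicOpen_le f) t = X.rres (X.basicOpen_le f) f ^ n • s

lemma hasLocalizedSections_of_isQuasicoherent (M : X.Modules) [M.IsQuasicoherent] :
    HasLocalizedSections M := by
  have key : ∀ (V : X.Opens) (hV : IsAffineOpen V) (f : Γ(X, V)),
      IsLocalizedModule (.powers f) ((modulesSpecToSheaf.obj (M.restrict hV.fromSpec)).obj.map
        (PrimeSpectrum.basicOpen f).leTop.op).hom := by
    intro V hV f
    have : (M.restrict hV.fromSpec).IsQuasicoherent := isQuasicoherent_restrictFunctor _ _
    exact (isIso_fromTildeΓ_iff_isLocalizing _).1 inferInstance f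
  have h₁ : ∀ {V : X.Opens} (hV : IsAffineOpen V) (f : Γ(X, V)),
      hV.fromSpec ''ᵁ (PrimeSpectrum.basicOpen f) = X.basicOpen f :=
    fun hV f => hV.fromSpec_image_basicOpen f
  constructor
  · intro V hV f s hs
    have := key V hV f
    obtain ⟨⟨_, n, rfl⟩, hn⟩ := (IsLocalizedModule.eq_zero_iff (.powers f)
      ((modulesSpecToSheaf.obj (M.restrict hV.fromSpec)).obj.map
        (PrimeSpectrum.basicOpen f).leTop.op).hom
      (m := M.res (fromSpec_image_le hV ⊤) s)).1 (by
        change M.res (hV.fromSpec.image_mono le_top) (M.res (fromSpec_image_le hV ⊤) s) = 0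
        have := congr_arg (M.res (h₁ hV f).le) hs
        rw [res_res, map_zero] at this
        rw [res_res, this])
    refine ⟨n, ?_⟩
    replace hn := (smul_restrict_fromSpec M hV ⊤ (f ^ n) _).symm.trans hn
    have := congr_arg (M.res (fromSpec_image_top hV).ge) hn
    rw [← res_smul, res_res, res_self] at this
    exact this.trans (map_zero _)
  · intro V hV f s
    have := key V hV f
    obtain ⟨⟨(y : Γ(M, hV.fromSpec ''ᵁ ⊤)), ⟨_, n, rfl⟩⟩, hn⟩ := IsLocalizedModule.surj (.powers f)
      ((modulesSpecToSheaf.obj (M.restrict hV.fromSpec)).obj.map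
        (PrimeSpectrum.basicOpen f).leTop.op).hom (M.res (h₁ hV f).le s)
    replace hn := (smul_restrict_fromSpec M hV _ (f ^ n) _).symm.trans hn
    replace hn : _ = M.res (hV.fromSpec.image_mono le_top) y := hn
    refine ⟨n, M.res (fromSpec_image_top hV).ge y, ?_⟩
    have := congr_arg (M.res (h₁ hV f).ge) hn
    rw [res_smul, res_res, res_self, rres_rres, res_res, map_pow] at this
    rw [res_res, this]

lemma isQuasicoherent_of_presentation (M : X.Modules) {ι : Type u} (U : ι → X.Opens)
    (hU : IsOpenCover U) (P : ∀ i, Nonempty (M.restrict (U i).ι).Presentation) :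
    M.IsQuasicoherent := by
  let q : SheafOfModules.QuasicoherentData.{u} (R := X.ringCatSheaf) M :=
    { I := ι
      X := U
      coversTop := (Opens.coversTop_iff _ _).2 hU
      presentation := fun i => by
        let e := (overFunctorEquiv (U i)).app M
        let E := overEquiv (U i)
        let N : SheafOfModules (X.ringCatSheaf.over (U i)) :=
          SheafOfModules.over (R := X.ringCatSheaf) M (U i)
        let p : SheafOfModules.Presentation (E.functor.obj N) :=
          @SheafOfModules.Presentation.ofIsIso.{u, u, u} _ _ _ _ _ _ _ _ e.inv
            (inferInstanceAs (IsIso e.inv)) (P i).some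
        let F : SheafOfModules.{u} (U i).toScheme.ringCatSheaf ⥤
          SheafOfModules.{u} (X.ringCatSheaf.over (U i)) := E.inverse
        have : PreservesColimitsOfSize.{u, u} F :=
          E.symm.toAdjunction.leftAdjoint_preservesColimits
        let η : SheafOfModules.unit (X.ringCatSheaf.over (U i)) ≅
            E.inverse.obj (SheafOfModules.unit (U i).toScheme.ringCatSheaf) :=
          E.unitIso.app _ ≪≫ E.inverse.mapIso (Iso.refl _)
        let p' := p.map F η
        exact @SheafOfModules.Presentation.ofIsIso.{u, u, u} _ _ _ _ _ _ _ _ (E.unitIso.app N).inv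
          (inferInstanceAs (IsIso (E.unitIso.app N).inv)) p' }
  exact q.isQuasicoherent

/-- On each affine open, localization of sections says that the sheaf is the tilde of its module of
sections, and a tilde has a presentation. With `hasLocalizedSections_of_isQuasicoherent` this makes
quasi-coherence a condition on sections. -/
lemma HasLocalizedSections.isQuasicoherent {M : X.Modules} (h : HasLocalizedSections M) :
    M.IsQuasicoherent := by
  have key : ∀ (V : X.Opens) (hV : IsAffineOpen V),
      IsIso (M.restrict hV.fromSpec).fromTildeΓ := by
    intro V hV
    rw [isIso_fromTildeΓ_iff_isLocalizing]
    intro f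
    have h₁ : hV.fromSpec ''ᵁ (PrimeSpectrum.basicOpen f) = X.basicOpen f :=
      hV.fromSpec_image_basicOpen f
    refine IsLocalizedModule.Away.mk_of_addCommGroup
      (isUnit_algebraMap_end_of_le_basicOpen f le_rfl) ?_ ?_
    · intro (s : Γ(M, hV.fromSpec ''ᵁ (PrimeSpectrum.basicOpen f)))
      obtain ⟨n, t, ht⟩ := h.exists_res_eq_pow_smul V hV f (M.res h₁.ge s)
      refine ⟨n, M.res (fromSpec_image_le hV ⊤) t, ?_⟩
      refine (smul_restrict_fromSpec M hV _ (f ^ n) s).trans ?_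
      change _ = M.res (hV.fromSpec.image_mono le_top) (M.res (fromSpec_image_le hV ⊤) t)
      have := congr_arg (M.res h₁.le) ht
      rw [res_smul, res_res, res_res, res_self, map_pow, rres_rres] at this
      rw [res_res, this, map_pow]
    · intro (s : Γ(M, hV.fromSpec ''ᵁ ⊤)) hs
      replace hs : M.res (hV.fromSpec.image_mono le_top) s =
        (0 : Γ(M, hV.fromSpec ''ᵁ (PrimeSpectrum.basicOpen f))) := hs
      obtain ⟨n, hn⟩ := h.exists_pow_smul_eq_zero V hV f (M.res (fromSpec_image_top hV).ge s) (by
        have := congr_arg (M.res h₁.ge) hs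
        rw [res_res, map_zero] at this
        rw [res_res, this])
      refine ⟨n, (smul_restrict_fromSpec M hV _ (f ^ n) s).trans ?_⟩
      have := congr_arg (M.res (fromSpec_image_top hV).le) hn
      rwa [res_smul, res_res, res_self, map_zero] at this
  refine isQuasicoherent_of_presentation M (fun V : X.affineOpens => V.1)
    (IsOpenCover.mk (iSup_affineOpens_eq_top X)) ?_
  rintro ⟨V, (hV : IsAffineOpen V)⟩
  have := key V hV
  let p : (M.restrict hV.fromSpec).Presentation := @SheafOfModules.Presentation.ofIsIso.{u, u, u}
    _ _ _ _ _ _ _ _ (M.restrict hV.fromSpec).fromTildeΓ this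
      (presentationTilde.{u} _ .univ (by simp) _ (Submodule.span_eq _))
  let p' := presentationRestrict hV.isoSpec.hom p
  have e : hV.isoSpec.hom ≫ hV.fromSpec = V.ι := hV.isoSpec_hom_fromSpec
  let i : restrictFunctor hV.fromSpec ⋙ restrictFunctor hV.isoSpec.hom ≅ restrictFunctor V.ι :=
    (restrictFunctorComp _ _).symm ≪≫ restrictFunctorCongr e
  exact ⟨@SheafOfModules.Presentation.ofIsIso.{u, u, u} _ _ _ _ _ _ _ _ (i.app M).hom
    (inferInstanceAs (IsIso (i.app M).hom)) p'⟩

/-- Vanishing of the first Čech cohomology of a two-element cover: `g ^ n • m` extends to `D(f)` and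
`f ^ k • m` to `D(g)`, and a combination of `f ^ k` and `g ^ n` equals 1. -/
lemma HasLocalizedSections.exists_add_eq {M : X.Modules} (h : HasLocalizedSections M)
    (hW : IsAffineOpen W) {f g : Γ(X, W)} (hfg : IsCoprime f g)
    (m : Γ(M, X.basicOpen f ⊓ X.basicOpen g)) :
    ∃ (s : Γ(M, X.basicOpen f)) (t : Γ(M, X.basicOpen g)),
      m = M.res inf_le_left s + M.res inf_le_right t := by
  have key : ∀ (f g : Γ(X, W)) (m : Γ(M, X.basicOpen f ⊓ X.basicOpen g)),
      ∃ (n : ℕ) (s : Γ(M, X.basicOpen f)), M.res (inf_le_left : X.basicOpen f ⊓ X.basicOpen g ≤ _) s =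
        X.rres ((inf_le_left : X.basicOpen f ⊓ X.basicOpen g ≤ _).trans (X.basicOpen_le f))
          (g ^ n) • m := by
    intro f g m
    have e : X.basicOpen (X.rres (X.basicOpen_le f) g) = X.basicOpen f ⊓ X.basicOpen g :=
      X.basicOpen_res g _
    obtain ⟨n, s, hs⟩ := h.exists_res_eq_pow_smul _ (hW.basicOpen f) (X.rres (X.basicOpen_le f) g)
      (M.res e.le m)
    refine ⟨n, s, ?_⟩
    have := congr_arg (M.res e.ge) hs
    rw [res_res, res_smul, res_res, res_self, map_pow, rres_rres, rres_rres] at this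
    rw [this, map_pow]
  obtain ⟨n, s, hs⟩ := key f g m
  obtain ⟨k, t, ht⟩ := key g f (M.res (inf_comm (X.basicOpen g) (X.basicOpen f)).le m)
  obtain ⟨a, b, hab⟩ := hfg.pow (m := k) (n := n)
  refine ⟨X.rres (X.basicOpen_le f) b • s, X.rres (X.basicOpen_le g) a • t, ?_⟩
  have ht' := congr_arg (M.res (inf_comm (X.basicOpen f) (X.basicOpen g)).le) ht
  rw [res_res, res_smul, res_res, res_self, rres_rres] at ht'
  rw [res_smul, res_smul, hs, ht', rres_rres, rres_rres, smul_smul, smul_smul, ← map_mul,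
    ← map_mul, ← add_smul, ← map_add, add_comm (b * _), hab, map_one, one_smul]

/-- Induction principle for affine open subsets. -/
lemma _root_.AlgebraicGeometry.IsAffineOpen.induction_of_isCoprime (hV : IsAffineOpen V)
    (P : X.Opens → Prop) (bot : P ⊥) (mono : ∀ {U W : X.Opens}, U ≤ W → P W → P U)
    (loc : ∀ x ∈ V, ∃ U : X.Opens, x ∈ U ∧ P U)
    (step : ∀ (W : X.Opens), IsAffineOpen W → W ≤ V → ∀ f g : Γ(X, W), IsCoprime f g →
      P (X.basicOpen f) → P (X.basicOpen g) → P W) : P V := by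
  -- The `f` such that `P` holds on `D(f)` form an ideal: `f` and `g` become coprime on `D(f + g)`,
  -- which is what `step` needs. Since `P` holds locally, the ideal contains 1.
  let K : Ideal Γ(X, V) :=
    { carrier := {f | P (X.basicOpen f)}
      zero_mem' := by
        change P _
        rwa [X.basicOpen_zero]
      smul_mem' := fun a f hf => by
        refine mono ?_ hf
        rw [smul_eq_mul, X.basicOpen_mul]
        exact inf_le_right
      add_mem' := by
        intro f g hf hg
        have e : ∀ f' : Γ(X, V), X.basicOpen (X.rres (X.basicOpen_le (f + g)) f') ≤
            X.basicOpen f' := fun f' => (X.basicOpen_res f' _).le.trans inf_le_right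
        refine step _ (hV.basicOpen (f + g)) (X.basicOpen_le _) (X.rres (X.basicOpen_le _) f)
          (X.rres (X.basicOpen_le _) g) ?_ (mono (e f) hf) (mono (e g) hg)
        obtain ⟨v, hv⟩ := (isUnit_rres_basicOpen (f + g)).exists_left_inv
        exact ⟨v, v, by rw [← mul_add, ← map_add, hv]⟩ }
  have hK : Ideal.span (K : Set Γ(X, V)) = ⊤ := by
    rw [← hV.iSup_basicOpen_eq_self_iff]
    refine le_antisymm (iSup_le fun f => X.basicOpen_le _) fun x hx => ?_
    obtain ⟨U, hxU, hU⟩ := loc x hx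
    obtain ⟨f, hf, hxf⟩ := hV.exists_basicOpen_le ⟨x, hxU⟩ hx
    exact Opens.mem_iSup.2 ⟨⟨f, mono hf hU⟩, hxf⟩
  rw [Ideal.span_eq] at hK
  have : (1 : Γ(X, V)) ∈ K := hK ▸ Submodule.mem_top
  exact mono (X.basicOpen_of_isUnit isUnit_one).ge this

end AlgebraicGeometry.Scheme.Modules

/-! ### Lifting boundaries and cohomology classes over affine opens -/

namespace AlgebraicGeometry.Scheme.Modules

variable {X : Scheme.{u}} {U V W : X.Opens}

lemma eq_of_res_eq₂ {M : X.Modules} (h₁ : V ≤ U) (h₂ : W ≤ U) (H : U ≤ V ⊔ W) {s t : Γ(M, U)}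
    (hV : M.res h₁ s = M.res h₁ t) (hW : M.res h₂ s = M.res h₂ t) : s = t := by
  refine eq_of_res_eq _ _ fun x hx => ?_
  obtain hx | hx := H hx
  exacts [⟨V, h₁, hx, hV⟩, ⟨W, h₂, hx, hW⟩]

lemma eq_of_bot {M : X.Modules} (s t : Γ(M, (⊥ : X.Opens))) : s = t :=
  eq_of_res_eq _ _ fun _ hx => hx.elim

lemma le_sup_basicOpen (hW : IsAffineOpen W) {f g : Γ(X, W)} (hfg : IsCoprime f g) :
    W ≤ X.basicOpen f ⊔ X.basicOpen g := by
  have : ⨆ f' : ({f, g} : Set Γ(X, W)), X.basicOpen f'.1 = W := by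
    rw [hW.iSup_basicOpen_eq_self_iff, Ideal.eq_top_iff_one, Ideal.mem_span_pair]
    exact hfg
  refine this.ge.trans (iSup_le ?_)
  rintro ⟨_, rfl | rfl⟩
  exacts [le_sup_left, le_sup_right]

variable {K : CochainComplex X.Modules ℤ} {i j k n : ℤ}

lemma IsLocalBoundary.res {z : Γ(K.X j, U)} (hz : IsLocalBoundary K i j z) (h : V ≤ U) :
    IsLocalBoundary K i j ((K.X j).res h z) := by
  intro x hx
  obtain ⟨W, hW, hxW, y, hy⟩ := hz x (h hx)
  refine ⟨V ⊓ W, inf_le_left, ⟨hx, hxW⟩, (K.X i).res inf_le_right y, ?_⟩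
  rw [← Hom.res_sec, hy, res_res, res_res]

lemma isLocalBoundary_d (y : Γ(K.X i, U)) : IsLocalBoundary K i j ((K.d i j).sec U y) :=
  fun x hx => ⟨U, le_rfl, hx, y, by rw [res_self]⟩

lemma IsLocalBoundary.sub {z z' : Γ(K.X j, U)} (hz : IsLocalBoundary K i j z)
    (hz' : IsLocalBoundary K i j z') : IsLocalBoundary K i j (z - z') := by
  intro x hx
  obtain ⟨V, h, hxV, y, hy⟩ := hz x hx
  obtain ⟨V', h', hxV', y', hy'⟩ := hz' x hx
  refine ⟨V ⊓ V', inf_le_left.trans h, ⟨hxV, hxV'⟩,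
    (K.X i).res inf_le_left y - (K.X i).res inf_le_right y', ?_⟩
  rw [map_sub, ← Hom.res_sec, ← Hom.res_sec, hy, hy', res_res, res_res, map_sub]

lemma IsLocalBoundary.d_eq_zero {z : Γ(K.X j, U)} (hz : IsLocalBoundary K i j z) :
    (K.d j k).sec U z = 0 := by
  refine eq_of_res_eq _ _ fun x hx => ?_
  obtain ⟨V, h, hxV, y, hy⟩ := hz x hx
  exact ⟨V, h, hxV, by rw [Hom.res_sec, ← hy, d_sec_d_sec, map_zero]⟩

/-- Sections over `V` which are locally boundaries are boundaries. -/
def LiftsBoundaries (K : CochainComplex X.Modules ℤ) (n : ℤ) (V : X.Opens) : Prop :=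
  ∀ z : Γ(K.X n, V), IsLocalBoundary K (n - 1) n z →
    ∃ y : Γ(K.X (n - 1), V), (K.d (n - 1) n).sec V y = z

/-- Sections over `V` of the cohomology sheaf are classes of cocycles. -/
def LiftsClasses (K : CochainComplex X.Modules ℤ) (n : ℤ) (V : X.Opens) : Prop :=
  Function.Surjective ((K.homologyπ n).sec V)

lemma exists_d_eq_of_glue {z : Γ(K.X j, W)} (hU : U ≤ W) (hV : V ≤ W) (H : W ≤ U ⊔ V)
    (y₁ : Γ(K.X i, U)) (y₂ : Γ(K.X i, V)) (h₁ : (K.d i j).sec U y₁ = (K.X j).res hU z)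
    (h₂ : (K.d i j).sec V y₂ = (K.X j).res hV z)
    (h : (K.X i).res (inf_le_left : U ⊓ V ≤ U) y₁ = (K.X i).res (inf_le_right : U ⊓ V ≤ V) y₂) :
    ∃ y : Γ(K.X i, W), (K.d i j).sec W y = z ∧ (K.X i).res hU y = y₁ ∧ (K.X i).res hV y = y₂ := by
  obtain ⟨y, rfl, rfl⟩ := exists_glue hU hV H y₁ y₂ h
  refine ⟨y, eq_of_res_eq₂ hU hV H ?_ ?_, rfl, rfl⟩
  · rw [Hom.res_sec, h₁]
  · rw [Hom.res_sec, h₂]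

/-- Primitives on `D(f)` and `D(g)` differ on the overlap by a cocycle of degree `n - 1`. Its class
splits as a sum of classes from the two opens, and these are represented by cocycles. After
correcting by them the difference is a boundary, whose primitive extends by flasqueness and is
absorbed on `D(f)`. -/
lemma liftsBoundaries_of_pred (hK : ∀ n, IsFlasque (K.X n))
    (hH : HasLocalizedSections (K.homology (n - 1)))
    (hS : ∀ V : X.Opens, IsAffineOpen V → LiftsBoundaries K (n - 1) V)
    (hT : ∀ V : X.Opens, IsAffineOpen V → LiftsClasses K (n - 1) V)
    (V : X.Opens) (hV : IsAffineOpen V) : LiftsBoundaries K n V := by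
  intro z hz
  obtain ⟨h, y, hy⟩ := hV.induction_of_isCoprime (fun U => ∃ (h : U ≤ V) (y : Γ(K.X (n - 1), U)),
      (K.d (n - 1) n).sec U y = (K.X n).res h z) ⟨bot_le, 0, eq_of_bot _ _⟩
    (by
      rintro U W hUW ⟨h, y, hy⟩
      exact ⟨hUW.trans h, (K.X _).res hUW y, by rw [← Hom.res_sec, hy, res_res]⟩)
    (by
      intro x hx
      obtain ⟨U, h, hxU, y, hy⟩ := hz x hx
      exact ⟨U, hxU, h, y, hy⟩)
    (by
      rintro W hW hWV f g hfg ⟨h₁, y₁, hy₁⟩ ⟨h₂, y₂, hy₂⟩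
      refine ⟨hWV, ?_⟩
      let A := X.basicOpen f
      let B := X.basicOpen g
      obtain ⟨c, hc⟩ : ∃ c : Γ(K.cycles (n - 1), A ⊓ B), (K.iCycles (n - 1)).sec _ c =
          (K.X (n - 1)).res inf_le_left y₁ - (K.X (n - 1)).res inf_le_right y₂ := by
        refine exists_iCycles_sec_eq (j := n) (by simp) _ ?_
        rw [map_sub, ← Hom.res_sec, ← Hom.res_sec, hy₁, hy₂, res_res, res_res, sub_self]
      obtain ⟨s, t, hst⟩ := hH.exists_add_eq hW hfg ((K.homologyπ (n - 1)).sec _ c)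
      obtain ⟨c₁, rfl⟩ := hT _ (hW.basicOpen f) s
      obtain ⟨c₂, rfl⟩ := hT _ (hW.basicOpen g) t
      obtain ⟨u, hu⟩ := hS (A ⊓ B) (by
          have := (hW.basicOpen f).basicOpen (X.rres (X.basicOpen_le f) g)
          rwa [show X.basicOpen (X.rres (X.basicOpen_le f) g) = A ⊓ B from X.basicOpen_res g _]
            at this)
        ((K.iCycles (n - 1)).sec _ (c - (K.cycles _).res inf_le_left c₁ -
          (K.cycles _).res inf_le_right c₂))
        ((homologyπ_sec_eq_zero_iff (by simp) _).1 (by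
          rw [map_sub, map_sub, hst, ← Hom.res_sec, ← Hom.res_sec]
          abel))
      obtain ⟨u', rfl⟩ := hK _ (inf_le_left : A ⊓ B ≤ A) u
      obtain ⟨y, hy, -, -⟩ := exists_d_eq_of_glue (K := K) (z := (K.X n).res hWV z)
        (X.basicOpen_le f) (X.basicOpen_le g) (le_sup_basicOpen hW hfg)
        (y₁ - (K.iCycles (n - 1)).sec _ c₁ - (K.d (n - 1 - 1) (n - 1)).sec _ u')
        (y₂ + (K.iCycles (n - 1)).sec _ c₂)
        (by rw [map_sub, map_sub, hy₁, d_sec_d_sec, d_sec_iCycles_sec, sub_zero, sub_zero, res_res])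
        (by rw [map_add, hy₂, d_sec_iCycles_sec, add_zero, res_res])
        (by
          rw [map_sub, map_sub, Hom.res_sec _ _ u', hu, map_sub, map_sub, hc, ← Hom.res_sec,
            ← Hom.res_sec, map_add]
          abel)
      exact ⟨y, hy⟩)
  exact ⟨y, by rw [hy, res_self]⟩

/-- Two cocycles representing the same class differ on the overlap by a local boundary, hence by a
boundary `d u`; extending `u` by flasqueness makes the cocycles glue. -/
lemma liftsClasses_of_liftsBoundaries (hK : ∀ n, IsFlasque (K.X n))
    (hS : ∀ V : X.Opens, IsAffineOpen V → LiftsBoundaries K n V)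
    (V : X.Opens) (hV : IsAffineOpen V) : LiftsClasses K n V := by
  intro z
  obtain ⟨h, c, hc⟩ := hV.induction_of_isCoprime (fun U => ∃ (h : U ≤ V) (c : Γ(K.cycles n, U)),
      (K.homologyπ n).sec U c = (K.homology n).res h z) ⟨bot_le, 0, eq_of_bot _ _⟩
    (by
      rintro U W hUW ⟨h, y, hy⟩
      exact ⟨hUW.trans h, (K.cycles _).res hUW y, by rw [← Hom.res_sec, hy, res_res]⟩)
    (by
      intro x hx
      obtain ⟨U, h, hxU, y, hy⟩ := exists_homologyπ_sec_eq z hx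
      exact ⟨U, hxU, h, y, hy⟩)
    (by
      rintro W hW hWV f g hfg ⟨h₁, c₁, hc₁⟩ ⟨h₂, c₂, hc₂⟩
      refine ⟨hWV, ?_⟩
      let A := X.basicOpen f
      let B := X.basicOpen g
      obtain ⟨u, hu⟩ := hS (A ⊓ B) (by
          have := (hW.basicOpen f).basicOpen (X.rres (X.basicOpen_le f) g)
          rwa [show X.basicOpen (X.rres (X.basicOpen_le f) g) = A ⊓ B from X.basicOpen_res g _]
            at this)
        ((K.iCycles n).sec _ ((K.cycles _).res inf_le_left c₁ - (K.cycles _).res inf_le_right c₂))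
        ((homologyπ_sec_eq_zero_iff (by simp) _).1 (by
          rw [map_sub, ← Hom.res_sec, ← Hom.res_sec, hc₁, hc₂, res_res, res_res, sub_self]))
      obtain ⟨u', rfl⟩ := hK _ (inf_le_left : A ⊓ B ≤ A) u
      obtain ⟨c, hc, hc'⟩ := exists_glue (M := K.cycles n) (X.basicOpen_le f) (X.basicOpen_le g)
        (le_sup_basicOpen hW hfg) (c₁ - (K.toCycles (n - 1) n).sec _ u') c₂ (by
          apply sec_injective (K.iCycles n)
          rw [map_sub, map_sub, Hom.res_sec _ _ u', ← Hom.sec_comp, K.toCycles_i, hu, map_sub]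
          abel)
      refine ⟨c, eq_of_res_eq₂ (X.basicOpen_le f) (X.basicOpen_le g) (le_sup_basicOpen hW hfg)
        ?_ ?_⟩
      · rw [Hom.res_sec, hc, map_sub, hc₁, ← Hom.sec_comp, K.toCycles_comp_homologyπ, Hom.sec_zero,
          sub_zero, res_res]
      · rw [Hom.res_sec, hc', hc₂, res_res])
  exact ⟨c, by rw [hc, res_self]⟩

end AlgebraicGeometry.Scheme.Modules

/-! ### Bounded below complexes. -/

namespace AlgebraicGeometry.Scheme.Modules

variable {X : Scheme.{u}} {U V W : X.Opens} {K L : CochainComplex X.Modules ℤ} {i j k n : ℤ}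

lemma lifts_of_isStrictlyGE (hK : ∀ n, IsFlasque (K.X n))
    (hH : ∀ n, HasLocalizedSections (K.homology n)) (m : ℤ) [K.IsStrictlyGE m] (n : ℤ) :
    (∀ V : X.Opens, IsAffineOpen V → LiftsBoundaries K n V) ∧
      (∀ V : X.Opens, IsAffineOpen V → LiftsClasses K n V) := by
  suffices h : ∀ V : X.Opens, IsAffineOpen V → LiftsBoundaries K n V from
    ⟨h, liftsClasses_of_liftsBoundaries hK h⟩
  -- The induction starts here: for `n ≤ m` the term in degree `n - 1` is zero, so local boundaries
  -- in degree `n` vanish.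
  have h₀ : ∀ n, n ≤ m → ∀ V : X.Opens, IsAffineOpen V → LiftsBoundaries K n V := by
    intro n hn V hV z hz
    refine ⟨0, ?_⟩
    rw [map_zero]
    refine (eq_of_res_eq _ _ fun x hx => ?_).symm
    obtain ⟨W, h, hxW, y, hy⟩ := hz x hx
    refine ⟨W, h, hxW, ?_⟩
    rw [← hy, eq_zero_of_isZero (K.isZero_of_isStrictlyGE m (n - 1)) y, map_zero, map_zero]
  obtain hn | hn := le_total n m
  · exact h₀ n hn
  · induction n, hn using Int.leInduction with
    | base => exact h₀ m le_rfl
    | succ n hn ih =>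
      have e : n = n + 1 - 1 := by simp
      refine liftsBoundaries_of_pred hK (hH _) ?_ ?_
      · rwa [← e]
      · rw [← e]
        exact liftsClasses_of_liftsBoundaries hK ih

lemma IsLocalBoundary.map {z : Γ(K.X j, U)} (hz : IsLocalBoundary K i j z) (φ : K ⟶ L) :
    IsLocalBoundary L i j ((φ.f j).sec U z) := by
  intro x hx
  obtain ⟨V, h, hxV, y, hy⟩ := hz x hx
  exact ⟨V, h, hxV, (φ.f i).sec V y, by rw [← f_sec_d_sec, hy, Hom.res_sec]⟩

lemma exists_d_eq_of_homotopy {φ : K ⟶ K} (h : Homotopy φ (𝟙 K)) (z : Γ(K.X n, U))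
    (hz : (K.d n (n + 1)).sec U z = 0) :
    ∃ y : Γ(K.X (n - 1), U), (K.d (n - 1) n).sec U y = (φ.f n).sec U z - z := by
  have := h.comm n
  rw [dNext_eq h.hom (show (ComplexShape.up ℤ).Rel n (n + 1) by simp),
    prevD_eq h.hom (show (ComplexShape.up ℤ).Rel (n - 1) n by simp)] at this
  refine ⟨(h.hom n (n - 1)).sec U z, ?_⟩
  rw [this, Hom.sec_add, Hom.sec_add, Hom.sec_comp, Hom.sec_comp, hz, map_zero]
  simp

lemma LiftsBoundaries.of_homotopy {φ : K ⟶ L} {ψ : L ⟶ K} (h : Homotopy (φ ≫ ψ) (𝟙 K))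
    (hL : LiftsBoundaries L n V) : LiftsBoundaries K n V := by
  intro z hz
  obtain ⟨y, hy⟩ := hL _ (hz.map φ)
  obtain ⟨y', hy'⟩ := exists_d_eq_of_homotopy h z hz.d_eq_zero
  refine ⟨(ψ.f _).sec V y - y', ?_⟩
  rw [map_sub, hy', ← f_sec_d_sec, hy]
  simp

lemma LiftsClasses.of_homotopy {φ : K ⟶ L} {ψ : L ⟶ K} (h : Homotopy (φ ≫ ψ) (𝟙 K))
    (hL : LiftsClasses L n V) : LiftsClasses K n V := by
  intro s
  obtain ⟨c, hc⟩ := hL ((HomologicalComplex.homologyMap φ n).sec V s)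
  refine ⟨(HomologicalComplex.cyclesMap ψ n).sec V c, ?_⟩
  rw [← Hom.sec_comp, ← HomologicalComplex.homologyπ_naturality, Hom.sec_comp, hc,
    ← Hom.sec_comp, ← HomologicalComplex.homologyMap_comp, h.homologyMap_eq,
    HomologicalComplex.homologyMap_id, Hom.sec_id]

lemma liftsBoundaries_iff [K.IsKInjective] [L.IsKInjective] (f : K ⟶ L) [QuasiIso f] :
    LiftsBoundaries K n V ↔ LiftsBoundaries L n V := by
  obtain ⟨e, rfl⟩ := (CochainComplex.IsKInjective.quasiIso_iff f).1 inferInstance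
  exact ⟨.of_homotopy e.homotopyInvHomId, .of_homotopy e.homotopyHomInvId⟩

lemma liftsClasses_iff [K.IsKInjective] [L.IsKInjective] (f : K ⟶ L) [QuasiIso f] :
    LiftsClasses K n V ↔ LiftsClasses L n V := by
  obtain ⟨e, rfl⟩ := (CochainComplex.IsKInjective.quasiIso_iff f).1 inferInstance
  exact ⟨.of_homotopy e.homotopyInvHomId, .of_homotopy e.homotopyHomInvId⟩

lemma HasLocalizedSections.of_iso {M N : X.Modules} (e : M ≅ N) (h : HasLocalizedSections M) :
    HasLocalizedSections N := by
  have h₁ : ∀ (U : X.Opens) (s : Γ(N, U)), e.hom.sec U (e.inv.sec U s) = s := fun U s => by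
    rw [← Hom.sec_comp, e.inv_hom_id, Hom.sec_id]
  constructor
  · intro V hV f s hs
    obtain ⟨n, hn⟩ := h.exists_pow_smul_eq_zero V hV f (e.inv.sec V s) (by
      rw [Hom.res_sec, hs, map_zero])
    refine ⟨n, ?_⟩
    rw [← h₁ V s, ← Hom.sec_smul, hn, map_zero]
  · intro V hV f s
    obtain ⟨n, t, ht⟩ := h.exists_res_eq_pow_smul V hV f (e.inv.sec _ s)
    refine ⟨n, e.hom.sec V t, ?_⟩
    rw [Hom.res_sec, ht, Hom.sec_smul, h₁]

lemma HasLocalizedSections.of_isZero {M : X.Modules} (h : IsZero M) : HasLocalizedSections M where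
  exists_pow_smul_eq_zero _ _ _ s _ := ⟨0, by rw [eq_zero_of_isZero h s, smul_zero]⟩
  exists_res_eq_pow_smul _ _ _ s :=
    ⟨0, 0, by rw [eq_zero_of_isZero h s, smul_zero, map_zero]⟩

-- The lifting properties do not depend on the K-injective representative, because
-- quasi-isomorphisms between such complexes are homotopy equivalences; a bounded below injective
-- resolution can therefore be used.
open CochainComplex in
lemma lifts_kInjectiveResolution_of_isStrictlyGE (m : ℤ) [K.IsStrictlyGE m]
    (hH : ∀ n, HasLocalizedSections (K.homology n)) (n : ℤ) :
    (∀ V : X.Opens, IsAffineOpen V → LiftsBoundaries (kInjectiveResolution.obj K) n V) ∧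
      (∀ V : X.Opens, IsAffineOpen V → LiftsClasses (kInjectiveResolution.obj K) n V) := by
  obtain ⟨I, f, _, _, _⟩ := CochainComplex.Plus.modelCategoryQuillen.exists_quasiIso_injective K m
  have : I.IsKInjective := isKInjective_of_injective I m
  obtain ⟨h₁, h₂⟩ := lifts_of_isStrictlyGE (K := I) (fun n => isFlasque_of_injective _)
    (fun n => (hH n).of_iso (isoOfQuasiIsoAt f n)) m n
  have : QuasiIso (kInjectiveResolution.map f) := by
    have : QuasiIso (toKInjectiveResolution.app K ≫ kInjectiveResolution.map f) := by
      rw [← toKInjectiveResolution.naturality f]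
      exact inferInstanceAs (QuasiIso (f ≫ toKInjectiveResolution.app I))
    exact quasiIso_of_comp_left (toKInjectiveResolution.app K) _
  simp only [liftsBoundaries_iff (kInjectiveResolution.map f),
    ← liftsBoundaries_iff (K := I) (toKInjectiveResolution.app I),
    liftsClasses_iff (kInjectiveResolution.map f),
    ← liftsClasses_iff (K := I) (toKInjectiveResolution.app I)]
  exact ⟨h₁, h₂⟩

end AlgebraicGeometry.Scheme.Modules

/-! ### K-injectivity of mapping cones and products -/

namespace CochainComplex

variable {C : Type*} [Category* C] [Abelian C]

lemma isKInjective_mappingCone {K L : CochainComplex C ℤ} [K.IsKInjective] [L.IsKInjective]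
    (φ : K ⟶ L) : (mappingCone φ).IsKInjective := by
  rw [isKInjective_iff_rightOrthogonal]
  exact ObjectProperty.ext_of_isTriangulatedClosed₃ _ _
    (HomotopyCategory.mappingCone_triangleh_distinguished φ)
    (IsKInjective.rightOrthogonal K) (IsKInjective.rightOrthogonal L)

lemma IsAcyclicFibrant.piObj {ι : Type*} (J : ι → CochainComplex C ℤ) [HasProduct J]
    (hJ : ∀ m, IsAcyclicFibrant (J m)) : IsAcyclicFibrant (∏ᶜ J) := by
  intro A B i f hi
  choose g hg using fun m => hJ m i (f ≫ Pi.π J m) hi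
  exact ⟨Pi.lift g, Pi.hom_ext _ _ fun m => by simp [hg]⟩

end CochainComplex

namespace AlgebraicGeometry.Scheme.Modules

variable {X : Scheme.{u}} {U V W : X.Opens} {i j k n : ℤ}

/-! ### Sections of products of complexes -/

section Products

variable (J : ℕ → CochainComplex X.Modules ℤ)

instance (U : X.Opens) : PreservesLimitsOfSize.{0, 0} (sections U) :=
  preservesLimitsOfSize_shrink.{0, u, 0, u} _

/-- The functor sending a complex to the set of sections in a given degree. -/
noncomputable abbrev sectionsDegree (U : X.Opens) (n : ℤ) :
    CochainComplex X.Modules ℤ ⥤ Type u :=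
  HomologicalComplex.eval X.Modules (ComplexShape.up ℤ) n ⋙ sections U ⋙
    CategoryTheory.forget Ab.{u}

lemma existsUnique_sec_π_eq (s : ∀ m, Γ((J m).X n, U)) :
    ∃! t : Γ((∏ᶜ J).X n, U), ∀ m, ((Pi.π J m).f n).sec U t = s m := by
  have : PreservesLimitsOfSize.{0, 0} (CategoryTheory.forget Ab.{u}) :=
    preservesLimitsOfSize_shrink.{0, u, 0, u} _
  have : PreservesLimit (Discrete.functor J) (sectionsDegree U n) := inferInstance
  have h := (Types.isLimit_iff _).1 ⟨isLimitOfPreserves (sectionsDegree U n) (productIsProduct J)⟩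
    (fun m => s m.as) (by
      rintro ⟨m⟩ ⟨m'⟩ f
      obtain rfl : m = m' := Discrete.eq_of_hom f
      obtain rfl : f = 𝟙 _ := Subsingleton.elim _ _
      rw [CategoryTheory.Functor.map_id]
      rfl)
  obtain ⟨t, ht, ht'⟩ := h
  exact ⟨t, fun m => ht ⟨m⟩, fun t' h => ht' t' fun m => h m.as⟩

lemma exists_sec_π_eq (s : ∀ m, Γ((J m).X n, U)) :
    ∃ t : Γ((∏ᶜ J).X n, U), ∀ m, ((Pi.π J m).f n).sec U t = s m :=
  (existsUnique_sec_π_eq J s).exists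

variable {J}

lemma eq_of_sec_π_eq {s t : Γ((∏ᶜ J).X n, U)}
    (h : ∀ m, ((Pi.π J m).f n).sec U s = ((Pi.π J m).f n).sec U t) : s = t :=
  (existsUnique_sec_π_eq J fun m => ((Pi.π J m).f n).sec U t).unique h fun _ => rfl

end Products

/-! ### Sections of mapping cones -/

section Cone

open CochainComplex

variable {K L : CochainComplex X.Modules ℤ} (φ : K ⟶ L)

/-- The section of the mapping cone attached to a pair of sections. -/
noncomputable def coneMk (hij : i + 1 = j) (z : Γ(K.X j, U)) (p : Γ(L.X i, U)) :
    Γ((mappingCone φ).X i, U) :=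
  ((mappingCone.inl φ).v j i (by lia)).sec U z + ((mappingCone.inr φ).f i).sec U p

variable {φ}

lemma exists_coneMk_eq (hij : i + 1 = j) (c : Γ((mappingCone φ).X i, U)) :
    ∃ z p, coneMk φ hij z p = c := by
  refine ⟨((mappingCone.fst φ).1.v i j hij).sec U c,
    ((mappingCone.snd φ).v i i (add_zero i)).sec U c, ?_⟩
  have := congr_arg (fun ψ => Hom.sec ψ U c) (mappingCone.id_X φ i j hij)
  exact this

lemma coneMk_inj (hij : i + 1 = j) {z z' : Γ(K.X j, U)} {p p' : Γ(L.X i, U)}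
    (h : coneMk φ hij z p = coneMk φ hij z' p') : z = z' ∧ p = p' := by
  have h₁ : ∀ (z : Γ(K.X j, U)) (p : Γ(L.X i, U)),
      ((mappingCone.fst φ).1.v i j hij).sec U (coneMk φ hij z p) = z := by
    intro z p
    rw [coneMk, map_add, ← Hom.sec_comp, ← Hom.sec_comp, mappingCone.inl_v_fst_v,
      mappingCone.inr_f_fst_v, Hom.sec_id, Hom.sec_zero, add_zero]
  have h₂ : ∀ (z : Γ(K.X j, U)) (p : Γ(L.X i, U)),
      ((mappingCone.snd φ).v i i (add_zero i)).sec U (coneMk φ hij z p) = p := by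
    intro z p
    rw [coneMk, map_add, ← Hom.sec_comp, ← Hom.sec_comp, mappingCone.inl_v_snd_v,
      mappingCone.inr_f_snd_v, Hom.sec_id, Hom.sec_zero, zero_add]
  exact ⟨by rw [← h₁ z p, h, h₁], by rw [← h₂ z p, h, h₂]⟩

lemma d_coneMk (hij : i + 1 = j) (hjk : j + 1 = k) (z : Γ(K.X j, U)) (p : Γ(L.X i, U)) :
    ((mappingCone φ).d i j).sec U (coneMk φ hij z p) =
      coneMk φ hjk (-(K.d j k).sec U z) ((φ.f j).sec U z + (L.d i j).sec U p) := by
  rw [coneMk, map_add, ← Hom.sec_comp, ← Hom.sec_comp,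
    mappingCone.inl_v_d φ j i k (by lia) (by lia), mappingCone.inr_f_d, Hom.sec_sub, Hom.sec_comp,
    Hom.sec_comp, Hom.sec_comp, coneMk, map_neg, map_add]
  abel

lemma res_coneMk (hij : i + 1 = j) (h : V ≤ U) (z : Γ(K.X j, U)) (p : Γ(L.X i, U)) :
    ((mappingCone φ).X i).res h (coneMk φ hij z p) =
      coneMk φ hij ((K.X j).res h z) ((L.X i).res h p) := by
  rw [coneMk, map_add, Hom.res_sec, Hom.res_sec]
  rfl

end Cone

lemma mono_of_eq_zero {M N : X.Modules} (φ : M ⟶ N)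
    (h : ∀ (U : X.Opens) (s : Γ(M, U)), φ.sec U s = 0 → s = 0) : Mono φ where
  right_cancellation g g' e := by
    refine hom_ext_sec fun U s => sub_eq_zero.1 (h U _ ?_)
    rw [map_sub, ← Hom.sec_comp, e, Hom.sec_comp, sub_self]

lemma epi_of_exists_sec_eq {M N : X.Modules} (φ : M ⟶ N)
    (h : ∀ (U : X.Opens) (s : Γ(N, U)), ∀ x ∈ U, ∃ (V : X.Opens) (hV : V ≤ U), x ∈ V ∧
      ∃ t : Γ(M, V), φ.sec V t = N.res hV s) : Epi φ where
  left_cancellation g g' e := by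
    refine hom_ext_sec fun U s => eq_of_res_eq _ _ fun x hx => ?_
    obtain ⟨V, hV, hxV, t, ht⟩ := h U s x hx
    refine ⟨V, hV, hxV, ?_⟩
    rw [Hom.res_sec, Hom.res_sec, ← ht, ← Hom.sec_comp, e, Hom.sec_comp]

/-! ### Isomorphisms on cohomology in terms of sections -/

section

variable {K L : CochainComplex X.Modules ℤ} (φ : K ⟶ L)

lemma IsLocalBoundary.of_map [QuasiIsoAt φ n] {z : Γ(K.X n, U)}
    (hz : (K.d n (n + 1)).sec U z = 0)
    (h : IsLocalBoundary L (n - 1) n ((φ.f n).sec U z)) : IsLocalBoundary K (n - 1) n z := by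
  obtain ⟨c, rfl⟩ := exists_iCycles_sec_eq rfl z hz
  rw [← homologyπ_sec_eq_zero_iff (by simp)]
  have e : (φ.f n).sec U ((K.iCycles n).sec U c) =
      (L.iCycles n).sec U ((HomologicalComplex.cyclesMap φ n).sec U c) := by
    rw [← Hom.sec_comp, ← Hom.sec_comp, HomologicalComplex.cyclesMap_i]
  rw [e, ← homologyπ_sec_eq_zero_iff (by simp), ← Hom.sec_comp,
    ← HomologicalComplex.homologyπ_naturality, Hom.sec_comp] at h
  apply sec_injective (HomologicalComplex.homologyMap φ n)
  rw [h, map_zero]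

lemma exists_isLocalBoundary_sub [QuasiIsoAt φ n] (z : Γ(L.X n, U))
    (hz : (L.d n (n + 1)).sec U z = 0) (hK : LiftsClasses K n U) :
    ∃ z' : Γ(K.X n, U), (K.d n (n + 1)).sec U z' = 0 ∧
      IsLocalBoundary L (n - 1) n ((φ.f n).sec U z' - z) := by
  obtain ⟨c, rfl⟩ := exists_iCycles_sec_eq rfl z hz
  obtain ⟨c', hc'⟩ := hK ((inv (HomologicalComplex.homologyMap φ n)).sec U
    ((L.homologyπ n).sec U c))
  refine ⟨(K.iCycles n).sec U c', d_sec_iCycles_sec c', ?_⟩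
  rw [← Hom.sec_comp, ← HomologicalComplex.cyclesMap_i, Hom.sec_comp, ← map_sub,
    ← homologyπ_sec_eq_zero_iff (by simp), map_sub, ← Hom.sec_comp,
    ← HomologicalComplex.homologyπ_naturality, Hom.sec_comp, hc', ← Hom.sec_comp,
    IsIso.inv_hom_id, Hom.sec_id, sub_self]

lemma exists_isLocalBoundary_sub_of_mem [QuasiIsoAt φ n] (z : Γ(L.X n, U))
    (hz : (L.d n (n + 1)).sec U z = 0) {x : X} (hx : x ∈ U) :
    ∃ (V : X.Opens) (h : V ≤ U), x ∈ V ∧ ∃ z' : Γ(K.X n, V), (K.d n (n + 1)).sec V z' = 0 ∧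
      IsLocalBoundary L (n - 1) n ((φ.f n).sec V z' - (L.X n).res h z) := by
  obtain ⟨c, rfl⟩ := exists_iCycles_sec_eq rfl z hz
  obtain ⟨V, hV, hxV, c', hc'⟩ := exists_homologyπ_sec_eq
    ((inv (HomologicalComplex.homologyMap φ n)).sec U ((L.homologyπ n).sec U c)) hx
  refine ⟨V, hV, hxV, (K.iCycles n).sec V c', d_sec_iCycles_sec c', ?_⟩
  rw [← Hom.sec_comp, ← HomologicalComplex.cyclesMap_i, Hom.sec_comp, Hom.res_sec, ← map_sub,
    ← homologyπ_sec_eq_zero_iff (by simp), map_sub, ← Hom.sec_comp,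
    ← HomologicalComplex.homologyπ_naturality, Hom.sec_comp, hc', ← Hom.res_sec, ← Hom.res_sec,
    ← Hom.sec_comp (inv _), IsIso.inv_hom_id, Hom.sec_id, sub_self]

lemma quasiIso_of_sections
    (h₁ : ∀ (n : ℤ) (U : X.Opens) (z : Γ(K.X n, U)), (K.d n (n + 1)).sec U z = 0 →
      IsLocalBoundary L (n - 1) n ((φ.f n).sec U z) → IsLocalBoundary K (n - 1) n z)
    (h₂ : ∀ (n : ℤ) (U : X.Opens) (z : Γ(L.X n, U)), (L.d n (n + 1)).sec U z = 0 →
      ∀ x ∈ U, ∃ (V : X.Opens) (h : V ≤ U), x ∈ V ∧ ∃ z' : Γ(K.X n, V),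
        (K.d n (n + 1)).sec V z' = 0 ∧
          IsLocalBoundary L (n - 1) n ((φ.f n).sec V z' - (L.X n).res h z)) : QuasiIso φ := by
  refine ⟨fun n => ?_⟩
  rw [quasiIsoAt_iff_isIso_homologyMap]
  have : Mono (HomologicalComplex.homologyMap φ n) := by
    refine mono_of_eq_zero _ fun U s hs => eq_of_res_eq _ _ fun x hx => ?_
    obtain ⟨V, hV, hxV, c, hc⟩ := exists_homologyπ_sec_eq s hx
    refine ⟨V, hV, hxV, ?_⟩
    rw [map_zero, ← hc, homologyπ_sec_eq_zero_iff (i := n - 1) (by simp)]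
    refine h₁ n V _ (d_sec_iCycles_sec c) ?_
    rw [← Hom.sec_comp, ← HomologicalComplex.cyclesMap_i, Hom.sec_comp,
      ← homologyπ_sec_eq_zero_iff (by simp), ← Hom.sec_comp,
      ← HomologicalComplex.homologyπ_naturality, Hom.sec_comp, hc, ← Hom.res_sec, hs, map_zero]
  have : Epi (HomologicalComplex.homologyMap φ n) := by
    refine epi_of_exists_sec_eq _ fun U s x hx => ?_
    obtain ⟨V, hV, hxV, c, hc⟩ := exists_homologyπ_sec_eq s hx
    obtain ⟨W, hW, hxW, z', hz', H⟩ := h₂ n V _ (d_sec_iCycles_sec c) x hxV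
    obtain ⟨c', rfl⟩ := exists_iCycles_sec_eq rfl z' hz'
    refine ⟨W, hW.trans hV, hxW, (K.homologyπ n).sec W c', ?_⟩
    rw [← Hom.sec_comp, ← HomologicalComplex.cyclesMap_i, Hom.sec_comp, Hom.res_sec, ← map_sub,
      ← homologyπ_sec_eq_zero_iff (by simp), map_sub, sub_eq_zero, ← Hom.res_sec, hc, res_res] at H
    rw [← Hom.sec_comp, HomologicalComplex.homologyπ_naturality, Hom.sec_comp, H]
  exact isIso_of_mono_of_epi _

end

end AlgebraicGeometry.Scheme.Modules

/-! ### K-injective complexes with quasi-coherent cohomology -/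

namespace AlgebraicGeometry.Scheme.Modules

open CochainComplex

variable {X : Scheme.{u}} {U V W : X.Opens} {i j k n : ℤ}

/-- A quasi-isomorphism of K-injective complexes is a homotopy equivalence, so it is injective on
the cohomology of sections over any open, not only on cohomology sheaves. -/
lemma exists_d_eq_of_quasiIso {K L : CochainComplex X.Modules ℤ} [K.IsKInjective]
    [L.IsKInjective] (f : K ⟶ L) [QuasiIso f] (z : Γ(K.X n, U))
    (hz : (K.d n (n + 1)).sec U z = 0) (w : Γ(L.X (n - 1), U))
    (hw : (L.d (n - 1) n).sec U w = (f.f n).sec U z) :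
    ∃ y : Γ(K.X (n - 1), U), (K.d (n - 1) n).sec U y = z := by
  obtain ⟨e, rfl⟩ := (IsKInjective.quasiIso_iff f).1 inferInstance
  obtain ⟨y, hy⟩ := exists_d_eq_of_homotopy e.homotopyHomInvId z hz
  refine ⟨(e.inv.f _).sec U w - y, ?_⟩
  rw [map_sub, hy, ← f_sec_d_sec, hw]
  simp

lemma IsLocalBoundary.of_local {K : CochainComplex X.Modules ℤ} {z : Γ(K.X j, U)}
    (h : ∀ x ∈ U, ∃ (V : X.Opens) (h : V ≤ U), x ∈ V ∧ IsLocalBoundary K i j ((K.X j).res h z)) :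
    IsLocalBoundary K i j z := by
  intro x hx
  obtain ⟨V, hV, hxV, H⟩ := h x hx
  obtain ⟨W, hW, hxW, y, hy⟩ := H x hxV
  exact ⟨W, hW.trans hV, hxW, y, by rw [hy, res_res]⟩

lemma exists_affine_le {x : X} (hx : x ∈ U) :
    ∃ V : X.Opens, V ≤ U ∧ x ∈ V ∧ IsAffineOpen V := by
  obtain ⟨V, hV, hxV, h⟩ := exists_isAffineOpen_mem_and_subset hx
  exact ⟨V, h, hxV, hV⟩

lemma IsLocalBoundary.neg {K : CochainComplex X.Modules ℤ} {z : Γ(K.X j, U)}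
    (hz : IsLocalBoundary K i j z) : IsLocalBoundary K i j (-z) := by
  have := (isLocalBoundary_d (K := K) (j := j) (0 : Γ(K.X i, U))).sub hz
  rwa [map_zero, zero_sub] at this

/-- A tower of complexes approximating a complex. -/
structure Tower (J : CochainComplex X.Modules ℤ) where
  /-- the complexes of the tower -/
  obj : ℕ → CochainComplex X.Modules ℤ
  /-- the transition maps -/
  map (m : ℕ) : obj (m + 1) ⟶ obj m
  /-- the maps to the tower -/
  π (m : ℕ) : J ⟶ obj m
  π_map (m : ℕ) : π (m + 1) ≫ map m = π m
  quasiIsoAt (m : ℕ) (n : ℤ) (h : -(m : ℤ) ≤ n) : QuasiIsoAt (π m) n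
  fibrant (m : ℕ) : IsAcyclicFibrant (obj m)
  liftsBoundaries (m : ℕ) (n : ℤ) (V : X.Opens) (hV : IsAffineOpen V) :
    LiftsBoundaries (obj m) n V
  liftsClasses (m : ℕ) (n : ℤ) (V : X.Opens) (hV : IsAffineOpen V) :
    LiftsClasses (obj m) n V

namespace Tower

variable {J : CochainComplex X.Modules ℤ} (T : Tower J)

/-- The product of the complexes of the tower. -/
noncomputable abbrev prod : CochainComplex X.Modules ℤ := ∏ᶜ T.obj

instance : T.prod.IsKInjective := (IsAcyclicFibrant.piObj _ T.fibrant).isKInjective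

lemma quasiIsoAt_map (m : ℕ) (n : ℤ) (h : -(m : ℤ) ≤ n) : QuasiIsoAt (T.map m) n := by
  have h₁ := T.quasiIsoAt m n h
  have h₂ := T.quasiIsoAt (m + 1) n (by push_cast; lia)
  rw [← T.π_map m] at h₁
  exact quasiIsoAt_of_comp_left (T.π (m + 1)) (T.map m) n

/-- The map to the product of the complexes of the tower. -/
noncomputable def toProd : J ⟶ T.prod := Pi.lift T.π

/-- The difference of the identity and of the shift on the product. -/
noncomputable def diff : T.prod ⟶ T.prod :=
  𝟙 _ - Pi.lift fun m => Pi.π T.obj (m + 1) ≫ T.map m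

lemma toProd_diff : T.toProd ≫ T.diff = 0 := by
  refine Pi.hom_ext _ _ fun m => ?_
  simp [toProd, diff, T.π_map]

/-- A component of a section of the product. -/
noncomputable def comp (m : ℕ) (p : Γ(T.prod.X n, U)) : Γ((T.obj m).X n, U) :=
  ((Pi.π T.obj m).f n).sec U p

variable {T}

lemma comp_toProd (m : ℕ) (z : Γ(J.X n, U)) :
    T.comp m ((T.toProd.f n).sec U z) = ((T.π m).f n).sec U z := by
  have : T.toProd ≫ Pi.π T.obj m = T.π m := by simp [toProd]
  rw [comp, ← Hom.sec_comp, ← this]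
  rfl

lemma comp_diff (m : ℕ) (p : Γ(T.prod.X n, U)) :
    T.comp m ((T.diff.f n).sec U p) = T.comp m p - ((T.map m).f n).sec U (T.comp (m + 1) p) := by
  have : T.diff ≫ Pi.π T.obj m = Pi.π T.obj m - Pi.π T.obj (m + 1) ≫ T.map m := by simp [diff]
  rw [comp, ← Hom.sec_comp, ← HomologicalComplex.comp_f, this]
  rfl

lemma comp_d (m : ℕ) (p : Γ(T.prod.X i, U)) :
    T.comp m ((T.prod.d i j).sec U p) = ((T.obj m).d i j).sec U (T.comp m p) :=
  f_sec_d_sec _ _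

lemma comp_add (m : ℕ) (p q : Γ(T.prod.X i, U)) : T.comp m (p + q) = T.comp m p + T.comp m q :=
  map_add _ _ _

lemma comp_zero (m : ℕ) : T.comp m (0 : Γ(T.prod.X i, U)) = 0 :=
  map_zero _

lemma res_comp (h : V ≤ U) (m : ℕ) (p : Γ(T.prod.X i, U)) :
    ((T.obj m).X i).res h (T.comp m p) = T.comp m ((T.prod.X i).res h p) :=
  Hom.res_sec _ _ _

lemma ext {p q : Γ(T.prod.X i, U)} (h : ∀ m, T.comp m p = T.comp m q) : p = q :=
  eq_of_sec_π_eq h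

lemma exists_comp_eq (s : ∀ m, Γ((T.obj m).X i, U)) : ∃ p : Γ(T.prod.X i, U), ∀ m, T.comp m p = s m :=
  exists_sec_π_eq _ s

variable (T)

/-- Surjectivity, on the cohomology of sections over an affine open, of the identity minus the
shift. From stage `|n|` on, the transition maps are isomorphisms on `H^n`, so the equations are
solved upwards up to boundaries; the finitely many lower components are determined downwards. -/
lemma exists_diff_eq (hV : IsAffineOpen V) (x : Γ(T.prod.X n, V))
    (hx : (T.prod.d n (n + 1)).sec V x = 0) :
    ∃ (q : Γ(T.prod.X n, V)) (w : Γ(T.prod.X (n - 1), V)), (T.prod.d n (n + 1)).sec V q = 0 ∧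
      (T.diff.f n).sec V q = x + (T.prod.d (n - 1) n).sec V w := by
  have hx' : ∀ m, ((T.obj m).d n (n + 1)).sec V (T.comp m x) = 0 := fun m => by
    rw [← comp_d, hx, comp_zero]
  suffices H : ∀ M ≤ n.natAbs, ∃ (q : ∀ m, Γ((T.obj m).X n, V))
      (w : ∀ m, Γ((T.obj m).X (n - 1), V)), ∀ m, M ≤ m →
        ((T.obj m).d n (n + 1)).sec V (q m) = 0 ∧
        q m - ((T.map m).f n).sec V (q (m + 1)) =
          T.comp m x + ((T.obj m).d (n - 1) n).sec V (w m) by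
    obtain ⟨q, w, h⟩ := H 0 (Nat.zero_le _)
    obtain ⟨q, rfl⟩ : ∃ q', q = fun m => T.comp m q' := by
      obtain ⟨q', h⟩ := exists_comp_eq q
      exact ⟨q', (funext h).symm⟩
    obtain ⟨w, rfl⟩ : ∃ w', w = fun m => T.comp m w' := by
      obtain ⟨w', h⟩ := exists_comp_eq w
      exact ⟨w', (funext h).symm⟩
    refine ⟨q, w, ext fun m => ?_, ext fun m => ?_⟩
    · rw [comp_d, comp_zero]
      exact (h m (Nat.zero_le _)).1
    · rw [comp_diff, comp_add, comp_d]
      exact (h m (Nat.zero_le _)).2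
  intro M hM
  induction hM using Nat.decreasingInduction with
  | self =>
    have step : ∀ (m : ℕ) (y : {y : Γ((T.obj m).X n, V) // ((T.obj m).d n (n + 1)).sec V y = 0}),
        ∃ y' : {y : Γ((T.obj (m + 1)).X n, V) // ((T.obj (m + 1)).d n (n + 1)).sec V y = 0},
          n.natAbs ≤ m → ∃ w, y.1 - ((T.map m).f n).sec V y'.1 =
            T.comp m x + ((T.obj m).d (n - 1) n).sec V w := by
      rintro m ⟨y, hy⟩
      by_cases hm : n.natAbs ≤ m
      · have := T.quasiIsoAt_map m n (by lia)
        obtain ⟨y', hy', h⟩ := exists_isLocalBoundary_sub (T.map m) (y - T.comp m x)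
          (by rw [map_sub, hy, hx', sub_zero]) (T.liftsClasses _ _ _ hV)
        obtain ⟨w, hw⟩ := T.liftsBoundaries _ _ _ hV _ h
        refine ⟨⟨y', hy'⟩, fun _ => ⟨-w, ?_⟩⟩
        rw [map_neg, hw]
        abel
      · exact ⟨⟨0, map_zero _⟩, fun h => (hm h).elim⟩
    choose F w hF using step
    let q : ∀ m, {y : Γ((T.obj m).X n, V) // ((T.obj m).d n (n + 1)).sec V y = 0} :=
      fun m => Nat.rec ⟨0, map_zero _⟩ F m
    exact ⟨fun m => (q m).1, fun m => if h : n.natAbs ≤ m then w m (q m) h else 0,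
      fun m hm => ⟨(q m).2, by
        have := hF m (q m) hm
        simp only [dif_pos hm]
        exact this⟩⟩
  | of_succ M hM ih =>
    obtain ⟨q, w, h⟩ := ih
    -- Downwards the equation at `M` is solved exactly, so no boundary is needed there.
    refine ⟨Function.update q M (((T.map M).f n).sec V (q (M + 1)) + T.comp M x),
      Function.update w M 0, fun m hm => ?_⟩
    have h₁ : m + 1 ≠ M := by lia
    rw [Function.update_of_ne h₁]
    obtain rfl | h₂ := eq_or_ne m M
    · rw [Function.update_self, Function.update_self, map_add, ← f_sec_d_sec,
        (h (m + 1) le_rfl).1, hx', map_zero, map_zero]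
      refine ⟨add_zero _, ?_⟩
      abel
    · rw [Function.update_of_ne h₂, Function.update_of_ne h₂]
      exact h m (by lia)

/-- The comparison map from the mapping cone to the product. -/
noncomputable def coneToProd : mappingCone T.toProd ⟶ T.prod :=
  mappingCone.desc T.toProd 0 T.diff (by rw [T.toProd_diff]; simp)

variable {T}

lemma coneToProd_coneMk (hij : i + 1 = j) (z : Γ(J.X j, U)) (p : Γ(T.prod.X i, U)) :
    (T.coneToProd.f i).sec U (coneMk T.toProd hij z p) = (T.diff.f i).sec U p := by
  rw [coneMk, map_add, ← Hom.sec_comp, ← Hom.sec_comp, coneToProd, mappingCone.inl_v_desc_f,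
    mappingCone.inr_f_desc_f]
  simp

lemma comp_sub (m : ℕ) (p q : Γ(T.prod.X i, U)) : T.comp m (p - q) = T.comp m p - T.comp m q :=
  map_sub _ _ _

lemma isLocalBoundary_of_comp (hij : i + 1 = j) {z : Γ(J.X j, U)}
    (hz : (J.d j (j + 1)).sec U z = 0) {p : Γ(T.prod.X i, U)}
    (h : (T.toProd.f j).sec U z = (T.prod.d i j).sec U p) : IsLocalBoundary J i j z := by
  obtain rfl : i = j - 1 := by lia
  have := T.quasiIsoAt j.natAbs j (by lia)
  refine .of_map (T.π j.natAbs) hz ?_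
  rw [← comp_toProd, h, comp_d]
  exact isLocalBoundary_d _

/-- Approximation of cocycles whose differences are boundaries. -/
lemma exists_toProd_sub_eq {p : Γ(T.prod.X n, U)} (hp : (T.prod.d n (n + 1)).sec U p = 0)
    {w : Γ(T.prod.X (n - 1), U)} (hw : (T.diff.f n).sec U p = (T.prod.d (n - 1) n).sec U w)
    {x : X} (hx : x ∈ U) :
    ∃ (V : X.Opens) (h : V ≤ U), x ∈ V ∧ ∃ (z : Γ(J.X n, V)) (q : Γ(T.prod.X (n - 1), V)),
      (J.d n (n + 1)).sec V z = 0 ∧ (T.toProd.f n).sec V z - (T.prod.X n).res h p =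
        (T.prod.d (n - 1) n).sec V q := by
  have hp' : ∀ m, ((T.obj m).d n (n + 1)).sec U (T.comp m p) = 0 := fun m => by
    rw [← comp_d, hp, comp_zero]
  have := T.quasiIsoAt n.natAbs n (by lia)
  obtain ⟨V', hV', hxV', z', hz', hzp'⟩ :=
    exists_isLocalBoundary_sub_of_mem (T.π n.natAbs) _ (hp' n.natAbs) hx
  obtain ⟨V, hVV', hxV, hV⟩ := exists_affine_le hxV'
  have hVU := hVV'.trans hV'
  let z := (J.X n).res hVV' z'
  have hz : (J.d n (n + 1)).sec V z = 0 := by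
    rw [← Hom.res_sec, hz', map_zero]
  let r : ∀ m, Γ((T.obj m).X n, V) := fun m =>
    ((T.π m).f n).sec V z - T.comp m ((T.prod.X n).res hVU p)
  have hr : ∀ m, ((T.obj m).d n (n + 1)).sec V (r m) = 0 := fun m => by
    rw [map_sub, ← f_sec_d_sec, hz, map_zero, ← comp_d, ← Hom.res_sec, hp, map_zero, comp_zero,
      sub_zero]
  have hr₁ : ∀ m, r m - ((T.map m).f n).sec V (r (m + 1)) =
      ((T.obj m).d (n - 1) n).sec V (-T.comp m ((T.prod.X (n - 1)).res hVU w)) := fun m => by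
    rw [map_neg, ← comp_d, ← Hom.res_sec, ← hw, Hom.res_sec, comp_diff, map_sub, ← Hom.sec_comp,
      ← HomologicalComplex.comp_f, T.π_map]
    dsimp only [r]
    abel
  -- At stage `|n|` this is the choice of `z'`. It propagates upwards since the transition maps are
  -- injective on `H^n` there, and downwards by applying them, because `r m` and the image of `r (m
  -- + 1)` differ by a boundary.
  have hr₂ : ∀ m, IsLocalBoundary (T.obj m) (n - 1) n (r m) := by
    intro m
    obtain hm | hm := le_total n.natAbs m
    · induction m, hm using Nat.le_induction with
      | base =>
        have := hzp'.res hVV'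
        rw [map_sub, res_res, Hom.res_sec, res_comp] at this
        exact this
      | succ m hm ih =>
        have := T.quasiIsoAt_map m n (by lia)
        refine .of_map (T.map m) (hr _) ?_
        have := ih.sub (hr₁ m ▸ isLocalBoundary_d _)
        rwa [sub_sub_cancel] at this
    · induction hm using Nat.decreasingInduction with
      | self =>
        have := hzp'.res hVV'
        rw [map_sub, res_res, Hom.res_sec, res_comp] at this
        exact this
      | of_succ m hm ih =>
        have h₁ := (hr₁ m ▸ isLocalBoundary_d _ : IsLocalBoundary (T.obj m) (n - 1) n
          (r m - ((T.map m).f n).sec V (r (m + 1))))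
        have h₂ := h₁.sub ((ih.map (T.map m)).neg)
        rwa [sub_neg_eq_add, sub_add_cancel] at h₂
  choose q hq using fun m => T.liftsBoundaries m n V hV _ (hr₂ m)
  obtain ⟨q', hq'⟩ := exists_comp_eq q
  refine ⟨V, hVU, hxV, z, q', hz, ext fun m => ?_⟩
  rw [comp_d, hq', hq, comp_sub, comp_toProd]

/-- This says that `J` is the homotopy limit of the tower. Surjectivity on cohomology is
`exists_diff_eq`. For injectivity, a cone cocycle `(z, p)` is first reduced to `z = 0`, as `z` is a
local boundary seen at a single stage; then `exists_toProd_sub_eq` replaces the remaining second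
component by the image of a cocycle of `J`. -/
instance : QuasiIso T.coneToProd := by
  refine quasiIso_of_sections _ (fun n U c hc hFc => ?_) (fun n U y hy x hx => ?_)
  · intro x hx
    obtain ⟨z, p, rfl⟩ := exists_coneMk_eq (j := n + 1) rfl c
    rw [coneToProd_coneMk] at hFc
    rw [d_coneMk rfl rfl] at hc
    obtain ⟨hz, hzp⟩ := coneMk_inj (z' := 0) (p' := 0) rfl (hc.trans (by simp [coneMk]))
    rw [neg_eq_zero] at hz
    have hzp' : (T.toProd.f (n + 1)).sec U z = (T.prod.d n (n + 1)).sec U (-p) := by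
      rw [map_neg]
      exact eq_neg_of_add_eq_zero_left hzp
    obtain ⟨V₁, h₁, hxV₁, w, hw⟩ := hFc x hx
    obtain ⟨V₂, h₂, hxV₂, z', hz'⟩ := isLocalBoundary_of_comp rfl hz hzp' x hx
    have hU : V₁ ⊓ V₂ ≤ U := inf_le_left.trans h₁
    -- With `d z' = z`, the section `p + toProd z'` is a cocycle with the same image under `diff` as
    -- `p`.
    obtain ⟨V, hV, hxV, z'', q, hz'', hq⟩ := exists_toProd_sub_eq (T := T) (n := n)
      (p := (T.prod.X n).res hU p + (T.toProd.f n).sec _ ((J.X n).res inf_le_right z'))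
      (by
        rw [map_add, ← f_sec_d_sec, ← Hom.res_sec, ← Hom.res_sec, hz', res_res, ← Hom.res_sec,
          hzp', map_neg, map_neg, add_neg_cancel])
      (w := (T.prod.X (n - 1)).res inf_le_left w)
      (by
        rw [map_add, ← Hom.sec_comp, ← HomologicalComplex.comp_f, T.toProd_diff,
          HomologicalComplex.zero_f, Hom.sec_zero, add_zero, ← Hom.res_sec, ← Hom.res_sec, hw,
          res_res]) (x := x) ⟨hxV₁, hxV₂⟩
    refine ⟨V, hV.trans hU, hxV, coneMk T.toProd (by simp)
      (z'' - (J.X n).res (hV.trans inf_le_right) z') (-q), ?_⟩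
    rw [d_coneMk _ rfl, res_coneMk, map_sub, hz'', ← Hom.res_sec, hz', res_res, zero_sub, neg_neg,
      map_neg, ← hq, map_sub, map_add, res_res, Hom.res_sec, res_res]
    congr 1
    abel
  · obtain ⟨V, hVU, hxV, hV⟩ := exists_affine_le hx
    obtain ⟨q, w, hq, hqw⟩ := T.exists_diff_eq hV ((T.prod.X n).res hVU y)
      (by rw [← Hom.res_sec, hy, map_zero])
    refine ⟨V, hVU, hxV, coneMk T.toProd rfl 0 q, ?_, ?_⟩
    · rw [d_coneMk rfl rfl, map_zero, map_zero, hq]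
      simp [coneMk]
    · rw [coneToProd_coneMk, hqw, add_sub_cancel_left]
      exact isLocalBoundary_d _

instance [J.IsKInjective] : (mappingCone T.toProd).IsKInjective := isKInjective_mappingCone _

/-- Both the cone and the product are K-injective, so `coneToProd` is a homotopy equivalence and
statements on local cohomology become statements on sections over `V`. -/
lemma liftsBoundaries_left [J.IsKInjective] (T : Tower J) (n : ℤ) (hV : IsAffineOpen V) :
    LiftsBoundaries J n V := by
  intro z hz
  choose p hp using fun m => T.liftsBoundaries m n V hV _ (hz.map (T.π m))
  obtain ⟨p, rfl⟩ : ∃ p', p = fun m => T.comp m p' := by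
    obtain ⟨p', h⟩ := exists_comp_eq p
    exact ⟨p', (funext h).symm⟩
  replace hp : (T.prod.d (n - 1) n).sec V p = (T.toProd.f n).sec V z :=
    ext fun m => by rw [comp_d, comp_toProd, hp]
  have h₁ : n - 1 + 1 = n := by simp
  obtain ⟨q, w, hq, hqw⟩ := T.exists_diff_eq hV ((T.diff.f (n - 1)).sec V p) (by
    rw [h₁, ← f_sec_d_sec, hp, ← Hom.sec_comp, ← HomologicalComplex.comp_f, T.toProd_diff]
    rfl)
  -- Subtracting `p` from the cocycle `q` makes `(z, q - p)` a cone cocycle, with image the boundary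
  -- of `w`. It therefore bounds in the cone, and the first coordinate exhibits `z` as a boundary.
  obtain ⟨c, hc⟩ := exists_d_eq_of_quasiIso T.coneToProd (coneMk T.toProd h₁ z (q - p)) (by
    rw [h₁] at hq ⊢
    rw [d_coneMk _ rfl, hz.d_eq_zero, map_sub, hq, hp]
    simp [coneMk]) w (by rw [coneToProd_coneMk, map_sub, hqw, add_sub_cancel_left])
  obtain ⟨z', p', rfl⟩ := exists_coneMk_eq (j := n - 1) (by simp) c
  rw [d_coneMk _ h₁] at hc
  exact ⟨-z', by rw [map_neg]; exact (coneMk_inj _ hc).1⟩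

/-- Lift the class at every stage to get `p`. The section `diff p` is componentwise a boundary, so
the cone cocycle `(0, p)` bounds some `(z, w')`; thus `p` is `toProd z` up to a boundary, and `z` is
the required cocycle. -/
lemma liftsClasses_left [J.IsKInjective] (T : Tower J) (n : ℤ) (hV : IsAffineOpen V) :
    LiftsClasses J n V := by
  intro s
  choose c hc using fun m => T.liftsClasses m n V hV
    ((HomologicalComplex.homologyMap (T.π m) n).sec V s)
  obtain ⟨p, hp⟩ := exists_comp_eq fun m => ((T.obj m).iCycles n).sec V (c m)
  have h : ∀ m, IsLocalBoundary (T.obj m) (n - 1) n (T.comp m ((T.diff.f n).sec V p)) := by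
    intro m
    rw [comp_diff, hp, hp, ← Hom.sec_comp, ← HomologicalComplex.cyclesMap_i, Hom.sec_comp,
      ← map_sub, ← homologyπ_sec_eq_zero_iff (by simp), map_sub, hc, ← Hom.sec_comp,
      ← HomologicalComplex.homologyπ_naturality, Hom.sec_comp, hc, ← Hom.sec_comp,
      ← HomologicalComplex.homologyMap_comp, T.π_map, sub_self]
  choose w hw using fun m => T.liftsBoundaries m n V hV _ (h m)
  obtain ⟨w, rfl⟩ : ∃ w', w = fun m => T.comp m w' := by
    obtain ⟨w', h⟩ := exists_comp_eq w
    exact ⟨w', (funext h).symm⟩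
  obtain ⟨c', hc'⟩ := exists_d_eq_of_quasiIso T.coneToProd (coneMk T.toProd rfl 0 p) (by
    rw [d_coneMk _ rfl, show (T.prod.d n (n + 1)).sec V p = 0 from ext fun m => by
      rw [comp_d, hp, d_sec_iCycles_sec, comp_zero]]
    simp [coneMk]) w (by
      rw [coneToProd_coneMk]
      exact ext fun m => by rw [comp_d, hw])
  obtain ⟨z, w', rfl⟩ := exists_coneMk_eq (j := n) (by simp) c'
  rw [d_coneMk _ rfl] at hc'
  obtain ⟨hz, hzp⟩ := coneMk_inj _ hc'
  rw [neg_eq_zero] at hz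
  obtain ⟨c₀, rfl⟩ := exists_iCycles_sec_eq rfl z hz
  refine ⟨c₀, ?_⟩
  -- Equality of classes can be checked at stage `|n|`, where the map from `J` is an isomorphism on
  -- `H^n`.
  have := T.quasiIsoAt n.natAbs n (by lia)
  apply sec_injective (HomologicalComplex.homologyMap (T.π n.natAbs) n)
  rw [← hc, ← sub_eq_zero, ← Hom.sec_comp, HomologicalComplex.homologyπ_naturality, Hom.sec_comp,
    ← map_sub, homologyπ_sec_eq_zero_iff (i := n - 1) (by simp), map_sub, ← hp, ← hzp, comp_add,
    comp_toProd, comp_d, ← Hom.sec_comp, HomologicalComplex.cyclesMap_i, Hom.sec_comp,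
    sub_add_cancel_left]
  exact (isLocalBoundary_d _).neg

end Tower

end AlgebraicGeometry.Scheme.Modules

/-! ### Unbounded K-injective complexes, and Mayer–Vietoris. -/

namespace AlgebraicGeometry.Scheme.Modules

open CochainComplex

variable {X : Scheme.{u}} {U V W : X.Opens} {i j k n : ℤ}

section

variable (J : CochainComplex X.Modules ℤ)

instance (m : ℕ) : (J.truncGE (-(m : ℤ))).IsStrictlyGE (-((m + 1 : ℕ) : ℤ)) :=
  isStrictlyGE_of_ge _ _ (-(m : ℤ)) (by push_cast; lia)

/-- The transition maps between the canonical truncations of a complex. -/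
noncomputable def truncGETransition (m : ℕ) :
    J.truncGE (-((m + 1 : ℕ) : ℤ)) ⟶ J.truncGE (-(m : ℤ)) :=
  truncGEMap (J.πTruncGE (-(m : ℤ))) _ ≫ inv (πTruncGE (J.truncGE (-(m : ℤ))) _)

lemma πTruncGE_truncGETransition (m : ℕ) :
    J.πTruncGE _ ≫ truncGETransition J m = J.πTruncGE _ := by
  rw [truncGETransition, ← Category.assoc, πTruncGE_naturality, Category.assoc,
    IsIso.hom_inv_id, Category.comp_id]

/-- The map from a complex to the K-injective resolution of its canonical truncation. -/
noncomputable def toResolutionTruncGE (m : ℕ) :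
    J ⟶ kInjectiveResolution.obj (J.truncGE (-(m : ℤ))) :=
  J.πTruncGE _ ≫ toKInjectiveResolution.app (J.truncGE (-(m : ℤ)))

lemma toResolutionTruncGE_map (m : ℕ) :
    toResolutionTruncGE J (m + 1) ≫ kInjectiveResolution.map (truncGETransition J m) =
      toResolutionTruncGE J m := by
  refine (Category.assoc _ _ _).trans ?_
  refine (congr_arg (J.πTruncGE _ ≫ ·)
    (toKInjectiveResolution.naturality (truncGETransition J m)).symm).trans ?_
  refine (Category.assoc _ _ _).symm.trans ?_
  exact congr_arg (· ≫ _) (πTruncGE_truncGETransition J m)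

lemma quasiIsoAt_toResolutionTruncGE (m : ℕ) (n : ℤ) (h : -(m : ℤ) ≤ n) :
    QuasiIsoAt (toResolutionTruncGE J m) n := by
  have h₁ := J.quasiIsoAt_πTruncGE _ n h
  have h₂ : QuasiIsoAt (toKInjectiveResolution.app (J.truncGE (-(m : ℤ)))) n := inferInstance
  exact @quasiIsoAt_comp _ _ _ _ _ _ _ _ _ _ _ _ _ _ h₁ h₂

variable {J} in
lemma hasLocalizedSections_homology_truncGE (hJ : ∀ n, HasLocalizedSections (J.homology n))
    (m n : ℤ) : HasLocalizedSections ((J.truncGE m).homology n) := by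
  obtain h | h := le_or_gt m n
  · have := J.quasiIsoAt_πTruncGE m n h
    exact (hJ n).of_iso (isoOfQuasiIsoAt (J.πTruncGE m) n)
  · exact .of_isZero (isZero_of_isGE _ m n h)

/-- The tower of the K-injective resolutions of the canonical truncations. -/
noncomputable def truncTower (hJ : ∀ n, HasLocalizedSections (J.homology n)) : Tower J where
  obj m := kInjectiveResolution.obj (J.truncGE (-(m : ℤ)))
  map m := kInjectiveResolution.map (truncGETransition J m)
  π m := toResolutionTruncGE J m
  π_map m := toResolutionTruncGE_map J m
  quasiIsoAt m n h := quasiIsoAt_toResolutionTruncGE J m n h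
  fibrant _ := isAcyclicFibrant_kInjectiveResolution_obj _
  liftsBoundaries m n := (lifts_kInjectiveResolution_of_isStrictlyGE (-(m : ℤ))
    (hasLocalizedSections_homology_truncGE hJ _) n).1
  liftsClasses m n := (lifts_kInjectiveResolution_of_isStrictlyGE (-(m : ℤ))
    (hasLocalizedSections_homology_truncGE hJ _) n).2

end

section

variable {J : CochainComplex X.Modules ℤ} [J.IsKInjective]

/-- Together with the next lemma: over an affine open, taking sections of `J` commutes with
cohomology. The tower exists because K-injective resolutions are functorial. -/
lemma liftsBoundaries_of_isKInjective (hJ : ∀ n, HasLocalizedSections (J.homology n)) (n : ℤ)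
    (hV : IsAffineOpen V) : LiftsBoundaries J n V :=
  (truncTower J hJ).liftsBoundaries_left n hV

lemma liftsClasses_of_isKInjective (hJ : ∀ n, HasLocalizedSections (J.homology n)) (n : ℤ)
    (hV : IsAffineOpen V) : LiftsClasses J n V :=
  (truncTower J hJ).liftsClasses_left n hV

end

/-! ### Cocycles vanishing on an open subset -/

/-- Cocycles over `V` vanishing on `D` are, up to a power of `f`, boundaries of sections
vanishing on `D`. -/
def KillsClasses (K : CochainComplex X.Modules ℤ) (f : Γ(X, U)) (D V : X.Opens) : Prop :=
  ∀ (h : V ≤ U) (n : ℤ) (z : Γ(K.X n, V)), (K.d n (n + 1)).sec V z = 0 →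
    (K.X n).res (inf_le_left : V ⊓ D ≤ V) z = 0 →
    ∃ (m : ℕ) (y : Γ(K.X (n - 1), V)), (K.X (n - 1)).res (inf_le_left : V ⊓ D ≤ V) y = 0 ∧
      (K.d (n - 1) n).sec V y = X.rres h f ^ m • z

/-- Induction on the number of members of a finite cover. Intersecting a member with the others
gives a cover in `B` with no more members, so the induction is on cardinality and not on the cover.
-/
lemma induction_of_mayerVietoris {P : X.Opens → Prop} (B : Set X.Opens)
    (hB : ∀ V ∈ B, ∀ W ∈ B, V ⊓ W ∈ B) (bot : P ⊥) (base : ∀ V ∈ B, P V)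
    (mv : ∀ V W, P V → P W → P (V ⊓ W) → P (V ⊔ W)) (V : X.Opens) (hV : IsCompact (V : Set X))
    (h : ∀ x ∈ V, ∃ W ∈ B, x ∈ W ∧ W ≤ V) : P V := by
  classical
  have key : ∀ (m : ℕ) (s : Finset X.Opens), s.card = m → (∀ W ∈ s, W ∈ B) → P (s.sup id) := by
    intro m
    induction m using Nat.strong_induction_on with
    | _ m ih =>
      intro s hs hsB
      obtain rfl | ⟨b, hb⟩ := s.eq_empty_or_nonempty
      · exact bot
      · have hlt : (s.erase b).card < m := hs ▸ Finset.card_erase_lt_of_mem hb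
        rw [← Finset.insert_erase hb, Finset.sup_insert, id]
        refine mv _ _ (base b (hsB b hb)) (ih _ hlt _ rfl fun W hW =>
          hsB W (Finset.mem_of_mem_erase hW)) ?_
        have := ih _ (Finset.card_image_le.trans_lt hlt) ((s.erase b).image (b ⊓ ·)) rfl (by
          intro W hW
          obtain ⟨W', hW', rfl⟩ := Finset.mem_image.1 hW
          exact hB b (hsB b hb) _ (hsB _ (Finset.mem_of_mem_erase hW')))
        rwa [Finset.sup_image, Function.id_comp, ← Finset.sup_inf_distrib_left] at this
  choose! F hF hxF hFV using h
  obtain ⟨t, ht⟩ := hV.elim_finite_subcover (fun x : V => (F x : Set X)) (fun x => (F x).isOpen)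
    fun x hx => Set.mem_iUnion.2 ⟨⟨x, hx⟩, hxF x hx⟩
  have e : V = (t.image fun x : V => F x).sup id := by
    refine le_antisymm (fun x hx => ?_) (Finset.sup_le fun W hW => ?_)
    · obtain ⟨y, hy, hxy⟩ := Set.mem_iUnion₂.1 (ht hx)
      exact (Finset.le_sup (f := id) (Finset.mem_image_of_mem _ hy) :
        F y ≤ (t.image fun x : V => F x).sup id) hxy
    · obtain ⟨y, -, rfl⟩ := Finset.mem_image.1 hW
      exact hFV y y.2
  rw [e]
  refine key _ _ rfl fun W hW => ?_
  obtain ⟨y, -, rfl⟩ := Finset.mem_image.1 hW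
  exact hF y y.2

variable {K : CochainComplex X.Modules ℤ} {f : Γ(X, U)} {D : X.Opens}

/-- Mayer–Vietoris for sections vanishing on `D`: after scaling by powers of `f`, the two primitives
differ on the overlap by a cocycle vanishing on `D`, to which the hypothesis on `V ⊓ W` applies. -/
lemma KillsClasses.sup (hK : ∀ n, IsFlasque (K.X n)) (hV : KillsClasses K f D V)
    (hW : KillsClasses K f D W) (hVW : KillsClasses K f D (V ⊓ W)) :
    KillsClasses K f D (V ⊔ W) := by
  intro h n z hz hzD
  have hV' := le_sup_left.trans h
  have hW' := le_sup_right.trans h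
  obtain ⟨m₁, y₁, hy₁, hdy₁⟩ := hV hV' n ((K.X n).res le_sup_left z)
    (by rw [← Hom.res_sec, hz, map_zero]) (by
      have := congr_arg ((K.X n).res (inf_le_inf_right D (le_sup_left : V ≤ V ⊔ W))) hzD
      rw [res_res, map_zero] at this
      rw [res_res, this])
  obtain ⟨m₂, y₂, hy₂, hdy₂⟩ := hW hW' n ((K.X n).res le_sup_right z)
    (by rw [← Hom.res_sec, hz, map_zero]) (by
      have := congr_arg ((K.X n).res (inf_le_inf_right D (le_sup_right : W ≤ V ⊔ W))) hzD
      rw [res_res, map_zero] at this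
      rw [res_res, this])
  let t : Γ(K.X (n - 1), V ⊓ W) :=
    (K.X (n - 1)).res inf_le_left (X.rres hV' f ^ m₂ • y₁) -
      (K.X (n - 1)).res inf_le_right (X.rres hW' f ^ m₁ • y₂)
  obtain ⟨m, w, hw, hdw⟩ := hVW (inf_le_left.trans hV') (n - 1) t
    (by
      rw [sub_add_cancel, map_sub, ← Hom.res_sec, ← Hom.res_sec, Hom.sec_smul, Hom.sec_smul, hdy₁, hdy₂,
        smul_smul, smul_smul, res_smul, res_smul, res_res, res_res, map_mul, map_mul, map_pow,
        map_pow, map_pow, map_pow, rres_rres, rres_rres, mul_comm, sub_self])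
    (by
      have h₁ := congr_arg ((K.X (n - 1)).res (inf_le_inf_right D (inf_le_left : V ⊓ W ≤ V))) hy₁
      have h₂ := congr_arg ((K.X (n - 1)).res (inf_le_inf_right D (inf_le_right : V ⊓ W ≤ W))) hy₂
      rw [res_res, map_zero] at h₁ h₂
      rw [map_sub, res_res, res_res, res_smul, res_smul, h₁, h₂, smul_zero, smul_zero, sub_zero])
  -- The correction `w` is glued with zero on `V ⊓ D` before the flasque extension to `V`, so that
  -- the corrected primitive still vanishes on `D`.
  obtain ⟨v, hv₁, hv₂⟩ := exists_glue (M := K.X (n - 1 - 1))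
    (le_sup_left : V ⊓ W ≤ V ⊓ W ⊔ V ⊓ D) le_sup_right le_rfl w 0 (by
      have := congr_arg ((K.X (n - 1 - 1)).res
        (le_inf inf_le_left (inf_le_right.trans inf_le_right) :
          V ⊓ W ⊓ (V ⊓ D) ≤ V ⊓ W ⊓ D)) hw
      rw [res_res, map_zero] at this
      rw [this, map_zero])
  obtain ⟨v, rfl⟩ := hK _ (sup_le inf_le_left inf_le_left : V ⊓ W ⊔ V ⊓ D ≤ V) v
  rw [res_res] at hv₁ hv₂
  obtain ⟨y, hy, hyV, hyW⟩ := exists_d_eq_of_glue (K := K)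
    (z := X.rres h f ^ (m + (m₁ + m₂)) • z) (le_sup_left : V ≤ V ⊔ W) le_sup_right le_rfl
    (X.rres hV' f ^ m • X.rres hV' f ^ m₂ • y₁ - (K.d (n - 1 - 1) (n - 1)).sec V v)
    (X.rres hW' f ^ m • X.rres hW' f ^ m₁ • y₂)
    (by
      rw [map_sub, d_sec_d_sec, sub_zero, Hom.sec_smul, Hom.sec_smul, hdy₁, res_smul, smul_smul, smul_smul,
        map_pow, rres_rres, ← pow_add, ← pow_add, add_assoc, add_comm m₂])
    (by
      rw [Hom.sec_smul, Hom.sec_smul, hdy₂, res_smul, smul_smul, smul_smul,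
        map_pow, rres_rres, ← pow_add, ← pow_add, add_assoc])
    (by
      rw [map_sub, Hom.res_sec, hv₁, hdw, res_smul, res_smul, map_pow, rres_rres, map_pow,
        rres_rres]
      simp only [t, res_smul, map_pow, rres_rres, smul_sub, sub_sub_cancel])
  refine ⟨m + (m₁ + m₂), y, ?_, hy⟩
  refine eq_of_res_eq₂ (V := V ⊓ D) (W := W ⊓ D) (inf_le_inf_right _ le_sup_left)
    (inf_le_inf_right _ le_sup_right) (inf_sup_right _ _ _).le ?_ ?_
  · have := congr_arg ((K.X (n - 1)).res (inf_le_left : V ⊓ D ≤ V)) hyV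
    rw [res_res, map_sub, res_smul, res_smul, hy₁, smul_zero, smul_zero, Hom.res_sec, hv₂,
      map_zero, sub_zero] at this
    rw [res_res, map_zero, this]
  · have := congr_arg ((K.X (n - 1)).res (inf_le_left : W ⊓ D ≤ W)) hyW
    rw [res_res, res_smul, res_smul, hy₂, smul_zero, smul_zero] at this
    rw [res_res, map_zero, this]

/-- Intersections of affine opens need not be affine, so Mayer–Vietoris is applied twice: within an
affine open, where basic opens are closed under intersection, and then for opens contained in some
affine open. Noetherianity makes every open compact. -/
lemma killsClasses_of_isAffineOpen [IsNoetherian X] (hK : ∀ n, IsFlasque (K.X n))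
    (h : ∀ V, V ≤ U → IsAffineOpen V → KillsClasses K f D V) : KillsClasses K f D V := by
  by_cases hVU : V ≤ U
  swap
  · exact fun h => (hVU h).elim
  have hc : ∀ V : X.Opens, IsCompact (V : Set X) := fun V => NoetherianSpace.isCompact _
  have bot : KillsClasses K f D ⊥ := fun _ n z _ _ => ⟨0, 0, by simp, eq_of_bot _ _⟩
  refine induction_of_mayerVietoris {V | V ≤ U ∧ ∃ W, V ≤ W ∧ IsAffineOpen W}
    (fun V hV W _ => ⟨inf_le_left.trans hV.1, hV.2.imp fun _ h => ⟨inf_le_left.trans h.1, h.2⟩⟩)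
    bot ?_ (fun _ _ => KillsClasses.sup hK) V (hc V) ?_
  · rintro V ⟨hVU, W, hVW, hW⟩
    refine induction_of_mayerVietoris {V | V ≤ U ∧ ∃ g : Γ(X, W), X.basicOpen g = V}
      ?_ bot ?_ (fun _ _ => KillsClasses.sup hK) V (hc V) ?_
    · rintro _ ⟨hV, g, rfl⟩ _ ⟨hV', g', rfl⟩
      exact ⟨inf_le_left.trans hV, g * g', X.basicOpen_mul g g'⟩
    · rintro _ ⟨hV, g, rfl⟩
      exact h _ hV (hW.basicOpen g)
    · intro x hx
      obtain ⟨g, hg, hxg⟩ := hW.exists_basicOpen_le ⟨x, hx⟩ (hVW hx)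
      exact ⟨_, ⟨hg.trans hVU, g, rfl⟩, hxg, hg⟩
  · intro x hx
    obtain ⟨W, hWV, hxW, hW⟩ := exists_affine_le hx
    exact ⟨W, ⟨hWV.trans hVU, W, le_rfl, hW⟩, hxW, hWV⟩

end AlgebraicGeometry.Scheme.Modules

/-! ### Killing classes by powers of a function, and quasi-coherence of cohomology. -/

namespace AlgebraicGeometry.Scheme.Modules

variable {X : Scheme.{u}} {U V W : X.Opens} {i j k n : ℤ} {K : CochainComplex X.Modules ℤ}

lemma IsLocalBoundary.exists_smul_d_eq (hH : HasLocalizedSections (K.homology n))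
    (hS : LiftsBoundaries K n V) (hV : IsAffineOpen V) (f : Γ(X, V)) {z : Γ(K.X n, V)}
    (hz : (K.d n (n + 1)).sec V z = 0)
    (h : IsLocalBoundary K (n - 1) n ((K.X n).res (X.basicOpen_le f) z)) :
    ∃ (m : ℕ) (y : Γ(K.X (n - 1), V)), (K.d (n - 1) n).sec V y = f ^ m • z := by
  obtain ⟨c, rfl⟩ := exists_iCycles_sec_eq rfl z hz
  rw [Hom.res_sec, ← homologyπ_sec_eq_zero_iff (by simp), ← Hom.res_sec] at h
  obtain ⟨m, hm⟩ := hH.exists_pow_smul_eq_zero V hV f _ h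
  rw [← Hom.sec_smul, homologyπ_sec_eq_zero_iff (i := n - 1) (by simp)] at hm
  obtain ⟨y, hy⟩ := hS _ hm
  exact ⟨m, y, by rw [hy, Hom.sec_smul]⟩

/-- A power of `f` kills the class of `z`, giving a primitive `y` that is a cocycle on `D(f)`. Up to
another power of `f`, the class of `y` there extends over `V`; subtracting a cocycle of that class
and a boundary extended by flasqueness makes the primitive vanish on `D(f)`. -/
lemma killsClasses_basicOpen (hK : ∀ n, IsFlasque (K.X n))
    (hH : ∀ n, HasLocalizedSections (K.homology n))
    (hS : ∀ n V, IsAffineOpen V → LiftsBoundaries K n V)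
    (hT : ∀ n V, IsAffineOpen V → LiftsClasses K n V) (f : Γ(X, U))
    (hV : IsAffineOpen V) : KillsClasses K f (X.basicOpen f) V := by
  intro h n z hz hzD
  have hD : X.basicOpen (X.rres h f) = V ⊓ X.basicOpen f := X.basicOpen_res f _
  obtain ⟨m, y, hy⟩ := IsLocalBoundary.exists_smul_d_eq (hH n) (hS n V hV) hV (X.rres h f) hz (by
    have := congr_arg ((K.X n).res hD.le) hzD
    rw [res_res, map_zero] at this
    rw [this]
    simpa using isLocalBoundary_d (K := K) (i := n - 1) (j := n) (0 : Γ(K.X (n - 1), _)))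
  obtain ⟨c, hc⟩ := exists_iCycles_sec_eq (K := K) (i := n - 1) (j := n) (by simp)
    ((K.X (n - 1)).res (X.basicOpen_le (X.rres h f)) y) (by
      have := congr_arg ((K.X n).res hD.le) hzD
      rw [res_res, map_zero] at this
      rw [← Hom.res_sec, hy, res_smul, this, smul_zero])
  obtain ⟨l, s, hs⟩ := (hH (n - 1)).exists_res_eq_pow_smul V hV (X.rres h f)
    ((K.homologyπ (n - 1)).sec _ c)
  obtain ⟨c', rfl⟩ := hT (n - 1) V hV s
  rw [Hom.res_sec, ← Hom.sec_smul, ← sub_eq_zero, ← map_sub,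
    homologyπ_sec_eq_zero_iff (i := n - 1 - 1) (by simp), map_sub, Hom.sec_smul, hc,
    ← Hom.res_sec] at hs
  obtain ⟨w, hw⟩ := hS _ _ (hV.basicOpen _) _ hs
  obtain ⟨w, rfl⟩ := hK _ (X.basicOpen_le _) w
  refine ⟨l + m, X.rres h f ^ l • y - (K.iCycles _).sec V c' + (K.d _ _).sec V w, ?_, ?_⟩
  · have : (K.X (n - 1)).res (X.basicOpen_le (X.rres h f))
        (X.rres h f ^ l • y - (K.iCycles _).sec V c' + (K.d _ _).sec V w) = 0 := by
      rw [map_add, map_sub, Hom.res_sec _ _ w, hw, res_smul, map_pow]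
      abel
    have := congr_arg ((K.X (n - 1)).res hD.ge) this
    rwa [res_res, map_zero] at this
  · rw [map_add, map_sub, d_sec_d_sec, d_sec_iCycles_sec, Hom.sec_smul, hy, smul_smul, pow_add]
    simp

/-- The case `f = 1`, `D = ⊥` of the Mayer–Vietoris argument: where the cohomology sheaves vanish,
sections over any open, affine or not, form an exact complex. -/
lemma exists_d_eq_of_isAcyclic [IsNoetherian X] (hK : ∀ n, IsFlasque (K.X n))
    (hS : ∀ n V, IsAffineOpen V → LiftsBoundaries K n V)
    (h : ∀ (n : ℤ) (V : X.Opens), V ≤ U → ∀ s t : Γ(K.homology n, V), s = t)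
    (z : Γ(K.X n, U)) (hz : (K.d n (n + 1)).sec U z = 0) :
    ∃ y : Γ(K.X (n - 1), U), (K.d (n - 1) n).sec U y = z := by
  obtain ⟨m, y, -, hy⟩ := killsClasses_of_isAffineOpen (f := (1 : Γ(X, U))) (D := ⊥) (V := U) hK
    (fun V hVU hV _ n z hz _ => by
      obtain ⟨c, rfl⟩ := exists_iCycles_sec_eq rfl z hz
      obtain ⟨y, hy⟩ := hS n V hV _ ((homologyπ_sec_eq_zero_iff (by simp) c).1 (h n V hVU _ _))
      exact ⟨0, y, eq_of_res_eq _ _ fun _ hx => hx.2.elim, by rw [hy, pow_zero, one_smul]⟩)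
    le_rfl n z hz (eq_of_res_eq _ _ fun _ hx => hx.2.elim)
  exact ⟨y, by rw [hy, map_one, one_pow, one_smul]⟩

lemma exists_smul_d_eq_of_killsClasses (hK : ∀ n, IsFlasque (K.X n)) {f : Γ(X, V)}
    (hD : KillsClasses K f (X.basicOpen f) V) {z : Γ(K.X n, V)}
    (hz : (K.d n (n + 1)).sec V z = 0) (w : Γ(K.X (n - 1), X.basicOpen f))
    (hw : (K.d (n - 1) n).sec _ w = (K.X n).res (X.basicOpen_le f) z) :
    ∃ (m : ℕ) (y : Γ(K.X (n - 1), V)), (K.d (n - 1) n).sec V y = f ^ m • z := by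
  obtain ⟨w, rfl⟩ := hK _ (X.basicOpen_le f) w
  rw [← Hom.res_sec] at hw
  obtain ⟨m, y, -, hy⟩ := hD le_rfl n (z - (K.d _ _).sec _ w)
    (by rw [map_sub, hz, d_sec_d_sec, sub_zero]) (by
      have := congr_arg ((K.X n).res (inf_le_right : V ⊓ X.basicOpen f ≤ _)) hw
      rw [res_res, res_res] at this
      rw [map_sub, this, sub_self])
  refine ⟨m, y + f ^ m • w, ?_⟩
  rw [map_add, hy, Hom.sec_smul, rres_self, smul_sub, sub_add_cancel]

lemma KillsClasses.exists_d_eq {f : Γ(X, U)} {D : X.Opens} (hD : KillsClasses K f D V)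
    (h : V ≤ U) (hij : i + 1 = j) (z : Γ(K.X j, V)) (hz : (K.d j (j + 1)).sec V z = 0)
    (hzD : (K.X j).res (inf_le_left : V ⊓ D ≤ V) z = 0) :
    ∃ (m : ℕ) (y : Γ(K.X i, V)), (K.X i).res (inf_le_left : V ⊓ D ≤ V) y = 0 ∧
      (K.d i j).sec V y = X.rres h f ^ m • z := by
  obtain rfl : i = j - 1 := by lia
  exact hD h j z hz hzD

lemma exists_res_eq_smul_of_killsClasses (hK : ∀ n, IsFlasque (K.X n)) {f : Γ(X, V)}
    (hD : KillsClasses K f (X.basicOpen f) V) (z : Γ(K.X n, X.basicOpen f))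
    (hz : (K.d n (n + 1)).sec _ z = 0) :
    ∃ (m : ℕ) (z' : Γ(K.X n, V)), (K.d n (n + 1)).sec V z' = 0 ∧
      (K.X n).res (X.basicOpen_le f) z' = X.rres (X.basicOpen_le f) f ^ m • z := by
  obtain ⟨z, rfl⟩ := hK _ (X.basicOpen_le f) z
  rw [← Hom.res_sec] at hz
  obtain ⟨m, y, hyD, hy⟩ := hD.exists_d_eq le_rfl rfl ((K.d n (n + 1)).sec _ z) (d_sec_d_sec _)
    (by
      have := congr_arg ((K.X _).res (inf_le_right : V ⊓ X.basicOpen f ≤ _)) hz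
      rwa [res_res, map_zero] at this)
  refine ⟨m, f ^ m • z - y, ?_, ?_⟩
  · rw [map_sub, hy, Hom.sec_smul, rres_self, sub_self]
  · have := congr_arg ((K.X _).res (le_inf (X.basicOpen_le f) le_rfl)) hyD
    rw [res_res, map_zero] at this
    rw [map_sub, this, sub_zero, res_smul, map_pow]

/-- The functions `f` for which `f • z` is a boundary form an ideal, and the basic opens of its
elements cover `V`. -/
lemma liftsBoundaries_of_killsClasses (hK : ∀ n, IsFlasque (K.X n))
    (hD : ∀ f : Γ(X, V), KillsClasses K f (X.basicOpen f) V) (hV : IsAffineOpen V) :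
    LiftsBoundaries K n V := by
  intro z hz
  let I : Ideal Γ(X, V) :=
    { carrier := {f | ∃ y : Γ(K.X (n - 1), V), (K.d (n - 1) n).sec V y = f • z}
      zero_mem' := ⟨0, by rw [map_zero, zero_smul]⟩
      add_mem' := by
        rintro f g ⟨y, hy⟩ ⟨y', hy'⟩
        exact ⟨y + y', by rw [map_add, hy, hy', add_smul]⟩
      smul_mem' := by
        rintro a f ⟨y, hy⟩
        exact ⟨a • y, by rw [Hom.sec_smul, hy, smul_smul, smul_eq_mul]⟩ }
  have hI : I = ⊤ := by
    rw [← Ideal.span_eq I, ← hV.iSup_basicOpen_eq_self_iff]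
    refine le_antisymm (iSup_le fun f => X.basicOpen_le _) fun x hx => ?_
    obtain ⟨W, hW, hxW, w, hw⟩ := hz x hx
    obtain ⟨g, hg, hxg⟩ := hV.exists_basicOpen_le ⟨x, hxW⟩ hx
    obtain ⟨m, y, hy⟩ := exists_smul_d_eq_of_killsClasses hK (hD g) hz.d_eq_zero
      ((K.X _).res hg w) (by rw [← Hom.res_sec, hw, res_res])
    refine Opens.mem_iSup.2 ⟨⟨g ^ (m + 1), g • y, by
      rw [Hom.sec_smul, hy, smul_smul, pow_succ']⟩, ?_⟩
    rw [X.basicOpen_pow _ (Nat.succ_pos m)]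
    exact hxg
  obtain ⟨y, hy⟩ : (1 : Γ(X, V)) ∈ I := hI ▸ Submodule.mem_top
  exact ⟨y, by rw [hy, one_smul]⟩

/-- This converse of `killsClasses_basicOpen` makes no prior assumption on the cohomology; applied
to `j_* J` it proves that `Rj_*` preserves quasi-coherent cohomology. -/
lemma hasLocalizedSections_homology_of_killsClasses (hK : ∀ n, IsFlasque (K.X n))
    (hD : ∀ V, IsAffineOpen V → ∀ f : Γ(X, V), KillsClasses K f (X.basicOpen f) V) (n : ℤ) :
    HasLocalizedSections (K.homology n) := by
  have hS : ∀ n V, IsAffineOpen V → LiftsBoundaries K n V := fun n V hV =>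
    liftsBoundaries_of_killsClasses hK (hD V hV) hV
  have hT : ∀ V, IsAffineOpen V → LiftsClasses K n V :=
    liftsClasses_of_liftsBoundaries hK (hS n)
  constructor
  · intro V hV f s hs
    obtain ⟨c, rfl⟩ := hT V hV s
    rw [Hom.res_sec, homologyπ_sec_eq_zero_iff (i := n - 1) (by simp), ← Hom.res_sec] at hs
    obtain ⟨w, hw⟩ := hS n _ (hV.basicOpen f) _ hs
    obtain ⟨m, y, hy⟩ := exists_smul_d_eq_of_killsClasses hK (hD V hV f)
      (d_sec_iCycles_sec c) w hw
    refine ⟨m, ?_⟩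
    rw [← Hom.sec_smul, homologyπ_sec_eq_zero_iff (i := n - 1) (by simp), Hom.sec_smul, ← hy]
    exact isLocalBoundary_d y
  · intro V hV f s
    obtain ⟨c, rfl⟩ := hT _ (hV.basicOpen f) s
    obtain ⟨m, z, hz, hzf⟩ := exists_res_eq_smul_of_killsClasses hK (hD V hV f)
      ((K.iCycles n).sec _ c) (d_sec_iCycles_sec c)
    obtain ⟨c', rfl⟩ := exists_iCycles_sec_eq rfl z hz
    refine ⟨m, (K.homologyπ n).sec V c', ?_⟩
    rw [Hom.res_sec, ← Hom.sec_smul]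
    congr 1
    apply sec_injective (K.iCycles n)
    rw [← Hom.res_sec, hzf, Hom.sec_smul]

end AlgebraicGeometry.Scheme.Modules

/-! ### Torsion in complexes of injective modules over Noetherian rings -/

section Torsion

variable {A : Type*} [CommRing A] {N : Type*} [AddCommGroup N] [Module A N]

/-- The element `x` is killed by a power of the ideal `a`. -/
def Ideal.IsTorsionElement (a : Ideal A) (x : N) : Prop :=
  ∃ m : ℕ, ∀ r ∈ a ^ m, r • x = 0

lemma Ideal.isTorsionElement_bot (x : N) : (⊥ : Ideal A).IsTorsionElement x :=
  ⟨1, fun r hr => by rw [pow_one, Submodule.mem_bot] at hr; rw [hr, zero_smul]⟩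

lemma Ideal.isTorsionElement_span_singleton {g : A} {m : ℕ} {x : N} (h : g ^ m • x = 0) :
    (Ideal.span {g}).IsTorsionElement x := by
  refine ⟨m, fun r hr => ?_⟩
  rw [Ideal.span_singleton_pow, Ideal.mem_span_singleton'] at hr
  obtain ⟨r, rfl⟩ := hr
  rw [mul_smul, h, smul_zero]

namespace Ideal.IsTorsionElement

variable {a b : Ideal A} {x y : N}

lemma mono (h : b ≤ a) (hx : a.IsTorsionElement x) : b.IsTorsionElement x := by
  obtain ⟨m, hm⟩ := hx
  exact ⟨m, fun r hr => hm r (Ideal.pow_right_mono h m hr)⟩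

lemma sub (hx : a.IsTorsionElement x) (hy : a.IsTorsionElement y) :
    a.IsTorsionElement (x - y) := by
  obtain ⟨m, hm⟩ := hx
  obtain ⟨l, hl⟩ := hy
  refine ⟨m + l, fun r hr => ?_⟩
  rw [smul_sub, hm r (Ideal.pow_le_pow_right (Nat.le_add_right _ _) hr),
    hl r (Ideal.pow_le_pow_right (Nat.le_add_left _ _) hr), sub_zero]

lemma smul (hx : a.IsTorsionElement x) (r : A) : a.IsTorsionElement (r • x) := by
  obtain ⟨m, hm⟩ := hx
  exact ⟨m, fun s hs => by rw [smul_comm, hm s hs, smul_zero]⟩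

lemma map {N' : Type*} [AddCommGroup N'] [Module A N'] (hx : a.IsTorsionElement x)
    (φ : N →ₗ[A] N') : a.IsTorsionElement (φ x) := by
  obtain ⟨m, hm⟩ := hx
  exact ⟨m, fun s hs => by rw [← map_smul, hm s hs, map_zero]⟩

lemma sup (hx : a.IsTorsionElement x) (hx' : b.IsTorsionElement x) :
    (a ⊔ b).IsTorsionElement x := by
  obtain ⟨m, hm⟩ := hx
  obtain ⟨l, hl⟩ := hx'
  refine ⟨m + l, fun r hr => ?_⟩
  obtain ⟨s, hs, t, ht, rfl⟩ := Submodule.mem_sup.1 (Ideal.sup_pow_add_le_pow_sup_pow hr)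
  rw [add_smul, hm s hs, hl t ht, add_zero]

end Ideal.IsTorsionElement

/-- Divisibility of the torsion part of an injective module: a map defined on `b ^ m + (g ^ (e +
s))`, zero on the first ideal and with value `g ^ s • y` on the generator of the second, extends to
the ring, and `w` is the image of 1. -/
lemma Module.Baer.exists_pow_smul_eq [IsNoetherianRing A] (hN : Module.Baer A N) {b : Ideal A}
    {y : N} (hy : b.IsTorsionElement y) (g : A) (e : ℕ) :
    ∃ (s : ℕ) (w : N), b.IsTorsionElement w ∧ g ^ (e + s) • w = g ^ s • y := by
  obtain ⟨m, hm⟩ := hy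
  -- The ascending chain of ideals `(b ^ m : g ^ k)` stabilizes. This makes the two partial maps
  -- agree on the intersection of their domains.
  obtain ⟨s, hs⟩ : ∃ s : ℕ, ∀ r : A, r * g ^ (e + s) ∈ b ^ m → r * g ^ s ∈ b ^ m := by
    let c : ℕ →o Ideal A :=
      { toFun k :=
          { carrier := {r | r * g ^ k ∈ b ^ m}
            zero_mem' := by simp
            add_mem' := fun {r r'} hr hr' => by
              simpa only [Set.mem_ofPred_eq, add_mul] using add_mem hr hr'
            smul_mem' := fun a r hr => by
              simpa only [Set.mem_ofPred_eq, smul_eq_mul, mul_assoc] using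
                Ideal.mul_mem_left _ a hr }
        monotone' := fun k l hkl r (hr : r * g ^ k ∈ b ^ m) => by
          change r * g ^ l ∈ b ^ m
          rw [← Nat.sub_add_cancel hkl, add_comm, pow_add, ← mul_assoc]
          exact Ideal.mul_mem_right _ _ hr }
    obtain ⟨s, hs⟩ := monotone_stabilizes_iff_noetherian.2 ‹IsNoetherianRing A› c
    exact ⟨s, fun r hr => (hs (e + s) (Nat.le_add_left _ _)).ge hr⟩
  let φ : A →ₗ.[A] N := ⟨b ^ m, 0⟩
  let ψ : A →ₗ.[A] N := LinearPMap.mkSpanSingleton' (g ^ (e + s)) (g ^ s • y) (fun r hr => by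
    rw [RingHom.id_apply, smul_smul]
    exact hm _ (hs r (by rw [← smul_eq_mul, hr]; exact zero_mem _)))
  have hψ : ∀ (r : A) (h : r • g ^ (e + s) ∈ ψ.domain), ψ ⟨r • g ^ (e + s), h⟩ = r • g ^ s • y :=
    fun r h => LinearPMap.mkSpanSingleton'_apply (σ := RingHom.id A) _ _ _ r h
  have hφψ : ∀ (x : φ.domain) (z : ψ.domain), (x : A) = z → φ x = ψ z := by
    rintro ⟨x, hx⟩ ⟨z, hz⟩ (rfl : x = z)
    obtain ⟨r, rfl⟩ := Submodule.mem_span_singleton.1 hz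
    rw [hψ, smul_smul, hm _ (hs r hx)]
    rfl
  obtain ⟨θ, hθ⟩ := hN _ (φ.sup ψ hφψ).toFun
  have h₁ : ∀ r ∈ b ^ m, θ r = 0 := fun r hr =>
    (hθ r (Submodule.mem_sup_left hr)).trans
      ((φ.left_le_sup ψ hφψ).2 (x := ⟨r, hr⟩) (y := ⟨r, Submodule.mem_sup_left hr⟩) rfl).symm
  have h₂ : θ (g ^ (e + s)) = g ^ s • y := by
    have hg : (1 : A) • g ^ (e + s) ∈ ψ.domain := by
      rw [one_smul]
      exact Submodule.mem_span_singleton_self _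
    have h := ((φ.right_le_sup ψ hφψ).2 (x := ⟨_, hg⟩) (y := ⟨_, Submodule.mem_sup_right hg⟩)
      rfl).symm.trans (hψ 1 hg)
    have h' := (hθ _ (Submodule.mem_sup_right hg)).trans h
    rwa [one_smul, one_smul] at h'
  have h₃ : ∀ r : A, θ r = r • θ 1 := fun r => by rw [← map_smul, smul_eq_mul, mul_one]
  exact ⟨s, θ 1, ⟨m, fun r hr => by rw [← h₃, h₁ r hr]⟩, by rw [← h₃, h₂]⟩

/-- In a complex of injective modules over a Noetherian ring whose cohomology is torsion, the
elements with torsion differential are torsion up to boundaries. -/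
lemma exists_isTorsionElement_sub [IsNoetherianRing A] {N : ℤ → Type*}
    [∀ n, AddCommGroup (N n)] [∀ n, Module A (N n)] (d : ∀ i j, N i →ₗ[A] N j)
    (hd : ∀ i j k, i + 1 = j → j + 1 = k → ∀ x, d j k (d i j x) = 0)
    (hN : ∀ n, Module.Baer A (N n)) (a : Ideal A)
    (ha : ∀ g ∈ a, ∀ i j k, i + 1 = j → j + 1 = k → ∀ z, d j k z = 0 →
      ∃ (m : ℕ) (y : N i), d i j y = g ^ m • z)
    {i j k : ℤ} (hij : i + 1 = j) (hjk : j + 1 = k) (z : N j)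
    (hz : a.IsTorsionElement (d j k z)) :
    ∃ w : N i, a.IsTorsionElement (z - d i j w) := by
  suffices H : ∀ T : Finset A, (∀ g ∈ T, g ∈ a) → ∀ i j k, i + 1 = j → j + 1 = k → ∀ z : N j,
      (Ideal.span (T : Set A)).IsTorsionElement (d j k z) →
      ∃ w : N i, (Ideal.span (T : Set A)).IsTorsionElement (z - d i j w) by
    obtain ⟨T, hT⟩ := IsNoetherian.noetherian a
    replace hT : Ideal.span (T : Set A) = a := hT
    rw [← hT] at hz ⊢
    exact H T (fun g hg => hT ▸ Ideal.subset_span hg) i j k hij hjk z hz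
  classical
  intro T
  induction T using Finset.induction_on with
  | empty =>
    intro _ i j k _ _ z _
    refine ⟨0, ?_⟩
    rw [Finset.coe_empty, Ideal.span_empty]
    exact Ideal.isTorsionElement_bot _
  | insert g T hg ih =>
    intro hT i j k hij hjk z hz
    replace ih := ih fun f hf => hT f (Finset.mem_insert_of_mem hf)
    rw [Finset.coe_insert, Ideal.span_insert] at hz ⊢
    -- Make `z` torsion for the old generators. Some power of `g` times the result is a cocycle, and
    -- a further power of `g` makes it a boundary `d y`.
    obtain ⟨w₁, hw₁⟩ := ih i j k hij hjk z (hz.mono le_sup_right)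
    obtain ⟨l, hl⟩ := hz.mono le_sup_left
    replace hl := hl (g ^ l) (Ideal.pow_mem_pow (Ideal.mem_span_singleton_self g) l)
    obtain ⟨m, y, hy⟩ := ha g (hT g (Finset.mem_insert_self _ _)) i j k hij hjk
      (g ^ l • (z - d i j w₁)) (by
        rw [map_smul, map_sub, hd i j k hij hjk, sub_zero, hl])
    rw [smul_smul, ← pow_add] at hy
    -- The induction hypothesis one degree lower makes `y` torsion up to a boundary. Dividing this
    -- torsion element by `g ^ (m + l)` yields a correction `w` that handles `g` without spoiling
    -- torsion for the old generators.
    obtain ⟨w₂, hw₂⟩ := ih (i - 1) i j (by lia) hij y (hy ▸ hw₁.smul _)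
    obtain ⟨s, w, hw, hw'⟩ := (hN i).exists_pow_smul_eq hw₂ g (m + l)
    refine ⟨w₁ + w, ?_⟩
    have e : z - d i j (w₁ + w) = z - d i j w₁ - d i j w := by rw [map_add]; abel
    rw [e]
    refine .sup (Ideal.isTorsionElement_span_singleton (m := m + l + s) ?_) (hw₁.sub (hw.map _))
    rw [smul_sub, ← map_smul, hw', map_smul, map_sub, hd (i - 1) i j (by lia) hij, sub_zero, hy,
      smul_smul, ← pow_add, add_comm s, sub_self]

end Torsion

/-! ### Mapping cones and reduction to power torsion cocycles. -/

namespace AlgebraicGeometry.Scheme.Modules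

open CochainComplex

variable {X : Scheme.{u}} {U V W : X.Opens} {i j k n : ℤ} {K L : CochainComplex X.Modules ℤ}

lemma injective_mappingCone_X (φ : K ⟶ L) (hK : ∀ n, Injective (K.X n))
    (hL : ∀ n, Injective (L.X n)) (n : ℤ) : Injective ((mappingCone φ).X n) where
  factors {A B} g f hf := by
    have := hK (n + 1)
    have := hL n
    refine ⟨Injective.factorThru (g ≫ (mappingCone.fst φ).1.v n (n + 1) rfl) f ≫
      (mappingCone.inl φ).v (n + 1) n (by lia) +
      Injective.factorThru (g ≫ (mappingCone.snd φ).v n n (add_zero n)) f ≫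
        (mappingCone.inr φ).f n, ?_⟩
    rw [Preadditive.comp_add, Injective.comp_factorThru_assoc, Injective.comp_factorThru_assoc,
      Category.assoc, Category.assoc, ← Preadditive.comp_add, mappingCone.id_X φ n (n + 1) rfl,
      Category.comp_id]

lemma smul_coneMk (φ : K ⟶ L) (hij : i + 1 = j) (r : Γ(X, U)) (z : Γ(K.X j, U))
    (p : Γ(L.X i, U)) : r • coneMk φ hij z p = coneMk φ hij (r • z) (r • p) := by
  simp only [coneMk, smul_add, Hom.sec_smul]

lemma coneMk_zero (φ : K ⟶ L) (hij : i + 1 = j) : coneMk φ hij (0 : Γ(K.X j, U)) 0 = 0 := by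
  simp [coneMk]

lemma coneMk_eq_zero {φ : K ⟶ L} (hij : i + 1 = j) {z : Γ(K.X j, U)} {p : Γ(L.X i, U)}
    (h : coneMk φ hij z p = 0) : z = 0 ∧ p = 0 :=
  coneMk_inj hij (h.trans (coneMk_zero φ hij).symm)

lemma KillsClasses.mappingCone (φ : K ⟶ L) {f : Γ(X, U)} {D : X.Opens}
    (hK : KillsClasses K f D V) (hL : KillsClasses L f D V) :
    KillsClasses (mappingCone φ) f D V := by
  intro h n c hc hcD
  obtain ⟨z, p, rfl⟩ := exists_coneMk_eq (j := n + 1) rfl c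
  rw [d_coneMk rfl rfl] at hc
  rw [res_coneMk] at hcD
  obtain ⟨hz, hzp⟩ := coneMk_eq_zero _ hc
  obtain ⟨hzD, hpD⟩ := coneMk_eq_zero _ hcD
  rw [neg_eq_zero] at hz
  obtain ⟨m, y, hyD, hy⟩ := hK.exists_d_eq h rfl z hz hzD
  obtain ⟨l, q, hqD, hq⟩ := hL h n (X.rres h f ^ m • p + (φ.f n).sec V y)
    (by
      rw [map_add, ← f_sec_d_sec, hy, Hom.sec_smul, Hom.sec_smul, ← smul_add,
        add_comm ((L.d _ _).sec _ _), hzp, smul_zero])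
    (by rw [map_add, Hom.res_sec, hyD, map_zero, res_smul, hpD, smul_zero, add_zero])
  refine ⟨l + m, coneMk φ (by simp) (-(X.rres h f ^ l • y)) q, ?_, ?_⟩
  · rw [res_coneMk, map_neg, res_smul, hyD, hqD, smul_zero, neg_zero, coneMk_zero]
  · rw [d_coneMk _ rfl, smul_coneMk, map_neg, map_neg, neg_neg, Hom.sec_smul, hy, hq, smul_add,
      Hom.sec_smul, smul_smul, smul_smul, ← pow_add, add_comm (X.rres h f ^ (l + m) • p),
      neg_add_cancel_left]

lemma isLocalBoundary_mappingCone (φ : K ⟶ L) [QuasiIso φ] (c : Γ((mappingCone φ).X n, U))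
    (hc : ((mappingCone φ).d n (n + 1)).sec U c = 0) :
    IsLocalBoundary (mappingCone φ) (n - 1) n c := by
  intro x hx
  obtain ⟨z, p, rfl⟩ := exists_coneMk_eq (j := n + 1) rfl c
  rw [d_coneMk rfl rfl] at hc
  obtain ⟨hz, hzp⟩ := coneMk_eq_zero _ hc
  rw [neg_eq_zero] at hz
  have hz' : IsLocalBoundary K n (n + 1) z := by
    have := IsLocalBoundary.of_map φ hz (by
      rw [eq_neg_of_add_eq_zero_left hzp, add_sub_cancel_right]
      exact (isLocalBoundary_d p).neg)
    rwa [add_sub_cancel_right] at this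
  obtain ⟨V, h, hxV, y, hy⟩ := hz' x hx
  obtain ⟨V', h', hxV', y', hy', hpy⟩ := exists_isLocalBoundary_sub_of_mem φ
    ((L.X n).res h p + (φ.f n).sec V y)
    (by rw [map_add, ← f_sec_d_sec, hy, ← Hom.res_sec, ← Hom.res_sec, ← map_add,
      add_comm ((L.d _ _).sec _ _), hzp, map_zero]) hxV
  obtain ⟨T, hT, hxT, q, hq⟩ := hpy x hxV'
  refine ⟨T, hT.trans (h'.trans h), hxT,
    coneMk φ (by simp) ((K.X n).res hT y' - (K.X n).res (hT.trans h') y) (-q), ?_⟩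
  rw [d_coneMk _ rfl, res_coneMk, map_sub, ← Hom.res_sec _ _ y', hy', map_zero,
    ← Hom.res_sec _ _ y, hy, res_res, zero_sub,
    neg_neg, map_neg, hq, map_sub, map_sub, map_add, map_add, res_res, Hom.res_sec, Hom.res_sec,
    Hom.res_sec, res_res, res_res]
  congr 1
  abel

lemma quasiIso_of_isLocalBoundary_mappingCone (φ : K ⟶ L)
    (h : ∀ (n : ℤ) (U : X.Opens) (c : Γ((mappingCone φ).X n, U)),
      ((mappingCone φ).d n (n + 1)).sec U c = 0 → IsLocalBoundary (mappingCone φ) (n - 1) n c) :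
    QuasiIso φ := by
  have h' : ∀ (i j k : ℤ), i + 1 = j → j + 1 = k → ∀ (U : X.Opens) (c : Γ((mappingCone φ).X j, U)),
      ((mappingCone φ).d j k).sec U c = 0 → IsLocalBoundary (mappingCone φ) i j c := by
    intro i j k hij hjk
    obtain rfl : i = j - 1 := by lia
    obtain rfl := hjk
    exact h j
  refine quasiIso_of_sections _ (fun n U z hz hFz x hx => ?_) (fun n U y hy x hx => ?_)
  · have e : n - 1 + 1 = n := by simp
    obtain ⟨V, hV, hxV, p, hp⟩ := hFz x hx
    obtain ⟨T, hT, hxT, c, hc⟩ := h' (n - 2) (n - 1) n (by lia) e V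
      (coneMk φ e ((K.X n).res hV z) (-p)) (by
        rw [d_coneMk _ rfl, ← Hom.res_sec, hz, map_zero, neg_zero, map_neg, hp, Hom.res_sec,
          add_neg_cancel, coneMk_zero]) x hxV
    obtain ⟨y, q, rfl⟩ := exists_coneMk_eq (j := n - 1) (by lia) c
    rw [d_coneMk _ e, res_coneMk, res_res] at hc
    exact ⟨T, hT.trans hV, hxT, -y, by rw [map_neg, (coneMk_inj _ hc).1]⟩
  · obtain ⟨V, hV, hxV, c, hc⟩ := h' (n - 1) n (n + 1) (by simp) rfl U (coneMk φ rfl 0 y) (by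
      rw [d_coneMk _ rfl, hy, map_zero, map_zero, neg_zero, add_zero, coneMk_zero]) x hx
    obtain ⟨z, q, rfl⟩ := exists_coneMk_eq (j := n) (by simp) c
    rw [d_coneMk _ rfl, res_coneMk, map_zero] at hc
    obtain ⟨hz, hzq⟩ := coneMk_inj _ hc
    rw [neg_eq_zero] at hz
    refine ⟨V, hV, hxV, z, hz, ?_⟩
    rw [← hzq, sub_add_cancel_left]
    exact (isLocalBoundary_d q).neg

lemma baer_sections (J : X.Modules) [Injective J] (hU : IsAffineOpen U) :
    Module.Baer Γ(X, U) Γ(J, U) := by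
  intro K φ
  obtain ⟨t, ht⟩ := exists_smul_eq_of_isAffineOpen J hU K φ
  exact ⟨LinearMap.toSpanSingleton _ _ t, fun r hr => ht ⟨r, hr⟩⟩

/-- The map on sections as a linear map. -/
noncomputable def Hom.secLinear {M N : X.Modules} (φ : M ⟶ N) (U : X.Opens) :
    Γ(M, U) →ₗ[Γ(X, U)] Γ(N, U) where
  toFun := φ.sec U
  map_add' := map_add _
  map_smul' r s := Hom.sec_smul φ r s

lemma isPowerTorsion_of_isTorsionElement (I : X.IdealSheafData) {M : X.Modules} (hU : IsAffineOpen U)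
    {s : Γ(M, U)} (hs : (I.ideal ⟨U, hU⟩).IsTorsionElement s) : IsPowerTorsion I s := by
  obtain ⟨m, hm⟩ := hs
  refine fun x hx => ⟨U, le_rfl, m, hx, ?_⟩
  intro W hW f hf
  rw [← I.map_ideal (V := ⟨U, hU⟩) (U := W) hW, ← Ideal.map_pow] at hf
  change f • M.res hW (M.res le_rfl s) = 0
  rw [res_self]
  induction hf using Submodule.span_induction with
  | mem f hf =>
    obtain ⟨r, hr, rfl⟩ := hf
    have := congr_arg (M.res hW) (hm r hr)
    rw [res_smul, map_zero] at this
    exact this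
  | zero => rw [zero_smul]
  | add f g _ _ hf hg => rw [add_smul, hf, hg, add_zero]
  | smul a f _ hf => rw [smul_eq_mul, mul_smul, hf, smul_zero]

/-- For `g` in the ideal, `D(g)` misses the support of `I`, so cocycles are local boundaries there,
hence boundaries, and a power of `g` makes the primitive extend to `U`. This is the hypothesis of
the algebraic lemma `exists_isTorsionElement_sub`. -/
lemma exists_isPowerTorsion_sub [IsNoetherian X] (I : X.IdealSheafData)
    (hK : ∀ n, Injective (K.X n))
    (hD : ∀ V, IsAffineOpen V → ∀ f : Γ(X, V), KillsClasses K f (X.basicOpen f) V)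
    (hI : ∀ (n : ℤ) (V : X.Opens), (∀ x ∈ V, x ∉ I.support) → ∀ c : Γ(K.X n, V),
      (K.d n (n + 1)).sec V c = 0 → IsLocalBoundary K (n - 1) n c)
    (hU : IsAffineOpen U) (c : Γ(K.X n, U)) (hc : (K.d n (n + 1)).sec U c = 0) :
    ∃ w : Γ(K.X (n - 1), U), IsPowerTorsion I (c - (K.d (n - 1) n).sec U w) := by
  have hK' : ∀ n, IsFlasque (K.X n) := fun n => isFlasque_of_injective _
  have : IsNoetherianRing Γ(X, U) := IsLocallyNoetherian.component_noetherian ⟨U, hU⟩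
  obtain ⟨w, hw⟩ := exists_isTorsionElement_sub (fun i j => (K.d i j).secLinear U)
    (fun i j k _ _ x => d_sec_d_sec x) (fun n => baer_sections _ hU) (I.ideal ⟨U, hU⟩)
    (by
      intro g hg i j k hij hjk z hz
      obtain rfl : i = j - 1 := by lia
      obtain rfl := hjk
      obtain ⟨w, hw⟩ := liftsBoundaries_of_killsClasses hK' (hD _ (hU.basicOpen g))
        (hU.basicOpen g) _ (hI j (X.basicOpen g) (fun x hx hxI => by
          have : x ∈ X.zeroLocus (U := U) (I.ideal ⟨U, hU⟩) :=
            I.supportSet_subset_zeroLocus ⟨U, hU⟩ hxI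
          exact (X.mem_zeroLocus_iff _ _).1 this g hg hx)
          ((K.X j).res (X.basicOpen_le g) z) (by
            rw [← Hom.res_sec]
            exact (congr_arg _ hz).trans (map_zero _)))
      exact exists_smul_d_eq_of_killsClasses hK' (hD U hU g) hz w hw)
    (i := n - 1) (by simp) rfl c
    ⟨0, fun r _ => by
      rw [show (K.d n (n + 1)).secLinear U c = 0 from hc, smul_zero]⟩
  exact ⟨w, isPowerTorsion_of_isTorsionElement I hU hw⟩

end AlgebraicGeometry.Scheme.Modules

/-! ### Complexes of sheaves and open immersions -/

namespace AlgebraicGeometry.Scheme.Modules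

open CochainComplex

variable {X Y : Scheme.{u}} (j : X ⟶ Y) {n : ℤ}

section Pushforward

variable {K : CochainComplex X.Modules ℤ}

/-- The direct image of a complex of sheaves of modules. -/
noncomputable abbrev pushforwardComplex (K : CochainComplex X.Modules ℤ) :
    CochainComplex Y.Modules ℤ :=
  ((pushforward j).mapHomologicalComplex (ComplexShape.up ℤ)).obj K

lemma KillsClasses.pushforward {U : Y.Opens} {f : Γ(Y, U)} {D V : Y.Opens}
    (H : KillsClasses K (j.app U f) (j ⁻¹ᵁ D) (j ⁻¹ᵁ V)) :
    KillsClasses (pushforwardComplex j K) f D V := by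
  intro h n (z : Γ(K.X n, j ⁻¹ᵁ V)) hz hzD
  obtain ⟨m, y, hyD, hy⟩ := H (j.preimage_mono h) n z hz hzD
  refine ⟨m, y, hyD, hy.trans ?_⟩
  have e : X.rres (j.preimage_mono h) (j.app U f) = j.app V (Y.rres h f) :=
    (ConcreteCategory.congr_hom (j.naturality (homOfLE h).op) f).symm
  rw [e, ← map_pow]
  rfl

/-- Sections of the direct image over `V` are sections over the preimage of `V`, which need not be
affine even if `V` is; hence the extension of `KillsClasses` to arbitrary opens. -/
lemma killsClasses_pushforward_basicOpen [IsNoetherian X] [K.IsKInjective]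
    (hK : ∀ n, IsFlasque (K.X n)) (hH : ∀ n, HasLocalizedSections (K.homology n))
    {U : Y.Opens} (f : Γ(Y, U)) (V : Y.Opens) :
    KillsClasses (pushforwardComplex j K) f (Y.basicOpen f) V := by
  refine .pushforward j ?_
  rw [Scheme.preimage_basicOpen]
  exact killsClasses_of_isAffineOpen hK fun V _ hV => killsClasses_basicOpen hK hH
    (fun n _ hV => liftsBoundaries_of_isKInjective hH n hV)
    (fun n _ hV => liftsClasses_of_isKInjective hH n hV) _ hV

lemma exists_d_eq_pushforward [IsNoetherian X] [K.IsKInjective] (hK : ∀ n, IsFlasque (K.X n))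
    (hH : ∀ n, HasLocalizedSections (K.homology n)) {U : Y.Opens}
    (h : ∀ (n : ℤ) (V : X.Opens), V ≤ j ⁻¹ᵁ U → ∀ s t : Γ(K.homology n, V), s = t)
    (z : Γ((pushforwardComplex j K).X n, U)) (hz : ((pushforwardComplex j K).d n (n + 1)).sec U z = 0) :
    ∃ y : Γ((pushforwardComplex j K).X (n - 1), U),
      ((pushforwardComplex j K).d (n - 1) n).sec U y = z :=
  exists_d_eq_of_isAcyclic (U := j ⁻¹ᵁ U) hK
    (fun n _ hV => liftsBoundaries_of_isKInjective hH n hV) h z hz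

/-- Near a point of the image of `j` the ideal is the unit ideal, and a section killed by a power of
it is zero. -/
lemma eq_zero_of_isPowerTorsion_pushforward (I : Y.IdealSheafData)
    (hI : ∀ x : X, j x ∉ I.support) {M : X.Modules} {U : Y.Opens}
    (s : Γ((Scheme.Modules.pushforward j).obj M, U)) (hs : IsPowerTorsion I s) : s = 0 := by
  refine eq_of_res_eq (M := M) (U := j ⁻¹ᵁ U) _ _ fun x hx => ?_
  obtain ⟨V, hV, n, hxV, H⟩ := hs (j x) hx
  obtain ⟨W, hWV, hxW, hW⟩ := exists_affine_le (U := V ⊓ I.support.compl) (x := j x) ⟨hxV, hI x⟩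
  have htop : I.ideal ⟨W, hW⟩ = ⊤ := by
    rw [← Ideal.span_eq (I.ideal ⟨W, hW⟩), ← hW.iSup_basicOpen_eq_self_iff]
    refine le_antisymm (iSup_le fun f => Y.basicOpen_le _) fun y hy => ?_
    by_contra hy'
    refine (hWV hy).2 (I.zeroLocus_inter_subset_supportSet ⟨W, hW⟩ ⟨?_, hy⟩)
    rw [Y.mem_zeroLocus_iff]
    exact fun f hf hyf => hy' (Opens.mem_iSup.2 ⟨⟨f, hf⟩, hyf⟩)
  have h₁ := H ⟨W, hW⟩ (hWV.trans inf_le_left) 1 (by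
    rw [htop, Ideal.top_pow]
    exact Submodule.mem_top)
  rw [one_smul, map_map_apply] at h₁
  exact ⟨j ⁻¹ᵁ W, j.preimage_mono (hWV.trans (inf_le_left.trans hV)), hxW,
    h₁.trans (map_zero (M.res _)).symm⟩

end Pushforward

section Gamma

variable (I : Y.IdealSheafData)

lemma exists_d_eq_of_isPowerTorsion {K : CochainComplex Y.Modules ℤ}
    (hK : (((gamma I).mapHomologicalComplex (ComplexShape.up ℤ)).obj K).Acyclic)
    {i k : ℤ} (hik : i + 1 = k) {U : Y.Opens} {z : Γ(K.X k, U)}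
    (hz : (K.d k (k + 1)).sec U z = 0) (hzI : IsPowerTorsion I z) {x : Y} (hx : x ∈ U) :
    ∃ (V : Y.Opens) (h : V ≤ U), x ∈ V ∧ ∃ y : Γ(K.X i, V), IsPowerTorsion I y ∧
      (K.d i k).sec V y = (K.X k).res h z := by
  obtain rfl : i = k - 1 := by lia
  obtain ⟨V, h, hxV, y, hy⟩ := acyclic_iff_isLocalBoundary.1 hK k U ⟨z, hzI⟩ (Subtype.ext hz) x hx
  exact ⟨V, h, hxV, y.1, y.2, congr_arg Subtype.val hy⟩

end Gamma

section Restrict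

variable [IsOpenImmersion j]

/-- The restriction of a complex of sheaves of modules to an open subscheme. -/
noncomputable abbrev restrictComplex (K : CochainComplex Y.Modules ℤ) :
    CochainComplex X.Modules ℤ :=
  ((restrictFunctor j).mapHomologicalComplex (ComplexShape.up ℤ)).obj K

/-- Restriction to an open subscheme commutes with cohomology sheaves. -/
noncomputable def homologyRestrictIso (K : CochainComplex Y.Modules ℤ) (n : ℤ) :
    (restrictComplex j K).homology n ≅ (K.homology n).restrict j :=
  (K.sc n).mapHomologyIso (restrictFunctor j)

lemma HasLocalizedSections.restrict {M : Y.Modules} (h : HasLocalizedSections M) :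
    HasLocalizedSections (M.restrict j) := by
  have := h.isQuasicoherent
  have : (M.restrict j).IsQuasicoherent := isQuasicoherent_restrictFunctor _ _
  exact hasLocalizedSections_of_isQuasicoherent _

lemma isLocalBoundary_of_acyclic_restrict {K : CochainComplex Y.Modules ℤ}
    (hK : (restrictComplex j K).Acyclic) {U : Y.Opens} (hU : U ≤ j.opensRange) (z : Γ(K.X n, U))
    (hz : (K.d n (n + 1)).sec U z = 0) : IsLocalBoundary K (n - 1) n z := by
  have e : j ''ᵁ (j ⁻¹ᵁ U) = U := by
    rw [j.image_preimage_eq_opensRange_inf]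
    exact inf_eq_right.2 hU
  intro x hx
  obtain ⟨x, rfl⟩ := hU hx
  obtain ⟨V, h, hxV, y, hy⟩ := acyclic_iff_isLocalBoundary.1 hK n (j ⁻¹ᵁ U)
    ((K.X n).res e.le z) (by
      refine (Hom.res_sec (K.d n (n + 1)) e.le z).symm.trans ?_
      rw [hz]
      exact map_zero _) x hx
  refine ⟨j ''ᵁ V, (j.image_mono h).trans e.le, ⟨x, hxV, rfl⟩, y, ?_⟩
  refine hy.trans ?_
  exact res_res (M := K.X n) _ _ z

end Restrict

end AlgebraicGeometry.Scheme.Modules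

lemma CochainComplex.IsAcyclicFibrant.map_of_adjunction {A B : Type*} [Category* A] [Category* B]
    [Abelian A] [Abelian B] {G : B ⥤ A} [G.Additive] {F : A ⥤ B} [F.Additive]
    [PreservesFiniteLimits G] [PreservesFiniteColimits G] (adj : G ⊣ F) {J : CochainComplex A ℤ}
    (hJ : IsAcyclicFibrant J) :
    IsAcyclicFibrant ((F.mapHomologicalComplex (ComplexShape.up ℤ)).obj J) := by
  rintro K L i f ⟨h₁, h₂⟩
  let adj' := mapHomologicalComplexAdjunction adj (ComplexShape.up ℤ)
  obtain ⟨g, hg⟩ := hJ ((G.mapHomologicalComplex (ComplexShape.up ℤ)).map i)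
    ((adj'.homEquiv _ _).symm f) ⟨by
      have (n : ℤ) : Mono (((G.mapHomologicalComplex (ComplexShape.up ℤ)).map i).f n) :=
        inferInstanceAs (Mono (G.map (i.f n)))
      exact HomologicalComplex.mono_of_mono_f _ this, inferInstance⟩
  refine ⟨adj'.homEquiv _ _ g, ?_⟩
  rw [← adj'.homEquiv_naturality_left, hg, Equiv.apply_symm_apply]

/-! ### The comparison map from a complex to the direct image of its resolved restriction. -/

namespace AlgebraicGeometry.Scheme.Modules

open CochainComplex

section

variable {X : Scheme.{u}} {U V W : X.Opens} {i j k n : ℤ} {K L : CochainComplex X.Modules ℤ}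

lemma fst_coneMk (φ : K ⟶ L) (hij : i + 1 = j) (z : Γ(K.X j, U)) (p : Γ(L.X i, U)) :
    ((mappingCone.fst φ).1.v i j hij).sec U (coneMk φ hij z p) = z := by
  rw [coneMk, map_add, ← Hom.sec_comp, ← Hom.sec_comp, mappingCone.inl_v_fst_v,
    mappingCone.inr_f_fst_v, Hom.sec_id, Hom.sec_zero, add_zero]

lemma snd_coneMk (φ : K ⟶ L) (hij : i + 1 = j) (z : Γ(K.X j, U)) (p : Γ(L.X i, U)) :
    ((mappingCone.snd φ).v i i (add_zero i)).sec U (coneMk φ hij z p) = p := by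
  rw [coneMk, map_add, ← Hom.sec_comp, ← Hom.sec_comp, mappingCone.inl_v_snd_v,
    mappingCone.inr_f_snd_v, Hom.sec_id, Hom.sec_zero, zero_add]

lemma isLocalBoundary_mappingCone_of_exact (φ : K ⟶ L)
    (hK : ∀ (n : ℤ) (V : X.Opens), V ≤ U → ∀ z : Γ(K.X n, V), (K.d n (n + 1)).sec V z = 0 →
      IsLocalBoundary K (n - 1) n z)
    (hL : ∀ (n : ℤ) (V : X.Opens), V ≤ U → ∀ z : Γ(L.X n, V), (L.d n (n + 1)).sec V z = 0 →
      IsLocalBoundary L (n - 1) n z) (c : Γ((mappingCone φ).X n, U))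
    (hc : ((mappingCone φ).d n (n + 1)).sec U c = 0) :
    IsLocalBoundary (mappingCone φ) (n - 1) n c := by
  intro x hx
  obtain ⟨z, p, rfl⟩ := exists_coneMk_eq (j := n + 1) rfl c
  rw [d_coneMk rfl rfl] at hc
  obtain ⟨hz, hzp⟩ := coneMk_eq_zero _ hc
  rw [neg_eq_zero] at hz
  have hz' := hK (n + 1) U le_rfl z hz
  rw [add_sub_cancel_right] at hz'
  obtain ⟨V, h, hxV, y, hy⟩ := hz' x hx
  obtain ⟨T, hT, hxT, q, hq⟩ := hL n V h ((L.X n).res h p + (φ.f n).sec V y) (by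
    rw [map_add, ← f_sec_d_sec, hy, ← Hom.res_sec, ← Hom.res_sec, ← map_add,
      add_comm ((L.d _ _).sec _ _), hzp, map_zero]) x hxV
  refine ⟨T, hT.trans h, hxT, coneMk φ (by simp) (-(K.X n).res hT y) q, ?_⟩
  rw [d_coneMk _ rfl, res_coneMk, map_neg, map_neg, neg_neg, ← Hom.res_sec _ _ y, hy, res_res, hq,
    map_add, res_res, Hom.res_sec]
  congr 1
  abel

end

lemma preimage_compl_closure_le {X Y : Scheme.{u}} (j : X ⟶ Y) (Z : Closeds X) :
    j ⁻¹ᵁ (Closeds.closure (j '' Z)).compl ≤ Z.compl :=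
  fun x hx hx' => hx (subset_closure ⟨x, hx', rfl⟩)

variable {X Y : Scheme.{u}} (j : X ⟶ Y) [IsOpenImmersion j] {n : ℤ}

lemma disjoint_image_closure {Z : Closeds X} {V : X.Opens} (hV : V ≤ Z.compl) :
    j ''ᵁ V ≤ (Closeds.closure (j '' Z)).compl := by
  rintro _ ⟨x, hx, rfl⟩ hx'
  refine hV hx ?_
  have := j.isOpenEmbedding.isInducing.closure_eq_preimage_closure_image (Z : Set X)
  rw [Z.isClosed.closure_eq] at this
  rw [SetLike.mem_coe, ← SetLike.mem_coe, this]
  exact hx'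

/-- The adjunction between restriction and direct image of complexes. -/
noncomputable abbrev complexAdjunction :=
  mapHomologicalComplexAdjunction (restrictAdjunction j) (ComplexShape.up ℤ)

/-- The restriction of the adjoint map, followed by the counit, is `α`; the counit is a termwise
isomorphism because `j` is an open immersion. -/
lemma quasiIso_restrict_homEquiv {J : CochainComplex Y.Modules ℤ} {J' : CochainComplex X.Modules ℤ}
    (α : restrictComplex j J ⟶ J') [QuasiIso α] :
    QuasiIso (((restrictFunctor j).mapHomologicalComplex (ComplexShape.up ℤ)).map
      ((complexAdjunction j).homEquiv J J' α)) := by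
  have h : ((restrictFunctor j).mapHomologicalComplex (ComplexShape.up ℤ)).map
      ((complexAdjunction j).homEquiv J J' α) ≫ (complexAdjunction j).counit.app J' = α := by
    refine ((complexAdjunction j).homEquiv_counit _ _ _).symm.trans ?_
    exact Equiv.symm_apply_apply _ _
  have (n : ℤ) : IsIso (((complexAdjunction j).counit.app J').f n) :=
    inferInstanceAs (IsIso ((restrictAdjunction j).counit.app (J'.X n)))
  have : IsIso ((complexAdjunction j).counit.app J') :=
    HomologicalComplex.Hom.isIso_of_components _
  have h' : QuasiIso (((restrictFunctor j).mapHomologicalComplex (ComplexShape.up ℤ)).map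
      ((complexAdjunction j).homEquiv J J' α) ≫ (complexAdjunction j).counit.app J') := by
    rwa [h]
  exact quasiIso_of_comp_right _ ((complexAdjunction j).counit.app J')

lemma eq_of_homology_restrict {J : CochainComplex Y.Modules ℤ} {J' : CochainComplex X.Modules ℤ}
    (α : restrictComplex j J ⟶ J') [QuasiIso α] {Z : Closeds X}
    (hs : ∀ (n : ℤ) (V : Y.Opens), V ≤ (Closeds.closure (j '' Z)).compl →
      ∀ s t : Γ(J.homology n, V), s = t)
    (n : ℤ) (V : X.Opens) (hV : V ≤ Z.compl) (s t : Γ(J'.homology n, V)) : s = t := by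
  let e : (J.homology n).restrict j ≅ J'.homology n :=
    (homologyRestrictIso j J n).symm ≪≫ isoOfQuasiIsoAt α n
  have h : ∀ s : Γ(J'.homology n, V), e.hom.sec V (e.inv.sec V s) = s := fun s => by
    rw [← Hom.sec_comp, e.inv_hom_id, Hom.sec_id]
  rw [← h s, ← h t]
  exact congr_arg _ (hs n (j ''ᵁ V) (disjoint_image_closure j hV) _ _)

/-- The heart of the proof: the cone of `φ` is acyclic. Its cohomology is supported on the zero
locus of `I`, and power torsion cocycles of the cone bound because of `hΓ`. -/
theorem quasiIso_homEquiv [IsNoetherian X] [IsNoetherian Y] (Z : Closeds X) (I : Y.IdealSheafData)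
    (hI : (I.support : Set Y) = closure (j '' Z) \ Set.range j)
    {J : CochainComplex Y.Modules ℤ} {J' : CochainComplex X.Modules ℤ} [J.IsKInjective]
    [J'.IsKInjective] (hJ : ∀ n, Injective (J.X n)) (hJ' : ∀ n, Injective (J'.X n))
    (hH : ∀ n, HasLocalizedSections (J.homology n))
    (hs : ∀ (n : ℤ) (V : Y.Opens), V ≤ (Closeds.closure (j '' Z)).compl →
      ∀ s t : Γ(J.homology n, V), s = t)
    (hΓ : (((gamma I).mapHomologicalComplex (ComplexShape.up ℤ)).obj J).Acyclic)
    (α : restrictComplex j J ⟶ J') [QuasiIso α] :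
    QuasiIso ((complexAdjunction j).homEquiv J J' α) := by
  set φ : J ⟶ pushforwardComplex j J' := (complexAdjunction j).homEquiv J J' α
  have hφ' : QuasiIso (((restrictFunctor j).mapHomologicalComplex (ComplexShape.up ℤ)).map φ) :=
    quasiIso_restrict_homEquiv j α
  have hH' : ∀ n, HasLocalizedSections (J'.homology n) := fun n =>
    (hH n).restrict j |>.of_iso ((homologyRestrictIso j J n).symm ≪≫ isoOfQuasiIsoAt α n)
  have hL : ∀ n, Injective ((pushforwardComplex j J').X n) := fun n =>
    Injective.injective_of_adjoint (restrictAdjunction j) (J'.X n)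
  have hflJ : ∀ n, IsFlasque (J.X n) := fun n => isFlasque_of_injective _
  have hflJ' : ∀ n, IsFlasque (J'.X n) := fun n => isFlasque_of_injective _
  have hIj : ∀ x : X, j x ∉ I.support := fun x hx => (hI.le hx).2 ⟨x, rfl⟩
  have hC : (restrictComplex j (mappingCone φ)).Acyclic := by
    have : (mappingCone
        (((restrictFunctor j).mapHomologicalComplex (ComplexShape.up ℤ)).map φ)).Acyclic :=
      acyclic_iff_isLocalBoundary.2 fun n U c hc => isLocalBoundary_mappingCone _ c hc
    exact fun n =>
      (this n).of_iso (mappingCone.mapHomologicalComplexIso φ (restrictFunctor j)).symm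
  have hC' : ∀ (n : ℤ) (V : Y.Opens), (∀ x ∈ V, x ∉ I.support) → ∀ c : Γ((mappingCone φ).X n, V),
      ((mappingCone φ).d n (n + 1)).sec V c = 0 → IsLocalBoundary (mappingCone φ) (n - 1) n c := by
    intro n V hV c hc
    refine .of_local fun x hx => ?_
    -- A point off the support of `I` lies in the image of `j`, where `φ` restricts to a
    -- quasi-isomorphism, or off the closure of `j(Z)`, where both complexes are exact.
    by_cases hxj : x ∈ j.opensRange
    · refine ⟨V ⊓ j.opensRange, inf_le_left, ⟨hx, hxj⟩,
        isLocalBoundary_of_acyclic_restrict j hC inf_le_right _ ?_⟩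
      rw [← Hom.res_sec, hc, map_zero]
    · have hxZ : x ∈ (Closeds.closure (j '' Z)).compl := fun h =>
        hV x hx (hI.ge ⟨h, hxj⟩)
      refine ⟨V ⊓ (Closeds.closure (j '' Z)).compl, inf_le_left, ⟨hx, hxZ⟩,
        isLocalBoundary_mappingCone_of_exact φ ?_ ?_ _ ?_⟩
      · intro n W hW z hz
        obtain ⟨c, rfl⟩ := exists_iCycles_sec_eq rfl z hz
        exact (homologyπ_sec_eq_zero_iff (by simp) c).1 (hs n W (hW.trans inf_le_right) _ _)
      · intro n W hW z hz
        obtain ⟨y, rfl⟩ := exists_d_eq_pushforward j hflJ' hH' (U := W) (fun n T hT =>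
          eq_of_homology_restrict j α hs n T (hT.trans ((j.preimage_mono
            (hW.trans inf_le_right)).trans (preimage_compl_closure_le j Z)))) z hz
        exact isLocalBoundary_d y
      · rw [← Hom.res_sec, hc, map_zero]
  refine quasiIso_of_isLocalBoundary_mappingCone φ fun n U c hc => .of_local fun x hx => ?_
  obtain ⟨V, hVU, hxV, hV⟩ := exists_affine_le hx
  refine ⟨V, hVU, hxV, ?_⟩
  obtain ⟨w, hw⟩ := exists_isPowerTorsion_sub I (injective_mappingCone_X φ hJ hL)
    (fun V hV f => .mappingCone φ (killsClasses_basicOpen hflJ hH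
      (fun n _ hV => liftsBoundaries_of_isKInjective hH n hV)
      (fun n _ hV => liftsClasses_of_isKInjective hH n hV) f hV)
      (killsClasses_pushforward_basicOpen j hflJ' hH' f V)) hC' hV
    (((mappingCone φ).X n).res hVU c) (by rw [← Hom.res_sec, hc, map_zero])
  suffices h : IsLocalBoundary (mappingCone φ) (n - 1) n (((mappingCone φ).X n).res hVU c -
      ((mappingCone φ).d (n - 1) n).sec V w) by
    have := h.sub (isLocalBoundary_d w).neg
    rwa [sub_neg_eq_add, sub_add_cancel] at this
  have hc' : ((mappingCone φ).d n (n + 1)).sec V (((mappingCone φ).X n).res hVU c -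
      ((mappingCone φ).d (n - 1) n).sec V w) = 0 := by
    rw [map_sub, d_sec_d_sec, ← Hom.res_sec, hc, map_zero, sub_zero]
  generalize ((mappingCone φ).X n).res hVU c - ((mappingCone φ).d (n - 1) n).sec V w = c at hw hc'
  obtain ⟨z, p, rfl⟩ := exists_coneMk_eq (j := n + 1) rfl c
  rw [d_coneMk rfl rfl] at hc'
  have hz := (coneMk_eq_zero _ hc').1
  rw [neg_eq_zero] at hz
  have hzI : IsPowerTorsion I z := by
    rw [← fst_coneMk φ rfl z p]
    exact hw.app _
  -- The second component lies in a direct image from `X`, which has no `I`-power torsion.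
  obtain rfl : p = 0 := by
    refine eq_zero_of_isPowerTorsion_pushforward j I hIj p ?_
    rw [← snd_coneMk φ rfl z p]
    exact hw.app _
  intro x hx
  -- It is essential that the primitive `y` be torsion too: its image under `φ` then vanishes for
  -- the same reason.
  obtain ⟨T, hT, hxT, y, hyI, hy⟩ := exists_d_eq_of_isPowerTorsion I hΓ (i := n) rfl hz hzI hx
  have hφy : (φ.f n).sec T y = 0 :=
    eq_zero_of_isPowerTorsion_pushforward j I hIj _ (hyI.app (φ.f n))
  refine ⟨T, hT, hxT, coneMk φ (by simp) (-y) 0, ?_⟩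
  rw [d_coneMk _ rfl, res_coneMk, map_neg, map_neg, neg_neg, hy, hφy, map_zero, map_zero, neg_zero,
    add_zero]

end AlgebraicGeometry.Scheme.Modules

/-! ### The equivalence of derived categories -/

namespace AlgebraicGeometry.Scheme.Modules

open CochainComplex

lemma isZero_restrict_iff {X : Scheme.{u}} (M : X.Modules) (U : X.Opens) :
    IsZero (M.restrict U.ι) ↔ ∀ V ≤ U, ∀ s t : Γ(M, V), s = t := by
  constructor
  · intro h V hV s t
    have e : U.ι ''ᵁ (U.ι ⁻¹ᵁ V) = V := by
      rw [U.ι.image_preimage_eq_opensRange_inf, U.opensRange_ι]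
      exact inf_eq_right.2 hV
    have h₁ : ∀ s : Γ(M, V), M.res e.le s = 0 := fun s =>
      eq_zero_of_isZero (U := U.ι ⁻¹ᵁ V) h _
    have h₂ : ∀ s : Γ(M, V), s = 0 := fun s => by
      have := congr_arg (M.res e.ge) (h₁ s)
      rwa [res_res, res_self, map_zero] at this
    rw [h₂ s, h₂ t]
  · intro h
    refine isZero_of_forall_eq_zero fun V s => ?_
    exact h (U.ι ''ᵁ V) ((U.ι.image_le_opensRange V).trans U.opensRange_ι.le) s 0

section

variable {X : Scheme.{u}} [HasDerivedCategory.{w} X.Modules]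

lemma exists_isAcyclicFibrant_iso (G : DerivedCategory X.Modules) :
    ∃ J : CochainComplex X.Modules ℤ, IsAcyclicFibrant J ∧ Nonempty (DerivedCategory.Q.obj J ≅ G) :=
  ⟨_, isAcyclicFibrant_kInjectiveResolution_obj _,
    ⟨(asIso (DerivedCategory.Q.map (toKInjectiveResolution.app
      (DerivedCategory.Q.objPreimage G)))).symm ≪≫ DerivedCategory.Q.objObjPreimageIso G⟩⟩

variable {J : CochainComplex X.Modules ℤ} {G : DerivedCategory X.Modules}

/-- The cohomology sheaves of an object of the derived category represented by a complex. -/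
noncomputable def homologyIsoOfIso (e : DerivedCategory.Q.obj J ≅ G) (n : ℤ) :
    J.homology n ≅ (DerivedCategory.homologyFunctor X.Modules n).obj G :=
  ((DerivedCategory.homologyFunctorFactors X.Modules n).app J).symm ≪≫
    (DerivedCategory.homologyFunctor X.Modules n).mapIso e

lemma dqc_iff (e : DerivedCategory.Q.obj J ≅ G) :
    Dqc G ↔ ∀ n, HasLocalizedSections (J.homology n) :=
  forall_congr' fun n => ⟨fun _ => (hasLocalizedSections_of_isQuasicoherent _).of_iso
    (homologyIsoOfIso e n).symm, fun h => (h.of_iso (homologyIsoOfIso e n)).isQuasicoherent⟩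

lemma dqcSupp_iff (Z : Closeds X) (e : DerivedCategory.Q.obj J ≅ G) :
    DqcSupp Z G ↔ (∀ n, HasLocalizedSections (J.homology n)) ∧
      ∀ (n : ℤ) (V : X.Opens), V ≤ Z.compl → ∀ s t : Γ(J.homology n, V), s = t := by
  refine and_congr (dqc_iff e) (forall_congr' fun n => ?_)
  rw [← isZero_restrict_iff]
  exact Iso.isZero_iff
    ((restrictFunctor (Scheme.Opens.ι Z.compl)).mapIso (homologyIsoOfIso e n)).symm

end

variable {X Y : Scheme.{u}} (j : X ⟶ Y) [IsOpenImmersion j]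
    [HasDerivedCategory.{w₁} X.Modules] [HasDerivedCategory.{w₂} Y.Modules]

section

variable [HasTotalRightDerived (pushforward j)]

/-- The adjunction between `j^*` and `Rj_*`. -/
noncomputable abbrev derivedRestrictAdjunction :
    derivedRestrict.{w₁, w₂} j ⊣ totalRight (pushforward j) :=
  derivedAdjunction (restrictAdjunction j)

instance : IsIso (derivedRestrictAdjunction.{w₁, w₂} j).counit := by
  have h (F) : IsIso ((derivedRestrictAdjunction.{w₁, w₂} j).counit.app F) := by
    obtain ⟨J, hJ, ⟨e⟩⟩ := exists_isAcyclicFibrant_iso F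
    have := hJ.isKInjective
    rw [← NatTrans.isIso_app_iff_of_iso _ e]
    have h := derivedAdjunction_counit_fac.{w₁, w₂} (restrictAdjunction j) J
    have (n : ℤ) : IsIso (((complexAdjunction j).counit.app J).f n) :=
      inferInstanceAs (IsIso ((restrictAdjunction j).counit.app (J.X n)))
    have : IsIso ((complexAdjunction j).counit.app J) :=
      HomologicalComplex.Hom.isIso_of_components _
    have h' : IsIso ((mapDerivedIso (restrictFunctor j)).hom.app (pushforwardComplex j J) ≫
      DerivedCategory.Q.map ((complexAdjunction j).counit.app J)) := inferInstance
    have h'' : IsIso ((derivedRestrict.{w₁, w₂} j).map ((totalRightUnit (pushforward j)).app J) ≫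
        (derivedRestrictAdjunction.{w₁, w₂} j).counit.app (DerivedCategory.Q.obj J)) :=
      (congr_arg (fun f => IsIso f) h).mpr h'
    exact IsIso.of_isIso_comp_left ((derivedRestrict.{w₁, w₂} j).map
      ((totalRightUnit (pushforward j)).app J)) _
  exact NatIso.isIso_of_isIso_app _

/-- Up to isomorphisms, the derived unit at `J` is the image in the derived category of the explicit
map `J ⟶ j_* J'`, since `J'` computes `Rj_*`. -/
lemma isIso_unit_app {J : CochainComplex Y.Modules ℤ} {J' : CochainComplex X.Modules ℤ}
    [J'.IsKInjective] (α : restrictComplex j J ⟶ J') [QuasiIso α]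
    [QuasiIso ((complexAdjunction j).homEquiv J J' α)] :
    IsIso ((derivedRestrictAdjunction.{w₁, w₂} j).unit.app (DerivedCategory.Q.obj J)) := by
  have h := derivedAdjunction_unit_fac.{w₁, w₂} (restrictAdjunction j) J
  have h₁ : (totalRightUnit (pushforward j)).app (restrictComplex j J) ≫
      (totalRight (pushforward j)).map (DerivedCategory.Q.map α) =
      DerivedCategory.Q.map (((pushforward j).mapHomologicalComplex _).map α) ≫
        (totalRightUnit (pushforward j)).app J' :=
    ((totalRightUnit (pushforward j)).naturality α).symm
  have h₂ : (derivedRestrictAdjunction.{w₁, w₂} j).unit.app (DerivedCategory.Q.obj J) ≫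
      (totalRight (pushforward j)).map ((mapDerivedIso (restrictFunctor j)).hom.app J) ≫
        (totalRight (pushforward j)).map (DerivedCategory.Q.map α) =
      DerivedCategory.Q.map ((complexAdjunction j).homEquiv J J' α) ≫
        (totalRightUnit (pushforward j)).app J' := by
    rw [Adjunction.homEquiv_unit, Functor.map_comp, Category.assoc]
    refine (Category.assoc _ _ _).symm.trans ((congr_arg (· ≫ _) h).trans ?_)
    exact (Category.assoc _ _ _).trans (congr_arg _ h₁)
  have h₃ : IsIso (DerivedCategory.Q.map ((complexAdjunction j).homEquiv J J' α) ≫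
      (totalRightUnit (pushforward j)).app J') := inferInstance
  have h₅ : IsIso ((totalRight (pushforward j)).map
      ((mapDerivedIso.{w₁, w₂} (restrictFunctor j)).hom.app J)) := inferInstance
  have h₆ : IsIso ((totalRight (pushforward j)).map (DerivedCategory.Q.map α)) := inferInstance
  have h₄ := (congr_arg (fun f => IsIso f) h₂).mpr h₃
  exact @IsIso.of_isIso_comp_right _ _ _ _ _ _ _ (@IsIso.comp_isIso _ _ _ _ _ _ _ h₅ h₆) h₄

end

lemma dqcSuppVanishing_totalRight [IsNoetherian X] [HasTotalRightDerived (pushforward j)]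
    (Z : Closeds X) (I : Y.IdealSheafData) [HasTotalRightDerived (gamma I)]
    (hI : (I.support : Set Y) = closure (j '' Z) \ Set.range j)
    {F : DerivedCategory.{w₁} X.Modules} (hF : DqcSupp Z F) :
    DqcSuppVanishing (Closeds.closure (j '' Z)) I ((totalRight (pushforward j)).obj F) := by
  obtain ⟨J, hJ, ⟨e⟩⟩ := exists_isAcyclicFibrant_iso F
  have := hJ.isKInjective
  have hfl : ∀ n, IsFlasque (J.X n) :=
    have := hJ.injective_X
    fun n => isFlasque_of_injective _
  have hL := (hJ.map_of_adjunction (restrictAdjunction j)).isKInjective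
  have hfl' : ∀ n, IsFlasque ((pushforwardComplex j J).X n) :=
    have (n : ℤ) : Injective ((pushforwardComplex j J).X n) :=
      (hJ.map_of_adjunction (restrictAdjunction j)).injective_X n
    fun n => isFlasque_of_injective _
  let e' : DerivedCategory.Q.obj (pushforwardComplex j J) ≅
      (totalRight (pushforward j)).obj F :=
    asIso ((totalRightUnit (pushforward j)).app J) ≪≫ (totalRight (pushforward j)).mapIso e
  obtain ⟨hH, hs⟩ := (dqcSupp_iff Z e).1 hF
  refine ⟨(dqcSupp_iff _ e').2 ⟨hasLocalizedSections_homology_of_killsClasses hfl'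
    fun V _ f => killsClasses_pushforward_basicOpen j hfl hH f V, fun n V hV => ?_⟩, ?_⟩
  · suffices h : ∀ s : Γ((pushforwardComplex j J).homology n, V), s = 0 from
      fun s t => (h s).trans (h t).symm
    refine fun s => eq_of_res_eq _ _ fun x hx => ?_
    obtain ⟨W, hW, hxW, c, hc⟩ := exists_homologyπ_sec_eq s hx
    refine ⟨W, hW, hxW, ?_⟩
    obtain ⟨y, hy⟩ := exists_d_eq_pushforward j hfl hH (U := W) (fun n T hT => hs n T
      (hT.trans ((j.preimage_mono (hW.trans hV)).trans (preimage_compl_closure_le j Z))))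
      (((pushforwardComplex j J).iCycles n).sec W c) (d_sec_iCycles_sec c)
    rw [← hc, map_zero, homologyπ_sec_eq_zero_iff (i := n - 1) (by simp), ← hy]
    exact isLocalBoundary_d y
  -- The direct image complex is K-injective, so it computes `RΓ`, and its subcomplex of torsion
  -- sections is zero term by term.
  · have h₀ : IsZero (((gamma I).mapHomologicalComplex (ComplexShape.up ℤ)).obj
        (pushforwardComplex j J)) := by
      rw [IsZero.iff_id_eq_zero]
      ext n : 1
      refine IsZero.eq_of_src (isZero_of_forall_eq_zero fun U s => Subtype.ext ?_) _ _
      exact eq_zero_of_isPowerTorsion_pushforward j I (fun x hx => (hI.le hx).2 ⟨x, rfl⟩) s.1 s.2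
    refine (DerivedCategory.Q.map_isZero h₀).of_iso ?_
    exact (totalRight (gamma I)).mapIso e'.symm ≪≫
      (asIso ((totalRightUnit (gamma I)).app (pushforwardComplex j J))).symm

lemma dqcSupp_derivedRestrict (Z : Closeds X) {G : DerivedCategory.{w₂} Y.Modules}
    (hG : DqcSupp (Closeds.closure (j '' Z)) G) :
    DqcSupp Z ((derivedRestrict.{w₁, w₂} j).obj G) := by
  obtain ⟨J, hJ, ⟨e⟩⟩ := exists_isAcyclicFibrant_iso G
  obtain ⟨hH, hs⟩ := (dqcSupp_iff _ e).1 hG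
  let e' : DerivedCategory.Q.obj (restrictComplex j J) ≅ (derivedRestrict.{w₁, w₂} j).obj G :=
    ((mapDerivedIso (restrictFunctor j)).app J).symm ≪≫ (derivedRestrict.{w₁, w₂} j).mapIso e
  refine (dqcSupp_iff Z e').2 ⟨fun n => (hH n).restrict j |>.of_iso (homologyRestrictIso j J n).symm,
    fun n V hV => eq_of_homology_restrict j (𝟙 _) hs n V hV⟩

lemma isIso_unit_app_of_dqcSuppVanishing [IsNoetherian X] [IsNoetherian Y]
    [HasTotalRightDerived (pushforward j)]
    (Z : Closeds X) (I : Y.IdealSheafData) [HasTotalRightDerived (gamma I)]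
    (hI : (I.support : Set Y) = closure (j '' Z) \ Set.range j)
    {G : DerivedCategory.{w₂} Y.Modules}
    (hG : DqcSuppVanishing (Closeds.closure (j '' Z)) I G) :
    IsIso ((derivedRestrictAdjunction.{w₁, w₂} j).unit.app G) := by
  obtain ⟨J, hJ, ⟨e⟩⟩ := exists_isAcyclicFibrant_iso G
  have := hJ.isKInjective
  obtain ⟨hH, hs⟩ := (dqcSupp_iff _ e).1 hG.1
  rw [← NatTrans.isIso_app_iff_of_iso _ e]
  have := quasiIso_homEquiv j Z I hI hJ.injective_X (fun n => inferInstance) hH hs ?_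
    (toKInjectiveResolution.app (restrictComplex j J))
  · exact isIso_unit_app j (toKInjectiveResolution.app (restrictComplex j J))
  · intro n
    rw [HomologicalComplex.exactAt_iff_isZero_homology]
    -- As `J` is K-injective, the vanishing of `RΓ` means that the complex of torsion sections of
    -- `J` is acyclic.
    have h : IsZero (DerivedCategory.Q.obj
        (((gamma I).mapHomologicalComplex (ComplexShape.up ℤ)).obj J)) :=
      hG.2.of_iso (asIso ((totalRightUnit (gamma I)).app J) ≪≫ (totalRight (gamma I)).mapIso e)
    exact ((DerivedCategory.homologyFunctor _ n).map_isZero h).of_iso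
      (homologyIsoOfIso (Iso.refl _) n)

end AlgebraicGeometry.Scheme.Modules
theorem mainTheorem6 {X Xbar : Scheme.{u}} [IsNoetherian X] [IsNoetherian Xbar]
    (j : X ⟶ Xbar) [IsOpenImmersion j]
    [HasDerivedCategory.{w₁} X.Modules] [HasDerivedCategory.{w₂} Xbar.Modules]
    (Z : Closeds X)
    (I : Xbar.IdealSheafData) (hI : (I.support : Set Xbar) = closure (j '' Z) \ Set.range j) :
    ∃ (_ : HasTotalRightDerived (Scheme.Modules.pushforward j))
      (_ : HasTotalRightDerived (Scheme.Modules.gamma I))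
      (h₁ : ∀ F : (Scheme.Modules.DqcSupp Z).FullSubcategory,
        Scheme.Modules.DqcSuppVanishing (Closeds.closure (j '' Z)) I
          (((Scheme.Modules.DqcSupp Z).ι ⋙ totalRight (Scheme.Modules.pushforward j)).obj F))
      (h₂ : ∀ G : (Scheme.Modules.DqcSuppVanishing (Closeds.closure (j '' Z)) I).FullSubcategory,
        Scheme.Modules.DqcSupp Z
          (((Scheme.Modules.DqcSuppVanishing (Closeds.closure (j '' Z)) I).ι ⋙
            Scheme.Modules.derivedRestrict j).obj G))
      (e : (Scheme.Modules.DqcSupp Z).FullSubcategory ≌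
        (Scheme.Modules.DqcSuppVanishing (Closeds.closure (j '' Z)) I).FullSubcategory),
      e.functor = (Scheme.Modules.DqcSuppVanishing (Closeds.closure (j '' Z)) I).lift
          ((Scheme.Modules.DqcSupp Z).ι ⋙ totalRight (Scheme.Modules.pushforward j)) h₁ ∧
        e.inverse = (Scheme.Modules.DqcSupp Z).lift
          ((Scheme.Modules.DqcSuppVanishing (Closeds.closure (j '' Z)) I).ι ⋙ Scheme.Modules.derivedRestrict j) h₂ := by
  have d₁ : HasTotalRightDerived (Scheme.Modules.pushforward j) :=
    hasTotalRightDerived_of_isGrothendieckAbelian _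
  have d₂ : HasTotalRightDerived (Scheme.Modules.gamma I) :=
    hasTotalRightDerived_of_isGrothendieckAbelian _
  have h₁ (F : (Scheme.Modules.DqcSupp Z).FullSubcategory) :=
    Scheme.Modules.dqcSuppVanishing_totalRight j Z I hI F.property
  have h₂ (G : (Scheme.Modules.DqcSuppVanishing (Closeds.closure (j '' Z)) I).FullSubcategory) :=
    Scheme.Modules.dqcSupp_derivedRestrict j Z G.property.1
  let P := Scheme.Modules.DqcSupp Z
  let P' := Scheme.Modules.DqcSuppVanishing (Closeds.closure (j '' Z)) I
  let Φ := P'.lift (P.ι ⋙ totalRight (Scheme.Modules.pushforward j)) h₁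
  let Ψ := P.lift (P'.ι ⋙ Scheme.Modules.derivedRestrict j) h₂
  let adj := Scheme.Modules.derivedRestrictAdjunction j
  have hunit (G : P'.FullSubcategory) : IsIso (adj.unit.app G.obj) :=
    Scheme.Modules.isIso_unit_app_of_dqcSuppVanishing j Z I hI G.property
  let η : 𝟭 _ ≅ Φ ⋙ Ψ := NatIso.ofComponents
    (fun F => P.isoMk (asIso (adj.counit.app F.obj)).symm) (fun {F F'} f => by
      apply P.ι.map_injective
      change f.hom ≫ inv (adj.counit.app F'.obj) = inv (adj.counit.app F.obj) ≫ _
      rw [IsIso.eq_inv_comp, ← Category.assoc, IsIso.comp_inv_eq]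
      exact (adj.counit.naturality f.hom).symm)
  let ε : Ψ ⋙ Φ ≅ 𝟭 _ := NatIso.ofComponents
    (fun G => P'.isoMk (asIso (adj.unit.app G.obj)).symm) (fun {G G'} f => by
      apply P'.ι.map_injective
      change _ ≫ inv (adj.unit.app G'.obj) = inv (adj.unit.app G.obj) ≫ f.hom
      rw [IsIso.eq_inv_comp, ← Category.assoc, IsIso.comp_inv_eq]
      exact (adj.unit.naturality f.hom).symm)
  -- `Equivalence.mk` corrects one of the two isomorphisms to satisfy the triangle identity and
  -- leaves the functors untouched.
  exact ⟨d₁, d₂, h₁, h₂, .mk Φ Ψ η ε, rfl, rfl⟩
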